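/- Let $\gamma\ge 1$, and let $\rho_0\ge 0$ (density), $u_0,v_0$ (velocity) be real functions on a neighbourhood of a point $x_0\in\mathbb R^2$, real analytic at $x_0$, with $\rho_0u_0v_0\ne0$ at $x_0$. Let $\kappa_0$ be related to them near $x_0$ by the curvature–density relation $$\Big(\frac{\rho^{\gamma}}{\gamma}\Big)^{2}+(u^2+v^2)\,\frac{\rho^{\gamma+1}}{\gamma}=\kappa ,\qquad (*)$$ that is, $(*)$ holds for $(\rho_0,u_0,v_0,\kappa_0)$. Then there are $T>0$, an open disc $B$ centred at $x_0$, and real analytic functions $\rho>0,\ u,\ v$, a real analytic family of Riemannian metrics $\mathbf g=(g_{ij})$ and a real analytic map $\mathbf y$ into $\mathbb R^3$, all defined on $(-T,T)\times B$, with the following properties. 1. $(\rho,u,v)=(\rho_0,u_0,v_0)$ at $t=0$, and the Gauss curvature of $\mathbf g(0,\cdot)$ is $\kappa_0$. 2. With $p=\rho^\gamma/\gamma$, the compressible Euler equations hold: $$\partial_1(\rho u^2+p)+\partial_2(\rho uv)=-\partial_t(\rho u),\quad \partial_1(\rho uv)+\partial_2(\rho v^2+p)=-\partial_t(\rho v),\quad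 \partial_1(\rho u)+\partial_2(\rho v)=-\partial_t\rho .$$ 3. Put $L=\rho v^2+p$, $M=-\rho uv$, $N=\rho u^2+p$, and let $\Gamma^k_{ij}$ be the Christoffel symbols and $\kappa$ the Gauss curvature of $\mathbf g(t,\cdot)$. Then the Gauss–Codazzi equations $$\partial_1N-\partial_2M=-\Gamma^1_{22}L+2\Gamma^1_{12}M-\Gamma^1_{11}N,\quad \partial_1M-\partial_2L=\Gamma^2_{22}L-2\Gamma^2_{12}M+\Gamma^2_{11}N,\quad LN-M^2=\kappa$$ hold, as do $\partial_{11}N-2\partial_{12}M+\partial_{22}L=\partial_{tt}\rho$ and $$\partial_t(\rho u)=\Gamma^1_{22}L-2\Gamma^1_{12}M+\Gamma^1_{11}N,\qquad \partial_t(\rho v)=\Gamma^2_{22}L-2\Gamma^2_{12}M+\Gamma^2_{11}N,$$ and $(\rho,u,v,\kappa)$ satisfies $(*)$ on all of $(-T,T)\times B$. 4. For every $t\in(-T,T)$ the map $\mathbf y(t,\cdot):B\to\mathbb R^3$ is an isometric immersion of $(B,\mathbf g(t,\cdot))$, i.e. $\partial_i\mathbf y\cdot\partial_j\mathbf y=g_{ij}$,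 and with $\mathbf n=\partial_1\mathbf y\times\partial_2\mathbf y/|\partial_1\mathbf y\times\partial_2\mathbf y|$ its second fundamental form is given by $$(\mathbf n\cdot\partial_{11}\mathbf y,\ \mathbf n\cdot\partial_{12}\mathbf y,\ \mathbf n\cdot\partial_{22}\mathbf y)=\sqrt{\det\mathbf g}\;(L,M,N).$$ -/

import Mathlib

open scoped Topology ContDiff

noncomputable section

namespace FluidGeometry

/-- The coordinate plane, with coordinates indexed by `0` and `1` (the usual `x₁` and `x₂`). -/
abbrev Plane := EuclideanSpace ℝ (Fin 2)

/-- Three-dimensional Euclidean space. -/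
abbrev Space := EuclideanSpace ℝ (Fin 3)

/-- The partial derivative in the `i`-th coordinate of a function on the plane. -/
def pd {F : Type*} [NormedAddCommGroup F] [NormedSpace ℝ F] (i : Fin 2) (f : Plane → F)
    (x : Plane) : F :=
  fderiv ℝ f x (EuclideanSpace.single i 1)

/-! ### Intrinsic geometry of a metric given in coordinates -/

/-- The Christoffel symbol `Γ^k_{ij} = ½ g^{kl} (∂_j g_{il} + ∂_i g_{jl} - ∂_l g_{ij})`. -/
def christoffel (g : Plane → Matrix (Fin 2) (Fin 2) ℝ) (k i j : Fin 2) (x : Plane) : ℝ :=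
  1 / 2 * ∑ l, (g x)⁻¹ k l *
    (pd j (fun z => g z i l) x + pd i (fun z => g z j l) x - pd l (fun z => g z i j) x)

/-- The Riemann curvature tensor
`R_{iljk} = g_{lm} (∂_k Γ^m_{ij} - ∂_j Γ^m_{ik} + Γ^n_{ij} Γ^m_{nk} - Γ^n_{ik} Γ^m_{nj})`. -/
def riemann (g : Plane → Matrix (Fin 2) (Fin 2) ℝ) (i l j k : Fin 2) (x : Plane) : ℝ :=
  ∑ m, g x l m * (pd k (christoffel g m i j) x - pd j (christoffel g m i k) x +
    ∑ n, (christoffel g n i j x * christoffel g m n k x -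
      christoffel g n i k x * christoffel g m n j x))

/-- The Gauss curvature `R_{1212} / det g` (indices start at `0` here). -/
def gaussCurvature (g : Plane → Matrix (Fin 2) (Fin 2) ℝ) (x : Plane) : ℝ :=
  riemann g 0 1 0 1 x / (g x).det

/-- The Gauss and Codazzi equations at `x` for the metric `g` and functions `L`, `M`, `N`. They are
written for the second fundamental form divided by `√(det g)`: if `h₁₁, h₁₂, h₂₂` are the
coefficients of the second fundamental form, then `(L, M, N) = (h₁₁, h₁₂, h₂₂) / √(det g)`. -/
structure GaussCodazziAt (g : Plane → Matrix (Fin 2) (Fin 2) ℝ) (L M N : Plane → ℝ)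
    (x : Plane) : Prop where
  codazzi_one : pd 0 N x - pd 1 M x =
    -christoffel g 0 1 1 x * L x + 2 * christoffel g 0 0 1 x * M x - christoffel g 0 0 0 x * N x
  codazzi_two : pd 0 M x - pd 1 L x =
    christoffel g 1 1 1 x * L x - 2 * christoffel g 1 0 1 x * M x + christoffel g 1 0 0 x * N x
  gauss : L x * N x - M x ^ 2 = gaussCurvature g x

/-! ### Parametrized surfaces in space -/

/-- `y` restricted to `U` is a smooth isometric immersion of `(U, g)`, with `g` a Riemannian
metric on `U`. -/
structure IsIsometricImmersionOn (g : Plane → Matrix (Fin 2) (Fin 2) ℝ) (y : Plane → Space)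
    (U : Set Plane) : Prop where
  smooth : ContDiffOn ℝ ∞ y U
  posDef : ∀ x ∈ U, (g x).PosDef
  immersion : ∀ x ∈ U, Function.Injective (fderiv ℝ y x)
  isometric : ∀ x ∈ U, ∀ i j, inner ℝ (pd i y x) (pd j y x) = g x i j

/-- The vector product `∂₁y × ∂₂y`. -/
def normalVector (y : Plane → Space) (x : Plane) : Space :=
  WithLp.toLp 2 (crossProduct (WithLp.ofLp (pd 0 y x)) (WithLp.ofLp (pd 1 y x)))

/-- The unit normal `n = ∂₁y × ∂₂y / |∂₁y × ∂₂y|`. -/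
def unitNormal (y : Plane → Space) (x : Plane) : Space :=
  ‖normalVector y x‖⁻¹ • normalVector y x

/-- The coefficient `n · ∂_i ∂_j y` of the second fundamental form. -/
def secondForm (y : Plane → Space) (i j : Fin 2) (x : Plane) : ℝ :=
  inner ℝ (unitNormal y x) (pd i (pd j y) x)

/-! ### The compressible Euler equations and their geometric variables -/

/-- The pressure law `p = ρ ^ γ / γ`. -/
def pressure (γ ρ : ℝ) : ℝ := ρ ^ γ / γ

/-- The compressible Euler equations (momentum and mass) at time `t` and position `x`. -/
structure CompressibleEulerAt (γ : ℝ) (ρ u v : ℝ → Plane → ℝ) (t : ℝ) (x : Plane) : Prop where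
  momentum_one :
    pd 0 (fun z => ρ t z * u t z ^ 2 + pressure γ (ρ t z)) x + pd 1 (fun z => ρ t z * u t z * v t z) x
      = -deriv (fun s => ρ s x * u s x) t
  momentum_two :
    pd 0 (fun z => ρ t z * u t z * v t z) x + pd 1 (fun z => ρ t z * v t z ^ 2 + pressure γ (ρ t z)) x
      = -deriv (fun s => ρ s x * v s x) t
  mass :
    pd 0 (fun z => ρ t z * u t z) x + pd 1 (fun z => ρ t z * v t z) x
      = -deriv (fun s => ρ s x) t

/-- `L = ρ v² + p`. -/
def formL (γ : ℝ) (ρ _u v : Plane → ℝ) (x : Plane) : ℝ := ρ x * v x ^ 2 + pressure γ (ρ x)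

/-- `M = -ρ u v`. -/
def formM (ρ u v : Plane → ℝ) (x : Plane) : ℝ := -(ρ x * u x * v x)

/-- `N = ρ u² + p`. -/
def formN (γ : ℝ) (ρ u _v : Plane → ℝ) (x : Plane) : ℝ := ρ x * u x ^ 2 + pressure γ (ρ x)

/-- The relation `p² + p ρ q² = κ`, where `p = ρ ^ γ / γ` and `q² = u² + v²`, between curvature
and density. -/
def CurvatureDensity (γ ρ u v κ : ℝ) : Prop :=
  (ρ ^ γ / γ) ^ 2 + (u ^ 2 + v ^ 2) * (ρ ^ (γ + 1) / γ) = κ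

/-- The evolution equations expressing the rate of change of the momentum through the geometry,
`∂_t (ρu) = Γ¹₂₂ L - 2 Γ¹₁₂ M + Γ¹₁₁ N` and `∂_t (ρv) = Γ²₂₂ L - 2 Γ²₁₂ M + Γ²₁₁ N`, together with
the divergence of the momentum equations, `∂₁₁ N - 2 ∂₁₂ M + ∂₂₂ L = ∂_tt ρ`. -/
structure GeometricFlowAt (γ : ℝ) (ρ u v : ℝ → Plane → ℝ)
    (g : ℝ → Plane → Matrix (Fin 2) (Fin 2) ℝ) (t : ℝ) (x : Plane) : Prop where
  evolution : ∀ k : Fin 2, deriv (fun s => ρ s x * ![u s x, v s x] k) t =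
    christoffel (g t) k 1 1 x * formL γ (ρ t) (u t) (v t) x
      - 2 * christoffel (g t) k 0 1 x * formM (ρ t) (u t) (v t) x
      + christoffel (g t) k 0 0 x * formN γ (ρ t) (u t) (v t) x
  divergence :
    pd 0 (pd 0 (formN γ (ρ t) (u t) (v t))) x - 2 * pd 0 (pd 1 (formM (ρ t) (u t) (v t))) x
      + pd 1 (pd 1 (formL γ (ρ t) (u t) (v t))) x
      = deriv (deriv (fun s => ρ s x)) t

end FluidGeometry

end

open FluidGeometry

open FluidGeometry

/-! The metric is never solved for. The Euler equations are closed by themselves, so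
Cauchy–Kovalevskaya gives `ρ, u, v` and hence analytic `L, M, N`. For each `t` one then constructs a
surface with second fundamental form `√(det g) (L, M, N)` and takes `g` to be its first fundamental
form. Gauss and Codazzi hold because the surface exists. Moreover `LN - M²` is identically `p² +
pρ(u² + v²)`, so the Gauss equation is the curvature–density relation, and at `t = 0` it forces the
curvature to be `κ₀`. The left sides of the Codazzi equations are the momentum fluxes, so comparison
with Euler yields the evolution equations for `ρu` and `ρv`.

The surface comes from the Weingarten equations `n₁ = n × (L y₂ - M y₁)`, `n₂ = n × (M y₂ - N y₁)`.
Since `N = ρu² + p > 0`, they can be solved for the `x₁`-derivatives: `y₁ = (M/N) y₂ + (1/N) n × n₂`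
and `n₁ = (M/N) n₂ + (L - M²/N) n × y₂`. This is a Cauchy problem in the direction `x₁`, with `t` a
mere parameter (`exists_surface_system`, `exists_surface`). The constraints `|n| = 1` and `n ⊥ y₂`
satisfy linear transport equations, so they persist from the initial line
(`eqOn_zero_of_transport`).

Both Cauchy problems are brought to the form `∂ₛ w = T (w, w, D w) + S (D w)` with multilinear `T`,
`S` (`cauchy_kovalevskaya`). The formal series in `s` converges by majorants: the normalized `k`-th
space derivative of the `n`-th coefficient is bounded by the coefficient of `sⁿ zᵏ` in `C c(As +
Rz)`, where `c` generates the Catalan numbers. Products cost only a factor 4 in these weights, and a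
space derivative is traded for a time derivative. Variable coefficients are absorbed as additional
unknowns (`cauchy_kovalevskaya_coeff`). -/

/-! ### Catalan majorants. -/

/-- The coefficients of the majorant series `c (s + z)`, with `c` the generating function of the
Catalan numbers. -/
def catalanWeight (n k : ℕ) : ℕ := (n + k).choose n * catalan (n + k)

theorem catalan_succ_le (n : ℕ) : catalan (n + 1) ≤ 4 * catalan n := by
  have h1 := succ_mul_catalan_eq_centralBinom (n + 1)
  have h2 := succ_mul_catalan_eq_centralBinom n
  have h3 := Nat.succ_mul_centralBinom_succ n
  rw [← h1, ← h2] at h3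
  have h4 : (n + 1 + 1) * catalan (n + 1) = 2 * (2 * n + 1) * catalan n := by
    have : 0 < n + 1 := Nat.succ_pos n
    apply Nat.eq_of_mul_eq_mul_left this
    linarith
  have h5 : (n + 1 + 1) * catalan (n + 1) ≤ (n + 1 + 1) * (4 * catalan n) := by
    rw [h4]; nlinarith [Nat.zero_le (catalan n)]
  exact Nat.le_of_mul_le_mul_left h5 (by omega)

theorem catalan_le_four_pow (n : ℕ) : catalan n ≤ 4 ^ n := by
  induction n with
  | zero => simp
  | succ n ih => rw [pow_succ]; linarith [catalan_succ_le n]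

theorem catalan_pos (n : ℕ) : 0 < catalan n := by
  have h := succ_mul_catalan_eq_centralBinom n
  exact Nat.pos_of_ne_zero fun h0 => (Nat.centralBinom_pos n).ne' (by rw [← h, h0, mul_zero])

theorem catalanWeight_le (n k : ℕ) : catalanWeight n k ≤ 8 ^ n * 8 ^ k := by
  rw [← pow_add, show 8 = 2 * 4 from rfl, mul_pow]
  exact Nat.mul_le_mul (Nat.choose_le_two_pow _ _) (catalan_le_four_pow _)

/-- The generating function depends on `s + z` only, so its two partial derivatives agree; this lets
a loss of one space derivative be paid for by one step in time. -/
theorem succ_mul_catalanWeight (n k : ℕ) :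
    (k + 1) * catalanWeight n (k + 1) = (n + 1) * catalanWeight (n + 1) k := by
  have h : (k + 1) * (n + (k + 1)).choose n = (n + 1) * (n + 1 + k).choose (n + 1) := by
    have h1 := Nat.choose_succ_right_eq (n + k + 1) n
    rw [show n + k + 1 - n = k + 1 by omega] at h1
    rw [show n + (k + 1) = n + k + 1 by ring, show n + 1 + k = n + k + 1 by ring]
    linarith
  unfold catalanWeight
  rw [show n + 1 + k = n + (k + 1) by ring] at *
  rw [← mul_assoc, h, mul_assoc]

-- The square of `c (s + z)` has Catalan numbers shifted by one as coefficients, and consecutive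
-- Catalan numbers have ratio at most 4. The splittings of `n` and of `k` are sorted by `c = a + b`,
-- a splitting of `n + k`.
open Finset in
theorem sum_catalanWeight_mul_le (n k : ℕ) :
    ∑ a ∈ antidiagonal n, ∑ b ∈ antidiagonal k, catalanWeight a.1 b.1 * catalanWeight a.2 b.2
      ≤ 4 * catalanWeight n k := by
  have key : ∑ a ∈ antidiagonal n, ∑ b ∈ antidiagonal k,
      catalanWeight a.1 b.1 * catalanWeight a.2 b.2 ≤
      ∑ a ∈ antidiagonal n, ∑ c ∈ antidiagonal (n + k),
        (catalan c.1 * catalan c.2) * (c.1.choose a.1 * c.2.choose a.2) := by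
    refine sum_le_sum fun a ha => ?_
    rw [HasAntidiagonal.mem_antidiagonal] at ha
    have hinj : Set.InjOn (fun b : ℕ × ℕ => (a.1 + b.1, a.2 + b.2)) (antidiagonal k) := by
      intro b _ b' _ h
      simp only [Prod.mk.injEq, Nat.add_left_cancel_iff] at h
      exact Prod.ext h.1 h.2
    have hsub : (antidiagonal k).image (fun b : ℕ × ℕ => (a.1 + b.1, a.2 + b.2)) ⊆
        antidiagonal (n + k) := by
      intro c hc
      obtain ⟨b, hb, rfl⟩ := mem_image.1 hc
      rw [HasAntidiagonal.mem_antidiagonal] at hb ⊢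
      dsimp only; omega
    refine le_trans (le_of_eq ?_) (sum_le_sum_of_subset hsub)
    rw [sum_image hinj]
    refine sum_congr rfl fun b _ => ?_
    simp only [catalanWeight]; ring
  refine key.trans ?_
  rw [sum_comm]
  -- Vandermonde's identity: the sum over `a` does not depend on `c`.
  have : ∀ c ∈ antidiagonal (n + k), ∑ a ∈ antidiagonal n,
      (catalan c.1 * catalan c.2) * (c.1.choose a.1 * c.2.choose a.2) =
      (catalan c.1 * catalan c.2) * (n + k).choose n := by
    intro c hc
    rw [← mul_sum, ← Nat.add_choose_eq, HasAntidiagonal.mem_antidiagonal.1 hc]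
  rw [sum_congr rfl this, ← sum_mul, ← catalan_succ']
  calc _ ≤ 4 * catalan (n + k) * (n + k).choose n := Nat.mul_le_mul_right _ (catalan_succ_le _)
    _ = _ := by rw [catalanWeight]; ring

/-- The weights majorizing the `n`-th coefficient in time and the `k`-th one in space. -/
noncomputable def majorant (A R : ℝ) (n k : ℕ) : ℝ := A ^ n * R ^ k * catalanWeight n k

theorem majorant_nonneg {A R : ℝ} (hA : 0 ≤ A) (hR : 0 ≤ R) (n k : ℕ) : 0 ≤ majorant A R n k := by
  unfold majorant; positivity

theorem succ_mul_majorant (A R : ℝ) (n k : ℕ) :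
    A * ((k + 1) * majorant A R n (k + 1)) = R * ((n + 1) * majorant A R (n + 1) k) := by
  have h : ((k + 1 : ℕ) : ℝ) * catalanWeight n (k + 1) =
      ((n + 1 : ℕ) : ℝ) * catalanWeight (n + 1) k := mod_cast succ_mul_catalanWeight n k
  push_cast at h
  unfold majorant
  linear_combination A ^ (n + 1) * R ^ (k + 1) * h

open Finset in
theorem sum_majorant_mul_le {A R : ℝ} (hA : 0 ≤ A) (hR : 0 ≤ R) (n k : ℕ) :
    ∑ a ∈ antidiagonal n, ∑ b ∈ antidiagonal k, majorant A R a.1 b.1 * majorant A R a.2 b.2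
      ≤ 4 * majorant A R n k := by
  have h : ((∑ a ∈ antidiagonal n, ∑ b ∈ antidiagonal k,
      catalanWeight a.1 b.1 * catalanWeight a.2 b.2 : ℕ) : ℝ) ≤ ((4 * catalanWeight n k : ℕ) : ℝ) :=
    mod_cast sum_catalanWeight_mul_le n k
  push_cast at h
  calc _ = A ^ n * R ^ k * ∑ a ∈ antidiagonal n, ∑ b ∈ antidiagonal k,
      (catalanWeight a.1 b.1 * catalanWeight a.2 b.2 : ℝ) := by
        rw [mul_sum]
        refine sum_congr rfl fun a ha => ?_
        rw [mul_sum]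
        refine sum_congr rfl fun b hb => ?_
        rw [← HasAntidiagonal.mem_antidiagonal.1 ha, ← HasAntidiagonal.mem_antidiagonal.1 hb, majorant, majorant, pow_add, pow_add]
        ring
    _ ≤ A ^ n * R ^ k * (4 * catalanWeight n k) := by gcongr
    _ = _ := by rw [majorant]; ring

-- The derivative on the second factor becomes a shift `a.2 ↦ a.2 + 1` with weight `a.2 + 1 ≤ n +
-- 1`; what remains is part of the plain product sum at level `n + 1`.
open Finset in
theorem sum_majorant_mul_succ_le {A R : ℝ} (hA : 0 < A) (hR : 0 ≤ R) (n k : ℕ) :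
    ∑ a ∈ antidiagonal n, ∑ b ∈ antidiagonal k,
      majorant A R a.1 b.1 * ((b.2 + 1) * majorant A R a.2 (b.2 + 1))
      ≤ 4 * (R / A) * ((n + 1) * majorant A R (n + 1) k) := by
  have hs : ∀ m l : ℕ, (l + 1) * majorant A R m (l + 1) =
      (R / A) * ((m + 1) * majorant A R (m + 1) l) := by
    intro m l
    have := succ_mul_majorant A R m l
    field_simp
    linarith
  calc _ ≤ ∑ a ∈ antidiagonal n, (R / A) * (n + 1) * ∑ b ∈ antidiagonal k,
      majorant A R a.1 b.1 * majorant A R (a.2 + 1) b.2 := by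
        refine sum_le_sum fun a ha => ?_
        rw [mul_sum]
        refine sum_le_sum fun b _ => ?_
        rw [hs]
        have h1 := majorant_nonneg hA.le hR a.1 b.1
        have h2 := majorant_nonneg hA.le hR (a.2 + 1) b.2
        have h3 : (a.2 : ℝ) ≤ n := by
          have := HasAntidiagonal.mem_antidiagonal.1 ha
          exact_mod_cast (by omega : a.2 ≤ n)
        calc _ = (R / A) * (a.2 + 1) * (majorant A R a.1 b.1 * majorant A R (a.2 + 1) b.2) := by
              ring
          _ ≤ _ := by gcongr
    _ ≤ (R / A) * (n + 1) * ∑ a ∈ antidiagonal (n + 1), ∑ b ∈ antidiagonal k,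
      majorant A R a.1 b.1 * majorant A R a.2 b.2 := by
        rw [← mul_sum, Nat.sum_antidiagonal_succ']
        gcongr
        exact le_add_of_nonneg_left (sum_nonneg fun b _ => mul_nonneg
          (majorant_nonneg hA.le hR _ _) (majorant_nonneg hA.le hR _ _))
    _ ≤ (R / A) * (n + 1) * (4 * majorant A R (n + 1) k) := by
        gcongr
        exact sum_majorant_mul_le hA.le hR _ _
    _ = _ := by ring

/-! ### Calculus of bounds on normalized derivatives. -/

section TaylorBound

variable {V F G H : Type*} [NormedAddCommGroup V] [NormedSpace ℝ V] [NormedAddCommGroup F]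
  [NormedSpace ℝ F] [NormedAddCommGroup G] [NormedSpace ℝ G] [NormedAddCommGroup H]
  [NormedSpace ℝ H] {s : Set V}

open scoped Nat in
/-- `f` is smooth on `s` and its normalized derivatives `D^k f / k!` are bounded by `b k` there. -/
structure TaylorBound (f : V → F) (s : Set V) (b : ℕ → ℝ) : Prop where
  contDiffOn : ContDiffOn ℝ ∞ f s
  bound : ∀ k, ∀ x ∈ s, ‖iteratedFDerivWithin ℝ k f s x‖ ≤ k ! * b k

namespace TaylorBound

variable {f : V → F} {g : V → G} {a b : ℕ → ℝ}

theorem mono (h : TaylorBound f s a) (hab : ∀ k, a k ≤ b k) : TaylorBound f s b :=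
  ⟨h.contDiffOn, fun k x hx => (h.bound k x hx).trans (by gcongr; exact hab k)⟩

theorem nonneg (h : TaylorBound f s a) {x : V} (hx : x ∈ s) (k : ℕ) : 0 ≤ a k := by
  have h1 := (norm_nonneg _).trans (h.bound k x hx)
  have h2 : (0 : ℝ) < k.factorial := mod_cast k.factorial_pos
  exact nonneg_of_mul_nonneg_right h1 h2

theorem congr {f' : V → F} (h : TaylorBound f s a) (hf : Set.EqOn f' f s) : TaylorBound f' s a :=
  ⟨h.contDiffOn.congr hf, fun k x hx => by
    rw [iteratedFDerivWithin_congr hf hx]; exact h.bound k x hx⟩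

theorem mono_set {t : Set V} (h : TaylorBound f s a) (hs : IsOpen s) (ht : IsOpen t)
    (hts : t ⊆ s) : TaylorBound f t a :=
  ⟨h.contDiffOn.mono hts, fun k x hx => by
    rw [iteratedFDerivWithin_of_isOpen k ht hx, ← iteratedFDerivWithin_of_isOpen k hs (hts hx)]
    exact h.bound k x (hts hx)⟩

theorem add {f' : V → F} (hs : IsOpen s) (h : TaylorBound f s a) (h' : TaylorBound f' s b) :
    TaylorBound (fun x => f x + f' x) s (fun k => a k + b k) := by
  refine ⟨h.contDiffOn.add h'.contDiffOn, fun k x hx => ?_⟩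
  rw [fun_iteratedFDerivWithin_add_apply ((h.contDiffOn.of_le (mod_cast le_top)) x hx)
    ((h'.contDiffOn.of_le (mod_cast le_top)) x hx) hs.uniqueDiffOn hx, mul_add]
  exact (norm_add_le _ _).trans (add_le_add (h.bound k x hx) (h'.bound k x hx))

theorem sum {ι : Type*} {f : ι → V → F} {a : ι → ℕ → ℝ} (hs : IsOpen s) (t : Finset ι)
    (h : ∀ i ∈ t, TaylorBound (f i) s (a i)) :
    TaylorBound (fun x => ∑ i ∈ t, f i x) s (fun k => ∑ i ∈ t, a i k) := by
  classical
  induction t using Finset.induction_on with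
  | empty =>
    refine ⟨by simpa using contDiffOn_const, fun k x _ => ?_⟩
    simp only [Finset.sum_empty, mul_zero]
    rw [iteratedFDerivWithin_fun_zero]
    simp
  | insert i t hi ih =>
    simp only [Finset.sum_insert hi]
    exact (h i (Finset.mem_insert_self _ _)).add hs
      (ih fun j hj => h j (Finset.mem_insert_of_mem hj))

theorem clm_comp (hs : IsOpen s) (S : F →L[ℝ] G) (h : TaylorBound f s a) :
    TaylorBound (fun x => S (f x)) s (fun k => ‖S‖ * a k) := by
  refine ⟨S.contDiff.comp_contDiffOn h.contDiffOn, fun k x hx => ?_⟩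
  have := S.iteratedFDerivWithin_comp_left (i := k) (h.contDiffOn x hx) hs.uniqueDiffOn hx
    (mod_cast le_top)
  rw [show (fun x => S (f x)) = S ∘ f from rfl, this]
  refine (S.norm_compContinuousMultilinearMap_le _).trans ?_
  calc _ ≤ ‖S‖ * (k.factorial * a k) := by gcongr; exact h.bound k x hx
    _ = _ := by ring

theorem const_smul (hs : IsOpen s) (c : ℝ) (h : TaylorBound f s a) :
    TaylorBound (fun x => c • f x) s (fun k => |c| * a k) := by
  refine ⟨h.contDiffOn.const_smul c, fun k x hx => ?_⟩
  rw [show (fun x => c • f x) = c • f from rfl, iteratedFDerivWithin_const_smul_apply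
    ((h.contDiffOn.of_le (mod_cast le_top)) x hx) hs.uniqueDiffOn hx, norm_smul, Real.norm_eq_abs]
  calc _ ≤ |c| * (k.factorial * a k) := by gcongr; exact h.bound k x hx
    _ = _ := by ring

open Finset in
theorem bilinear (hs : IsOpen s) (B : F →L[ℝ] G →L[ℝ] H) (hf : TaylorBound f s a)
    (hg : TaylorBound g s b) :
    TaylorBound (fun x => B (f x) (g x)) s
      (fun k => ‖B‖ * ∑ p ∈ antidiagonal k, a p.1 * b p.2) := by
  refine ⟨B.isBoundedBilinearMap.contDiff.comp₂_contDiffOn hf.contDiffOn hg.contDiffOn,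
    fun k x hx => ?_⟩
  refine (B.norm_iteratedFDerivWithin_le_of_bilinear hf.contDiffOn hg.contDiffOn
    hs.uniqueDiffOn hx (n := k) (mod_cast le_top)).trans ?_
  rw [← Finset.Nat.sum_antidiagonal_eq_sum_range_succ_mk (f := fun p => (k.choose p.1 : ℝ) *
    ‖iteratedFDerivWithin ℝ p.1 f s x‖ * ‖iteratedFDerivWithin ℝ p.2 g s x‖)]
  rw [mul_left_comm]
  gcongr
  rw [mul_sum]
  refine sum_le_sum fun p hp => ?_
  have hp' := HasAntidiagonal.mem_antidiagonal.1 hp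
  have h1 : (k.choose p.1 : ℝ) * p.1.factorial * p.2.factorial = k.factorial := by
    rw [← hp', Nat.choose_symm_add]
    exact mod_cast Nat.add_choose_mul_factorial_mul_factorial p.1 p.2
  calc _ ≤ (k.choose p.1 : ℝ) * (p.1.factorial * a p.1) * (p.2.factorial * b p.2) := by
        have := hf.bound p.1 x hx
        have := hg.bound p.2 x hx
        have := hf.nonneg hx p.1
        gcongr
    _ = _ := by rw [← h1]; ring

theorem fderivWithin (hs : IsOpen s) (h : TaylorBound f s a) :
    TaylorBound (fderivWithin ℝ f s) s (fun k => (k + 1) * a (k + 1)) := by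
  refine ⟨h.contDiffOn.fderivWithin hs.uniqueDiffOn (by simp), fun k x hx => ?_⟩
  rw [norm_iteratedFDerivWithin_fderivWithin hs.uniqueDiffOn hx]
  refine (h.bound (k + 1) x hx).trans (le_of_eq ?_)
  rw [Nat.factorial_succ]; push_cast; ring

end TaylorBound

end TaylorBound

/-! ### Majorization of the formal power series in time. -/

section CauchyKovalevskaya

set_option maxSynthPendingDepth 3

variable {X E : Type*} [NormedAddCommGroup X] [NormedSpace ℝ X] [NormedAddCommGroup E]
  [NormedSpace ℝ E]

/-- The coefficients of the power series in time of the solution of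
`∂ₛ w = T (w, w, D w) + S (D w)`, `w (0, ·) = w₀`. -/
noncomputable def ckCoeff (U : Set X) (T : E →L[ℝ] E →L[ℝ] (X →L[ℝ] E) →L[ℝ] E)
    (S : (X →L[ℝ] E) →L[ℝ] E) (w₀ : X → E) : ℕ → X → E
  | 0 => w₀
  | n + 1 => fun x => ((n : ℝ) + 1)⁻¹ • (S (fderivWithin ℝ (ckCoeff U T S w₀ n) U x) +
      ∑ i : Fin (n + 1), (∑ j : Fin (i + 1), T (ckCoeff U T S w₀ j x)
        (ckCoeff U T S w₀ (i - j) x)) (fderivWithin ℝ (ckCoeff U T S w₀ (n - i)) U x))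
  decreasing_by all_goals omega

variable {U : Set X} {T : E →L[ℝ] E →L[ℝ] (X →L[ℝ] E) →L[ℝ] E} {S : (X →L[ℝ] E) →L[ℝ] E}
  {w₀ : X → E}

-- The sums over `Fin` in the definition carry the index bounds that make the recursion well
-- founded; antidiagonals match the product estimates.
open Finset in
theorem ckCoeff_succ (n : ℕ) (x : X) : ckCoeff U T S w₀ (n + 1) x = ((n : ℝ) + 1)⁻¹ •
    (S (fderivWithin ℝ (ckCoeff U T S w₀ n) U x) + ∑ a ∈ antidiagonal n,
      (∑ c ∈ antidiagonal a.1, T (ckCoeff U T S w₀ c.1 x) (ckCoeff U T S w₀ c.2 x))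
        (fderivWithin ℝ (ckCoeff U T S w₀ a.2) U x)) := by
  simp only [ckCoeff, Nat.sum_antidiagonal_eq_sum_range_succ_mk, sum_range]

open Finset in
theorem taylorBound_sum_bilinear {F G H : Type*} [NormedAddCommGroup F] [NormedSpace ℝ F]
    [NormedAddCommGroup G] [NormedSpace ℝ G] [NormedAddCommGroup H] [NormedSpace ℝ H]
    (hU : IsOpen U) (B : F →L[ℝ] G →L[ℝ] H) {f : ℕ → X → F} {g : ℕ → X → G} {N : ℕ}
    {M M' A R : ℝ} (hM : 0 ≤ M) (hM' : 0 ≤ M') (hA : 0 ≤ A) (hR : 0 ≤ R)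
    (hf : ∀ n ≤ N, TaylorBound (f n) U fun k => M * majorant A R n k)
    (hg : ∀ n ≤ N, TaylorBound (g n) U fun k => M' * majorant A R n k) :
    TaylorBound (fun x => ∑ a ∈ antidiagonal N, B (f a.1 x) (g a.2 x)) U
      fun k => 4 * ‖B‖ * M * M' * majorant A R N k := by
  refine (TaylorBound.sum hU _ fun a ha => (hf a.1 ?_).bilinear hU B (hg a.2 ?_)).mono fun k => ?_
  · have := HasAntidiagonal.mem_antidiagonal.1 ha; omega
  · have := HasAntidiagonal.mem_antidiagonal.1 ha; omega
  calc _ = ‖B‖ * M * M' * ∑ a ∈ antidiagonal N, ∑ b ∈ antidiagonal k,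
        majorant A R a.1 b.1 * majorant A R a.2 b.2 := by
        simp only [mul_sum]
        refine sum_congr rfl fun a _ => sum_congr rfl fun b _ => by ring
    _ ≤ ‖B‖ * M * M' * (4 * majorant A R N k) := by
        gcongr; exact sum_majorant_mul_le hA hR N k
    _ = _ := by ring

-- The derivative raises the time index to `N + 1` and produces a factor `N + 1`, which the inverse
-- in the recursion for `ckCoeff` cancels.
open Finset in
theorem taylorBound_sum_bilinear_fderivWithin {F G H : Type*} [NormedAddCommGroup F]
    [NormedSpace ℝ F] [NormedAddCommGroup G] [NormedSpace ℝ G] [NormedAddCommGroup H]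
    [NormedSpace ℝ H] (hU : IsOpen U) (B : F →L[ℝ] (X →L[ℝ] G) →L[ℝ] H) {f : ℕ → X → F}
    {g : ℕ → X → G} {N : ℕ} {M M' A R : ℝ} (hM : 0 ≤ M) (hM' : 0 ≤ M') (hA : 0 < A) (hR : 0 ≤ R)
    (hf : ∀ n ≤ N, TaylorBound (f n) U fun k => M * majorant A R n k)
    (hg : ∀ n ≤ N, TaylorBound (g n) U fun k => M' * majorant A R n k) :
    TaylorBound (fun x => ∑ a ∈ antidiagonal N, B (f a.1 x) (fderivWithin ℝ (g a.2) U x)) U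
      fun k => 4 * ‖B‖ * M * M' * (R / A) * ((N + 1) * majorant A R (N + 1) k) := by
  refine (TaylorBound.sum hU _ fun a ha =>
    (hf a.1 ?_).bilinear hU B ((hg a.2 ?_).fderivWithin hU)).mono fun k => ?_
  · have := HasAntidiagonal.mem_antidiagonal.1 ha; omega
  · have := HasAntidiagonal.mem_antidiagonal.1 ha; omega
  calc _ = ‖B‖ * M * M' * ∑ a ∈ antidiagonal N, ∑ b ∈ antidiagonal k,
        majorant A R a.1 b.1 * ((b.2 + 1) * majorant A R a.2 (b.2 + 1)) := by
        simp only [mul_sum]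
        refine sum_congr rfl fun a _ => sum_congr rfl fun b _ => by ring
    _ ≤ ‖B‖ * M * M' * (4 * (R / A) * ((N + 1) * majorant A R (N + 1) k)) := by
        gcongr; exact sum_majorant_mul_succ_le hA hR N k
    _ = _ := by ring

/-- The coefficients of the time series are majorized by the Catalan weights. -/
theorem exists_taylorBound_ckCoeff (hU : IsOpen U) {C R : ℝ} (hC : 0 ≤ C) (hR : 0 ≤ R)
    (h₀ : TaylorBound w₀ U fun k => C * R ^ k) :
    ∃ A > 0, ∀ n, TaylorBound (ckCoeff U T S w₀ n) U fun k => C * majorant A R n k := by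
  -- The induction closes as soon as `R * (‖S‖ + 16 * ‖T‖ * C ^ 2) ≤ A`. The 16 is 4 · 4, from the
  -- two products in the trilinear term; the added 1 keeps `A` positive when `R = 0`.
  set A : ℝ := R * (‖S‖ + 16 * ‖T‖ * C ^ 2) + 1 with hAdef
  have hA : 0 < A := by positivity
  refine ⟨A, hA, fun n => ?_⟩
  induction n using Nat.strong_induction_on with
  | _ n ih =>
    rcases n with _ | n
    · rw [ckCoeff]
      refine h₀.mono fun k => ?_
      gcongr
      have : (1 : ℝ) ≤ catalanWeight 0 k := by
        simp only [catalanWeight, zero_add, Nat.choose_zero_right, one_mul]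
        exact_mod_cast catalan_pos k
      rw [majorant, pow_zero, one_mul]
      exact le_mul_of_one_le_right (by positivity) this
    · have ih' : ∀ m ≤ n, TaylorBound (ckCoeff U T S w₀ m) U fun k => C * majorant A R m k :=
        fun m hm => ih m (by omega)
      have h1 : ∀ m ≤ n, TaylorBound (fun x => ∑ c ∈ Finset.HasAntidiagonal.antidiagonal m,
          T (ckCoeff U T S w₀ c.1 x) (ckCoeff U T S w₀ c.2 x)) U
          fun k => (4 * ‖T‖ * C * C) * majorant A R m k := fun m hm =>
        taylorBound_sum_bilinear hU T hC hC hA.le hR (fun j hj => ih' j (hj.trans hm))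
          (fun j hj => ih' j (hj.trans hm))
      have h2 := taylorBound_sum_bilinear_fderivWithin hU (ContinuousLinearMap.id ℝ _)
        (by positivity) hC hA hR h1 ih'
      have h3 := (((ih' n le_rfl).fderivWithin hU).clm_comp hU S)
      have h4 := ((h3.add hU h2).const_smul hU ((n : ℝ) + 1)⁻¹)
      refine (h4.congr fun x _ => by simp [ckCoeff_succ]).mono fun k => ?_
      have hm := majorant_nonneg hA.le hR (n + 1) k
      have hs : (k + 1) * majorant A R n (k + 1) =
          (R / A) * ((n + 1) * majorant A R (n + 1) k) := by
        have := succ_mul_majorant A R n k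
        field_simp
        linarith
      have hid : ‖ContinuousLinearMap.id ℝ ((X →L[ℝ] E) →L[ℝ] E)‖ ≤ 1 :=
        ContinuousLinearMap.norm_id_le
      rw [abs_of_pos (by positivity)]
      calc _ = ((n : ℝ) + 1)⁻¹ * (‖S‖ * C * ((k + 1) * majorant A R n (k + 1)) +
            ‖ContinuousLinearMap.id ℝ ((X →L[ℝ] E) →L[ℝ] E)‖ * (16 * ‖T‖ * C * C * C * (R / A) *
              ((n + 1) * majorant A R (n + 1) k))) := by ring
        _ ≤ ((n : ℝ) + 1)⁻¹ * (‖S‖ * C * ((k + 1) * majorant A R n (k + 1)) +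
            1 * (16 * ‖T‖ * C * C * C * (R / A) *
              ((n + 1) * majorant A R (n + 1) k))) := by gcongr
        _ = (R * (‖S‖ + 16 * ‖T‖ * C ^ 2)) / A * (C * majorant A R (n + 1) k) := by
            rw [hs]; field_simp
        _ ≤ 1 * (C * majorant A R (n + 1) k) := by
            gcongr
            rw [div_le_one hA, hAdef]; linarith
        _ = _ := one_mul _

end CauchyKovalevskaya

/-! ### From derivative bounds to analyticity and back. -/

section PowerSeries

variable {V F : Type*} [NormedAddCommGroup V] [NormedSpace ℝ V] [NormedAddCommGroup F]
  [NormedSpace ℝ F] [CompleteSpace F]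

open Metric

/-- A function with geometrically bounded normalized derivatives is the sum of its Taylor series. -/
theorem TaylorBound.hasSum {f : V → F} {z : V} {r C Q : ℝ}
    (h : TaylorBound f (ball z r) fun k => C * Q ^ k) (hQ : 0 ≤ Q) {y : V} (hy : ‖y‖ < r)
    (hQy : Q * ‖y‖ < 1) :
    HasSum (fun k => (k.factorial : ℝ)⁻¹ • iteratedFDeriv ℝ k f z (fun _ => y)) (f (z + y)) := by
  have hr : 0 < r := (norm_nonneg y).trans_lt hy
  have hC : 0 ≤ C := by simpa using h.nonneg (mem_ball_self hr) 0
  have hmem : ∀ t ∈ Set.Icc (0 : ℝ) 1, z + t • y ∈ ball z r := by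
    intro t ht
    rw [mem_ball, dist_eq_norm, add_sub_cancel_left, norm_smul, Real.norm_of_nonneg ht.1]
    exact (mul_le_of_le_one_left (norm_nonneg _) ht.2).trans_lt hy
  have hb : ∀ k, ∀ x ∈ ball z r, ∀ v : V, ‖iteratedFDeriv ℝ k f x (fun _ => v)‖ ≤
      k.factorial * (C * Q ^ k) * ‖v‖ ^ k := by
    intro k x hx v
    have h1 := h.bound k x hx
    rw [iteratedFDerivWithin_of_isOpen k isOpen_ball hx] at h1
    have h2 := (iteratedFDeriv ℝ k f x).le_opNorm fun _ => v
    rw [Finset.prod_const, Finset.card_fin] at h2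
    exact h2.trans (by gcongr)
  have hsum : Summable fun k =>
      (k.factorial : ℝ)⁻¹ • iteratedFDeriv ℝ k f z (fun _ => y) := by
    refine Summable.of_norm_bounded (g := fun k => C * (Q * ‖y‖) ^ k)
      ((summable_geometric_of_lt_one (by positivity) hQy).mul_left C) fun k => ?_
    rw [norm_smul, norm_inv, Real.norm_natCast, inv_mul_le_iff₀ (by positivity)]
    refine (hb k z (mem_ball_self hr) y).trans (le_of_eq ?_)
    rw [mul_pow]; ring
  refine hsum.hasSum_iff_tendsto_nat.2 ?_
  rw [← Filter.tendsto_add_atTop_iff_nat 1, tendsto_iff_norm_sub_tendsto_zero]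
  -- Estimating `(1 - t) ^ n` by 1 in the integral remainder costs a factor `n + 1`, which the
  -- geometric decay absorbs.
  have hlim : Filter.Tendsto (fun n : ℕ => C * ((n + 1 : ℕ) * (Q * ‖y‖) ^ (n + 1)))
      Filter.atTop (𝓝 0) := by
    have := (Filter.tendsto_add_atTop_iff_nat 1).2
      (tendsto_self_mul_const_pow_of_lt_one (by positivity) hQy)
    simpa using this.const_mul C
  refine squeeze_zero (fun _ => norm_nonneg _) (fun n => ?_) hlim
  have htaylor := map_add_eq_sum_add_integral_iteratedFDeriv (f := f) (x := z) (y := y) (n := n)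
    fun t ht => (h.contDiffOn.contDiffAt (isOpen_ball.mem_nhds (hmem t ht))).of_le
      (mod_cast le_top)
  rw [htaylor, ← norm_neg, neg_sub, add_sub_cancel_left, norm_smul, norm_inv, Real.norm_natCast,
    inv_mul_le_iff₀ (by positivity)]
  have := intervalIntegral.norm_integral_le_of_norm_le_const (a := 0) (b := 1)
    (f := fun t : ℝ => (1 - t) ^ n • iteratedFDeriv ℝ (n + 1) f (z + t • y) (fun _ => y))
    (C := (n + 1).factorial * (C * Q ^ (n + 1)) * ‖y‖ ^ (n + 1)) fun t ht => ?_
  · refine this.trans (le_of_eq ?_)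
    rw [Nat.factorial_succ]; push_cast
    rw [mul_pow]; norm_num; ring
  · rw [Set.uIoc_of_le zero_le_one] at ht
    rw [norm_smul, norm_pow]
    have h1 : ‖1 - t‖ ^ n ≤ 1 := pow_le_one₀ (norm_nonneg _) (by
      rw [Real.norm_eq_abs, abs_le]; constructor <;> linarith [ht.1, ht.2])
    exact (mul_le_of_le_one_left (norm_nonneg _) h1).trans (hb _ _ (hmem t ⟨ht.1.le, ht.2⟩) _)

/-- An analytic function has geometrically bounded normalized derivatives near each point. -/
theorem AnalyticAt.exists_taylorBound {f : V → F} {x : V} (hf : AnalyticAt ℝ f x) :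
    ∃ r > 0, ∃ C ≥ 0, ∃ R ≥ 0, TaylorBound f (ball x r) fun k => C * R ^ k := by
  obtain ⟨p, r, hp⟩ := hf
  obtain ⟨ρ, hρ0, hρ⟩ := ENNReal.lt_iff_exists_nnreal_btwn.1 hp.r_pos
  -- Half of the radius is spent on moving the centre to `y`, the other half on the expansion about
  -- `y`.
  set q : NNReal := ρ / 2 with hq
  have hq0 : 0 < q := half_pos (by exact_mod_cast hρ0)
  have hqr : (q + q : ENNReal) < r := by
    rw [← ENNReal.coe_add, hq, add_halves]; exact hρ
  have hqr' : (q : ENNReal) < r := lt_of_le_of_lt (le_add_of_nonneg_left (zero_le)) hqr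
  have hs := p.changeOriginSeries_summable_aux₁ (hqr.trans_le hp.r_le)
  set C := ∑' s : Σ k l : ℕ, { s : Finset (Fin (k + l)) // s.card = l },
    ‖p (s.1 + s.2.1)‖₊ * q ^ s.2.1 * q ^ s.1 with hC
  refine ⟨q, hq0, C, C.2, (q : ℝ)⁻¹, by positivity, ?_, fun k y hy => ?_⟩
  · intro y hy
    refine (hp.analyticAt_of_mem ?_).contDiffAt.contDiffWithinAt
    rw [mem_eball, edist_nndist]
    refine lt_trans ?_ hqr'
    exact_mod_cast (mem_ball.1 hy : (nndist y x : ℝ) < q)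
  · rw [iteratedFDerivWithin_of_isOpen k isOpen_ball hy]
    have hyq : ‖y - x‖₊ < q := by
      have := mem_ball.1 hy
      rw [dist_eq_norm] at this
      exact_mod_cast this
    have hyr : (‖y - x‖₊ : ENNReal) < r := lt_trans (by exact_mod_cast hyq) hqr'
    have hp' := hp.changeOrigin hyr
    rw [add_sub_cancel] at hp'
    have hk : ‖p.changeOrigin (y - x) k‖₊ * q ^ k ≤ C := by
      have h1 := p.nnnorm_changeOrigin_le k (hyr.trans_le hp.r_le)
      have h2 := (NNReal.summable_sigma.1 hs).2
      have h2' := (NNReal.summable_sigma.1 hs).1 k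
      have h3 : ∑' s : Σ l : ℕ, { s : Finset (Fin (k + l)) // s.card = l },
          ‖p (k + s.1)‖₊ * q ^ s.1 * q ^ k ≤ C := by
        rw [hC, (hs.tsum_sigma' fun i => (NNReal.summable_sigma.1 hs).1 i)]
        exact h2.le_tsum' k
      refine le_trans ?_ h3
      rw [NNReal.tsum_mul_right]
      gcongr
      refine h1.trans (Summable.tsum_le_tsum (fun s => by gcongr) ?_ ?_)
      · refine NNReal.summable_of_le (fun s => ?_)
          (p.changeOriginSeries_summable_aux₂ (hqr'.trans_le hp.r_le) k)
        gcongr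
      · exact p.changeOriginSeries_summable_aux₂ (hqr'.trans_le hp.r_le) k
    have hk' : ‖p.changeOrigin (y - x) k‖ ≤ C * (q : ℝ)⁻¹ ^ k := by
      rw [inv_pow, ← div_eq_mul_inv, le_div_iff₀ (by positivity)]
      exact_mod_cast hk
    refine ContinuousMultilinearMap.opNorm_le_bound (by positivity) fun v => ?_
    -- The `k`-th derivative is the sum of the `k`-th coefficient over all permutations of its
    -- arguments, whence the factor `k!`.
    rw [hp'.iteratedFDeriv_eq_sum_of_completeSpace]
    refine (norm_sum_le _ _).trans ?_
    have hterm : ∀ σ : Equiv.Perm (Fin k), ‖p.changeOrigin (y - x) k fun i => v (σ i)‖ ≤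
        C * (q : ℝ)⁻¹ ^ k * ∏ i, ‖v i‖ := by
      intro σ
      refine ((p.changeOrigin (y - x) k).le_opNorm _).trans ?_
      rw [Equiv.prod_comp σ fun i => ‖v i‖]
      gcongr
    refine (Finset.sum_le_sum fun σ _ => hterm σ).trans (le_of_eq ?_)
    rw [Finset.sum_const, Finset.card_univ, Fintype.card_perm, Fintype.card_fin, nsmul_eq_mul]
    ring

/-- A series of functions whose normalized derivatives have a summable geometric bound is
analytic, and can be differentiated termwise. -/
theorem analyticOnNhd_tsum {f : ℕ → V → F} {z : V} {r Q : ℝ} {c : ℕ → ℝ} (hQ : 0 ≤ Q)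
    (hc : Summable c) (hf : ∀ n, TaylorBound (f n) (ball z r) fun k => c n * Q ^ k) :
    AnalyticOnNhd ℝ (fun x => ∑' n, f n x) (ball z r) := by
  intro x hx
  have hr : 0 < r - dist x z := sub_pos.2 hx
  have hc0 : ∀ n, 0 ≤ c n := fun n => by simpa using (hf n).nonneg hx 0
  -- The second entry gives `Q * ρ < 1`, also when `Q = 0`.
  set ρ : ℝ := min (r - dist x z) (2 * Q + 1)⁻¹ with hρ
  have hρ0 : 0 < ρ := lt_min hr (by positivity)
  have hQρ : Q * ρ < 1 := by
    calc Q * ρ ≤ Q * (2 * Q + 1)⁻¹ := by gcongr; exact min_le_right _ _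
      _ < 1 := by rw [← div_eq_mul_inv, div_lt_one (by positivity)]; linarith
  have hball : ball x (r - dist x z) ⊆ ball z r := ball_subset_ball' (by linarith)
  have hf' : ∀ n, TaylorBound (f n) (ball x (r - dist x z)) fun k => c n * Q ^ k :=
    fun n => (hf n).mono_set isOpen_ball isOpen_ball hball
  have hbound : ∀ n k, ‖(k.factorial : ℝ)⁻¹ • iteratedFDeriv ℝ k (f n) x‖ ≤ c n * Q ^ k := by
    intro n k
    have := (hf n).bound k x hx
    rw [iteratedFDerivWithin_of_isOpen k isOpen_ball hx] at this
    rwa [norm_smul, norm_inv, Real.norm_natCast, inv_mul_le_iff₀ (by positivity)]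
  have hsumm : ∀ k, Summable fun n => (k.factorial : ℝ)⁻¹ • iteratedFDeriv ℝ k (f n) x :=
    fun k => Summable.of_norm_bounded (hc.mul_right _) fun n => hbound n k
  let P : FormalMultilinearSeries ℝ V F :=
    fun k => ∑' n, (k.factorial : ℝ)⁻¹ • iteratedFDeriv ℝ k (f n) x
  have hP : ∀ k, ‖P k‖ ≤ (∑' n, c n) * Q ^ k := fun k => by
    rw [← tsum_mul_right]
    exact tsum_of_norm_bounded (hc.mul_right _).hasSum fun n => hbound n k
  have hsc : 0 ≤ ∑' n, c n := tsum_nonneg hc0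
  refine ⟨P, ENNReal.ofReal ρ, ?_, by simpa using hρ0, ?_⟩
  · refine P.le_radius_of_bound (∑' n, c n) fun k => ?_
    rw [Real.coe_toNNReal _ hρ0.le]
    calc _ ≤ (∑' n, c n) * Q ^ k * ρ ^ k := by gcongr; exact hP k
      _ = (∑' n, c n) * (Q * ρ) ^ k := by rw [mul_pow]; ring
      _ ≤ (∑' n, c n) * 1 := by
        gcongr
        exact pow_le_one₀ (by positivity) hQρ.le
      _ = _ := mul_one _
  · intro y hy
    have hyρ : ‖y‖ < ρ := by
      rw [eball_ofReal] at hy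
      simpa using hy
    have hyr : ‖y‖ < r - dist x z := hyρ.trans_le (min_le_left _ _)
    have hQy : Q * ‖y‖ < 1 := lt_of_le_of_lt (by gcongr) hQρ
    -- Summed over `k` first, this double family gives the values `f n (x + y)`; summed over `n`
    -- first, it gives the power series `P`.
    set u : ℕ × ℕ → F := fun nk =>
      (nk.2.factorial : ℝ)⁻¹ • iteratedFDeriv ℝ nk.2 (f nk.1) x (fun _ => y) with hu
    have hus : Summable u := by
      refine Summable.of_norm_bounded (g := fun nk : ℕ × ℕ => c nk.1 * (Q * ‖y‖) ^ nk.2)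
        (hc.mul_of_nonneg (summable_geometric_of_lt_one (by positivity) hQy) hc0
          fun _ => by positivity) fun nk => ?_
      have h1 := ((nk.2.factorial : ℝ)⁻¹ • iteratedFDeriv ℝ nk.2 (f nk.1) x).le_opNorm fun _ => y
      rw [Finset.prod_const, Finset.card_fin] at h1
      refine h1.trans ?_
      rw [mul_pow, ← mul_assoc]
      gcongr
      exact hbound _ _
    have h1 : HasSum u (∑' n, f n (x + y)) := by
      have := hus.hasSum.prod_fiberwise fun n => (hf' n).hasSum hQ hyr hQy
      rw [this.tsum_eq]
      exact hus.hasSum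
    have h2 := ((Equiv.prodComm ℕ ℕ).hasSum_iff.2 h1)
    refine h2.prod_fiberwise fun k => ?_
    have := ContinuousMultilinearMap.hasSum_eval (hsumm k).hasSum fun _ => y
    exact this

theorem hasFDerivAt_tsum_taylorBound {f : ℕ → V → F} {z : V} {r Q : ℝ} {c : ℕ → ℝ}
    (hc : Summable c) (hf : ∀ n, TaylorBound (f n) (ball z r) fun k => c n * Q ^ k) {x : V}
    (hx : x ∈ ball z r) :
    HasFDerivAt (fun x => ∑' n, f n x) (∑' n, fderiv ℝ (f n) x) x := by
  have hb : ∀ n, ∀ y ∈ ball z r, ‖fderiv ℝ (f n) y‖ ≤ c n * Q := by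
    intro n y hy
    have := (hf n).bound 1 y hy
    rw [iteratedFDerivWithin_of_isOpen 1 isOpen_ball hy, norm_iteratedFDeriv_one] at this
    simpa using this
  refine hasFDerivAt_tsum_of_isPreconnected (hc.mul_right Q) isOpen_ball
    (convex_ball z r).isPreconnected (fun n y hy => ?_) hb hx ?_ hx
  · exact (((hf n).contDiffOn.contDiffAt (isOpen_ball.mem_nhds hy)).differentiableAt
      (by simp)).hasFDerivAt
  · refine Summable.of_norm_bounded hc fun n => ?_
    have := (hf n).bound 0 x hx
    simpa using this

end PowerSeries

/-! ### Cauchy products under continuous bilinear maps. -/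

section BilinearCauchyProduct

variable {F G H : Type*} [NormedAddCommGroup F] [NormedSpace ℝ F] [NormedAddCommGroup G]
  [NormedSpace ℝ G] [NormedAddCommGroup H] [NormedSpace ℝ H]

open Finset in
/-- The Cauchy product of two series for a continuous bilinear map. -/
theorem ContinuousLinearMap.hasSum_cauchyProduct [CompleteSpace H] (B : F →L[ℝ] G →L[ℝ] H)
    {f : ℕ → F} {g : ℕ → G} {a : F} {b : G} (hf : Summable fun n => ‖f n‖)
    (hg : Summable fun n => ‖g n‖) (ha : HasSum f a) (hb : HasSum g b) :
    HasSum (fun n => ∑ p ∈ antidiagonal n, B (f p.1) (g p.2)) (B a b) := by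
  have hs : Summable fun p : ℕ × ℕ => B (f p.1) (g p.2) := by
    refine Summable.of_norm_bounded
      ((hf.mul_of_nonneg hg (fun _ => norm_nonneg _) fun _ => norm_nonneg _).mul_left ‖B‖)
      fun p => ?_
    rw [← mul_assoc]
    exact B.le_opNorm₂ _ _
  have h1 : HasSum (fun p : ℕ × ℕ => B (f p.1) (g p.2)) (B a b) := by
    have h2 := hs.hasSum.prod_fiberwise fun n => (B (f n)).hasSum hb
    have h3 : HasSum (fun n => B (f n) b) (B a b) := (B.flip b).hasSum ha
    rw [h3.unique h2]
    exact hs.hasSum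
  have h4 := (HasAntidiagonal.sigmaAntidiagonalEquivProd (A := ℕ)).hasSum_iff.2 h1
  refine h4.sigma fun n => ?_
  have := hasSum_fintype fun p : antidiagonal n => B (f p.1.1) (g p.1.2)
  rw [Finset.sum_coe_sort (antidiagonal n) fun p => B (f p.1) (g p.2)] at this
  exact this

-- Absolute convergence allows the product to be multiplied again: the trilinear term is two
-- successive Cauchy products.
open Finset in
theorem ContinuousLinearMap.summable_norm_cauchyProduct (B : F →L[ℝ] G →L[ℝ] H)
    {f : ℕ → F} {g : ℕ → G} (hf : Summable fun n => ‖f n‖) (hg : Summable fun n => ‖g n‖) :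
    Summable fun n => ‖∑ p ∈ antidiagonal n, B (f p.1) (g p.2)‖ := by
  have hs := (summable_norm_sum_mul_antidiagonal_of_summable_norm hf.norm hg.norm).mul_left ‖B‖
  refine Summable.of_nonneg_of_le (fun _ => norm_nonneg _) (fun n => ?_) hs
  rw [Real.norm_of_nonneg (sum_nonneg fun p _ => by positivity), mul_sum]
  refine (norm_sum_le _ _).trans (sum_le_sum fun p _ => ?_)
  rw [← mul_assoc]
  exact B.le_opNorm₂ _ _

end BilinearCauchyProduct

/-! ### Convergence of the series and the Cauchy–Kovalevskaya theorem. -/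

section CauchyKovalevskaya

set_option maxSynthPendingDepth 3

variable {X E : Type*} [NormedAddCommGroup X] [NormedSpace ℝ X] [NormedAddCommGroup E]
  [NormedSpace ℝ E]

open Metric

theorem TaylorBound.comp_clm {V W F : Type*} [NormedAddCommGroup V] [NormedSpace ℝ V]
    [NormedAddCommGroup W] [NormedSpace ℝ W] [NormedAddCommGroup F] [NormedSpace ℝ F]
    {f : V → F} {s : Set V} {b : ℕ → ℝ} (h : TaylorBound f s b) (hs : IsOpen s) (g : W →L[ℝ] V)
    (hg : ‖g‖ ≤ 1) : TaylorBound (fun x => f (g x)) (g ⁻¹' s) b := by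
  have hs' := hs.preimage g.continuous
  refine ⟨h.contDiffOn.comp g.contDiff.contDiffOn fun _ hx => hx, fun k x hx => ?_⟩
  have := g.iteratedFDerivWithin_comp_right h.contDiffOn hs.uniqueDiffOn hs'.uniqueDiffOn hx
    (i := k) (mod_cast le_top)
  rw [show (fun x => f (g x)) = f ∘ g from rfl, this]
  refine (ContinuousMultilinearMap.norm_compContinuousLinearMap_le _ _).trans ?_
  rw [Finset.prod_const]
  exact (mul_le_of_le_one_right (norm_nonneg _) (pow_le_one₀ (norm_nonneg _) hg)).trans
    (h.bound k _ hx)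

theorem taylorBound_pow {δ : ℝ} (n : ℕ) :
    TaylorBound (fun s : ℝ => s ^ n) (ball 0 δ) fun k => n.choose k * δ ^ (n - k) := by
  refine ⟨contDiff_id.pow n |>.contDiffOn, fun k s hs => ?_⟩
  rw [iteratedFDerivWithin_of_isOpen k isOpen_ball hs, norm_iteratedFDeriv_eq_norm_iteratedDeriv,
    iteratedDeriv_pow, norm_mul, norm_pow, Real.norm_natCast, Nat.descFactorial_eq_factorial_mul_choose]
  rw [mem_ball_zero_iff] at hs
  push_cast
  rw [mul_assoc]
  gcongr

open Finset in
/-- Normalized derivatives of the terms `sⁿ wₙ(x)` of a time series. -/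
theorem TaylorBound.time_series_term {w : X → E} {x₀ : X} {r δ C A R Q : ℝ} {n : ℕ} (hδr : δ ≤ r)
    (hδ : 0 < δ) (hC : 0 ≤ C) (hA : 0 ≤ A) (hR : 0 ≤ R) (hQ : 0 < Q) (hRQ : R ≤ Q)
    (hAδ : A * (δ + Q⁻¹) ≤ 1 / 2)
    (h : TaylorBound w (ball x₀ r) fun k => C * (A ^ n * R ^ k)) :
    TaylorBound (fun z : ℝ × X => z.1 ^ n • w z.2) (ball (0, x₀) δ)
      fun k => C * (1 / 2) ^ n * Q ^ k := by
  have h1 : TaylorBound (fun z : ℝ × X => z.1 ^ n) (ball (0, x₀) δ)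
      fun k => n.choose k * δ ^ (n - k) :=
    ((taylorBound_pow n).comp_clm isOpen_ball (ContinuousLinearMap.fst ℝ ℝ X)
      (ContinuousLinearMap.norm_fst_le ℝ ℝ X)).mono_set
      (isOpen_ball.preimage (ContinuousLinearMap.continuous _)) isOpen_ball fun z hz => by
        rw [← ball_prod_same] at hz; exact hz.1
  have h2 : TaylorBound (fun z : ℝ × X => w z.2) (ball (0, x₀) δ)
      fun k => C * (A ^ n * R ^ k) :=
    (h.comp_clm isOpen_ball (ContinuousLinearMap.snd ℝ ℝ X)
      (ContinuousLinearMap.norm_snd_le ℝ ℝ X)).mono_set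
      (isOpen_ball.preimage (ContinuousLinearMap.continuous _)) isOpen_ball fun z hz => by
        rw [← ball_prod_same] at hz; exact ball_subset_ball hδr hz.2
  refine (h1.bilinear isOpen_ball (ContinuousLinearMap.lsmul ℝ ℝ) h2).mono fun k => ?_
  have hlsmul : ‖(ContinuousLinearMap.lsmul ℝ ℝ : ℝ →L[ℝ] E →L[ℝ] E)‖ ≤ 1 :=
    ContinuousLinearMap.opNorm_lsmul_le
  -- The `i` derivatives falling on `sⁿ` leave a factor `Q⁻¹ ^ i` once `Q ^ k` is taken out, so a
  -- truncated binomial expansion appears; `A ^ n` then reduces it to `(1 / 2) ^ n`.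
  have hbin : ∑ i ∈ range (k + 1), (n.choose i : ℝ) * δ ^ (n - i) * Q⁻¹ ^ i ≤ (δ + Q⁻¹) ^ n := by
    rw [add_comm δ, add_pow]
    calc _ ≤ ∑ i ∈ range (max k n + 1), (n.choose i : ℝ) * δ ^ (n - i) * Q⁻¹ ^ i :=
          sum_le_sum_of_subset_of_nonneg (range_mono (by omega)) fun _ _ _ => by positivity
      _ = ∑ i ∈ range (n + 1), (n.choose i : ℝ) * δ ^ (n - i) * Q⁻¹ ^ i := by
          refine (sum_subset (range_mono (by omega)) fun i _ hi => ?_).symm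
          rw [Nat.choose_eq_zero_of_lt (by simpa using hi)]; simp
      _ = _ := sum_congr rfl fun i _ => by ring
  calc _ ≤ 1 * ∑ p ∈ antidiagonal k,
        n.choose p.1 * δ ^ (n - p.1) * (C * (A ^ n * R ^ p.2)) := by
        have : 0 ≤ ∑ p ∈ antidiagonal k,
          n.choose p.1 * δ ^ (n - p.1) * (C * (A ^ n * R ^ p.2)) :=
            sum_nonneg fun p _ => by positivity
        gcongr
    _ ≤ ∑ p ∈ antidiagonal k, C * A ^ n * Q ^ k * (n.choose p.1 * δ ^ (n - p.1) * Q⁻¹ ^ p.1) := by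
        rw [one_mul]
        refine sum_le_sum fun p hp => ?_
        have hk : k = p.1 + p.2 := (HasAntidiagonal.mem_antidiagonal.1 hp).symm
        have hpow : Q ^ k * Q⁻¹ ^ p.1 = Q ^ p.2 := by
          rw [hk, pow_add, inv_pow]; field_simp
        calc _ ≤ n.choose p.1 * δ ^ (n - p.1) * (C * (A ^ n * Q ^ p.2)) := by gcongr
          _ = _ := by rw [← hpow]; ring
    _ ≤ C * A ^ n * Q ^ k * (δ + Q⁻¹) ^ n := by
        rw [← mul_sum, Nat.sum_antidiagonal_eq_sum_range_succ_mk]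
        gcongr
    _ = C * Q ^ k * (A * (δ + Q⁻¹)) ^ n := by rw [mul_pow]; ring
    _ ≤ C * Q ^ k * (1 / 2) ^ n := by gcongr
    _ = _ := by ring

open Finset in
/-- **Cauchy–Kovalevskaya** for the equation `∂ₛ w = T (w, w, D w) + S (D w)`, with `T` trilinear
and `S` linear: the initial value problem with data analytic at `x₀` has a solution that is analytic
near `(0, x₀)`. -/
theorem cauchy_kovalevskaya [CompleteSpace E] (T : E →L[ℝ] E →L[ℝ] (X →L[ℝ] E) →L[ℝ] E)
    (S : (X →L[ℝ] E) →L[ℝ] E) {w₀ : X → E} {x₀ : X} (hw₀ : AnalyticAt ℝ w₀ x₀) :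
    ∃ δ > 0, ∃ w : ℝ × X → E, AnalyticOnNhd ℝ w (ball (0, x₀) δ) ∧
      (∀ x, w (0, x) = w₀ x) ∧ ∀ z ∈ ball ((0 : ℝ), x₀) δ, fderiv ℝ w z (1, 0) =
        T (w z) (w z) ((fderiv ℝ w z).comp (ContinuousLinearMap.inr ℝ ℝ X)) +
          S ((fderiv ℝ w z).comp (ContinuousLinearMap.inr ℝ ℝ X)) := by
  obtain ⟨r, hr, C, hC, R, hR, h₀⟩ := hw₀.exists_taylorBound
  obtain ⟨A, hA, hb⟩ := exists_taylorBound_ckCoeff (T := T) (S := S) isOpen_ball hC hR h₀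
  set W := ckCoeff (ball x₀ r) T S w₀ with hW
  have hb' : ∀ n, TaylorBound (W n) (ball x₀ r) fun k => C * ((8 * A) ^ n * (8 * R) ^ k) := by
    intro n
    refine (hb n).mono fun k => ?_
    have : (catalanWeight n k : ℝ) ≤ 8 ^ n * 8 ^ k := mod_cast catalanWeight_le n k
    rw [majorant, mul_pow, mul_pow]
    calc _ ≤ C * (A ^ n * R ^ k * (8 ^ n * 8 ^ k)) := by gcongr
      _ = _ := by ring
  -- The factors 8 come from `catalanWeight_le`. Both `δ` and `Q⁻¹` are at most `(32 * A)⁻¹`, so `8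
  -- * A * (δ + Q⁻¹) ≤ 1 / 2`.
  set Q := 8 * R + 32 * A with hQ
  set δ := min r (32 * A)⁻¹ with hδ
  have hQ0 : 0 < Q := by positivity
  have hδ0 : 0 < δ := lt_min hr (by positivity)
  have hAδ : 8 * A * (δ + Q⁻¹) ≤ 1 / 2 := by
    have h1 : δ ≤ (32 * A)⁻¹ := min_le_right _ _
    have h2 : Q⁻¹ ≤ (32 * A)⁻¹ := by gcongr; linarith
    calc _ ≤ 8 * A * ((32 * A)⁻¹ + (32 * A)⁻¹) := by gcongr
      _ = 1 / 2 := by field_simp; norm_num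
  have hterm : ∀ n, TaylorBound (fun z : ℝ × X => z.1 ^ n • W n z.2) (ball (0, x₀) δ)
      fun k => C * (1 / 2) ^ n * Q ^ k := fun n =>
    (hb' n).time_series_term (min_le_left _ _) hδ0 hC (by positivity) (by positivity) hQ0
      (by linarith) hAδ
  have hgeom : Summable fun n : ℕ => (1 / 2 : ℝ) ^ n := summable_geometric_two
  have hsum : Summable fun n : ℕ => C * (1 / 2 : ℝ) ^ n := hgeom.mul_left C
  set w : ℝ × X → E := fun z => ∑' n, z.1 ^ n • W n z.2 with hw
  refine ⟨δ, hδ0, w, analyticOnNhd_tsum hQ0.le hsum hterm, fun x => ?_, fun z hz => ?_⟩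
  · rw [hw]
    dsimp only
    rw [tsum_eq_single 0 fun n hn => by simp [hn]]
    simp [hW, ckCoeff]
  · have hz2 : z.2 ∈ ball x₀ r := by
      rw [← ball_prod_same] at hz; exact ball_subset_ball (min_le_left _ _) hz.2
    have hdW : ∀ n, HasFDerivAt (W n) (fderivWithin ℝ (W n) (ball x₀ r) z.2) z.2 := fun n =>
      (((hb' n).contDiffOn.differentiableOn (by simp)) z.2 hz2).hasFDerivWithinAt.hasFDerivAt
        (isOpen_ball.mem_nhds hz2)
    have hd : ∀ n, HasFDerivAt (fun z : ℝ × X => z.1 ^ n • W n z.2)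
        (z.1 ^ n • (fderivWithin ℝ (W n) (ball x₀ r) z.2).comp (ContinuousLinearMap.snd ℝ ℝ X) +
          ((n * z.1 ^ (n - 1)) • ContinuousLinearMap.fst ℝ ℝ X).smulRight (W n z.2)) z := by
      intro n
      have h1 : HasFDerivAt (fun z : ℝ × X => z.1 ^ n)
          ((n * z.1 ^ (n - 1)) • ContinuousLinearMap.fst ℝ ℝ X) z := by
        have := (hasDerivAt_pow n z.1).comp_hasFDerivAt z (hasFDerivAt_fst (𝕜 := ℝ))
        exact this
      exact h1.smul ((hdW n).comp z hasFDerivAt_snd)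
    have hfd := hasFDerivAt_tsum_taylorBound hsum hterm hz
    have hbd : ∀ n, ‖fderiv ℝ (fun z : ℝ × X => z.1 ^ n • W n z.2) z‖ ≤ C * (1 / 2) ^ n * Q := by
      intro n
      have := (hterm n).bound 1 z hz
      rw [iteratedFDerivWithin_of_isOpen 1 isOpen_ball hz, norm_iteratedFDeriv_one] at this
      simpa using this
    have hsd : Summable fun n => fderiv ℝ (fun z : ℝ × X => z.1 ^ n • W n z.2) z :=
      Summable.of_norm_bounded (hsum.mul_right Q) hbd
    have hinr : ∀ n, (fderiv ℝ (fun z : ℝ × X => z.1 ^ n • W n z.2) z).comp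
        (ContinuousLinearMap.inr ℝ ℝ X) = z.1 ^ n • fderivWithin ℝ (W n) (ball x₀ r) z.2 := by
      intro n; rw [(hd n).fderiv]; ext v; simp
    have hD : HasSum (fun n => z.1 ^ n • fderivWithin ℝ (W n) (ball x₀ r) z.2)
        ((fderiv ℝ w z).comp (ContinuousLinearMap.inr ℝ ℝ X)) := by
      rw [hfd.fderiv]
      have := ((ContinuousLinearMap.compL ℝ X (ℝ × X) E).flip
        (ContinuousLinearMap.inr ℝ ℝ X)).hasSum hsd.hasSum
      simpa [Function.comp_def, hinr] using this
    have hDn : Summable fun n => ‖z.1 ^ n • fderivWithin ℝ (W n) (ball x₀ r) z.2‖ := by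
      refine Summable.of_nonneg_of_le (fun _ => norm_nonneg _) (fun n => ?_)
        (hsum.mul_right Q)
      rw [← hinr]
      refine (ContinuousLinearMap.opNorm_comp_le _ _).trans ?_
      exact (mul_le_of_le_one_right (norm_nonneg _) (ContinuousLinearMap.norm_inr_le_one ℝ ℝ X)).trans
        (hbd n)
    have hwn : Summable fun n => ‖z.1 ^ n • W n z.2‖ :=
      Summable.of_nonneg_of_le (fun _ => norm_nonneg _)
        (fun n => by simpa using (hterm n).bound 0 z hz) hsum
    have hws : HasSum (fun n => z.1 ^ n • W n z.2) (w z) := hwn.of_norm.hasSum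
    have hTT := T.hasSum_cauchyProduct hwn hwn hws hws
    have hTTn := T.summable_norm_cauchyProduct hwn hwn
    have hT := (ContinuousLinearMap.id ℝ ((X →L[ℝ] E) →L[ℝ] E)).hasSum_cauchyProduct
      hTTn hDn hTT hD
    have hS := S.hasSum hD
    have hrhs := hT.add hS
    simp only [ContinuousLinearMap.id_apply] at hrhs
    have hlhs : HasSum (fun n : ℕ => ((n : ℝ) + 1) • z.1 ^ n • W (n + 1) z.2)
        (fderiv ℝ w z (1, 0)) := by
      rw [hfd.fderiv]
      have h1 := (ContinuousLinearMap.apply ℝ E ((1 : ℝ), (0 : X))).hasSum hsd.hasSum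
      have h2 : ∀ n, fderiv ℝ (fun z : ℝ × X => z.1 ^ n • W n z.2) z (1, 0) =
          (n * z.1 ^ (n - 1)) • W n z.2 := by
        intro n; rw [(hd n).fderiv]; simp
      simp only [ContinuousLinearMap.apply_apply, h2] at h1
      -- The term `n = 0` of the differentiated series is zero; dropping it shifts the index.
      rw [← hasSum_nat_add_iff' 1] at h1
      simpa [mul_smul] using h1
    refine hlhs.unique ?_
    convert hrhs using 1
    funext n
    have hpow : ∀ a ∈ antidiagonal n, z.1 ^ n = z.1 ^ a.1 * z.1 ^ a.2 := fun a ha => by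
      rw [← pow_add, HasAntidiagonal.mem_antidiagonal.1 ha]
    rw [hW, ckCoeff_succ, smul_comm, smul_smul ((n : ℝ) + 1), mul_inv_cancel₀ (by positivity),
      one_smul, smul_add, add_comm, smul_sum, ← hW]
    simp only [map_smul]
    congr 1
    refine sum_congr rfl fun a ha => ?_
    rw [hpow a ha, mul_comm, mul_smul]
    congr 1
    rw [← smul_apply, smul_sum]
    congr 1
    refine sum_congr rfl fun c hc => ?_
    rw [← HasAntidiagonal.mem_antidiagonal.1 hc, pow_add, mul_smul]
    simp only [smul_apply]
    rw [smul_comm]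

end CauchyKovalevskaya

theorem zero_prodMk_mem_ball {X : Type*} [PseudoMetricSpace X] {x x₀ : X} {δ : ℝ}
    (hx : x ∈ Metric.ball x₀ δ) : ((0 : ℝ), x) ∈ Metric.ball ((0 : ℝ), x₀) δ := by
  rw [← ball_prod_same]
  exact ⟨Metric.mem_ball_self (Metric.pos_of_mem_ball hx), hx⟩

/-! ### Uniqueness for linear transport equations. -/

section Transport

set_option maxSynthPendingDepth 3

variable {X F G H : Type*} [NormedAddCommGroup X] [NormedSpace ℝ X] [NormedAddCommGroup F]
  [NormedSpace ℝ F] [NormedAddCommGroup G] [NormedSpace ℝ G] [NormedAddCommGroup H]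
  [NormedSpace ℝ H]

open Metric

/-- The derivatives in time of `f` up to order `n` vanish at time zero on the ball `ball x₀ δ`. -/
def TimeVanishing (x₀ : X) (δ : ℝ) : ℕ → (ℝ × X → F) → Prop
  | 0, f => ∀ x ∈ ball x₀ δ, f (0, x) = 0
  | n + 1, f => (∀ x ∈ ball x₀ δ, f (0, x) = 0) ∧
      TimeVanishing x₀ δ n fun z => fderiv ℝ f z (1, 0)

namespace TimeVanishing

variable {x₀ : X} {δ : ℝ} {n : ℕ} {f f' : ℝ × X → F} {g : ℝ × X → G}

theorem zero_time (h : TimeVanishing x₀ δ n f) : ∀ x ∈ ball x₀ δ, f (0, x) = 0 := by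
  cases n with
  | zero => exact h
  | succ n => exact h.1

theorem congr (h : TimeVanishing x₀ δ n f) (hff' : Set.EqOn f' f (ball (0, x₀) δ)) :
    TimeVanishing x₀ δ n f' := by
  induction n generalizing f f' with
  | zero => exact fun x hx => (hff' (zero_prodMk_mem_ball hx)).trans (h x hx)
  | succ n ih =>
    refine ⟨fun x hx => (hff' (zero_prodMk_mem_ball hx)).trans (h.1 x hx), ih h.2 fun z hz => ?_⟩
    rw [(hff'.eventuallyEq_of_mem (isOpen_ball.mem_nhds hz)).fderiv_eq]

theorem of_succ (h : TimeVanishing x₀ δ (n + 1) f) : TimeVanishing x₀ δ n f := by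
  induction n generalizing f with
  | zero => exact h.1
  | succ n ih => exact ⟨h.1, ih h.2⟩

theorem add (h : TimeVanishing x₀ δ n f) (h' : TimeVanishing x₀ δ n f')
    (hf : AnalyticOnNhd ℝ f (ball (0, x₀) δ)) (hf' : AnalyticOnNhd ℝ f' (ball (0, x₀) δ))
    [CompleteSpace F] : TimeVanishing x₀ δ n fun z => f z + f' z := by
  induction n generalizing f f' with
  | zero => exact fun x hx => by simp [h x hx, h' x hx]
  | succ n ih =>
    refine ⟨fun x hx => by simp [h.1 x hx, h'.1 x hx], (ih h.2 h'.2 ?_ ?_).congr fun z hz => ?_⟩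
    · exact fun z hz => ((ContinuousLinearMap.apply ℝ F ((1 : ℝ), (0 : X))).analyticAt _).comp
        (hf.fderiv z hz)
    · exact fun z hz => ((ContinuousLinearMap.apply ℝ F ((1 : ℝ), (0 : X))).analyticAt _).comp
        (hf'.fderiv z hz)
    · dsimp only
      rw [fderiv_fun_add (hf z hz).differentiableAt (hf' z hz).differentiableAt]
      rfl

/-- By the Leibniz rule it suffices that one factor vanishes to the given order. -/
theorem bilinear [CompleteSpace F] [CompleteSpace G] [CompleteSpace H] (B : G →L[ℝ] F →L[ℝ] H)
    (h : TimeVanishing x₀ δ n f) (hf : AnalyticOnNhd ℝ f (ball (0, x₀) δ))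
    (hg : AnalyticOnNhd ℝ g (ball (0, x₀) δ)) :
    TimeVanishing x₀ δ n fun z => B (g z) (f z) := by
  induction n generalizing f g with
  | zero => exact fun x hx => by simp [h x hx]
  | succ n ih =>
    have hf' : AnalyticOnNhd ℝ (fun z => fderiv ℝ f z (1, 0)) (ball (0, x₀) δ) := fun z hz =>
      ((ContinuousLinearMap.apply ℝ F ((1 : ℝ), (0 : X))).analyticAt _).comp (hf.fderiv z hz)
    have hg' : AnalyticOnNhd ℝ (fun z => fderiv ℝ g z (1, 0)) (ball (0, x₀) δ) := fun z hz =>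
      ((ContinuousLinearMap.apply ℝ G ((1 : ℝ), (0 : X))).analyticAt _).comp (hg.fderiv z hz)
    refine ⟨fun x hx => by simp [h.1 x hx],
      ((ih h.2 hf' hg).add (ih h.of_succ hf hg') ?_ ?_).congr fun z hz => ?_⟩
    · exact fun z hz => (B.analyticAt_bilinear _).comp₂ (hg z hz) (hf' z hz)
    · exact fun z hz => (B.analyticAt_bilinear _).comp₂ (hg' z hz) (hf z hz)
    · dsimp only
      rw [B.fderiv_of_bilinear (hg z hz).differentiableAt (hf z hz).differentiableAt]
      rfl

/-- A space derivative at time zero sees only values on the initial slice, and it commutes with the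
time derivatives. -/
theorem spatial [CompleteSpace F] (h : TimeVanishing x₀ δ n f)
    (hf : AnalyticOnNhd ℝ f (ball (0, x₀) δ)) :
    TimeVanishing x₀ δ n fun z => (fderiv ℝ f z).comp (ContinuousLinearMap.inr ℝ ℝ X) := by
  have h0 : ∀ x ∈ ball x₀ δ,
      (fderiv ℝ f (0, x)).comp (ContinuousLinearMap.inr ℝ ℝ X) = 0 := by
    intro x hx
    have h1 : HasFDerivAt (fun x => f (0, x))
        ((fderiv ℝ f (0, x)).comp (ContinuousLinearMap.inr ℝ ℝ X)) x :=
      (hf _ (zero_prodMk_mem_ball hx)).differentiableAt.hasFDerivAt.comp x (hasFDerivAt_prodMk_right 0 x)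
    have h2 : (fun x => f (0, x)) =ᶠ[𝓝 x] fun _ => 0 :=
      Filter.eventuallyEq_of_mem (isOpen_ball.mem_nhds hx) h.zero_time
    exact h1.unique ((hasFDerivAt_const (0 : F) x).congr_of_eventuallyEq h2)
  induction n generalizing f with
  | zero => exact h0
  | succ n ih =>
    have hf' : AnalyticOnNhd ℝ (fun z => fderiv ℝ f z (1, 0)) (ball (0, x₀) δ) := fun z hz =>
      ((ContinuousLinearMap.apply ℝ F ((1 : ℝ), (0 : X))).analyticAt _).comp (hf.fderiv z hz)
    refine ⟨h0, (ih h.2 hf' fun x hx => ?_).congr fun z hz => ?_⟩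
    · have h1 : HasFDerivAt (fun x => fderiv ℝ f (0, x) (1, 0))
          ((fderiv ℝ (fun z => fderiv ℝ f z (1, 0)) (0, x)).comp
            (ContinuousLinearMap.inr ℝ ℝ X)) x :=
        (hf' _ (zero_prodMk_mem_ball hx)).differentiableAt.hasFDerivAt.comp x
          (hasFDerivAt_prodMk_right 0 x)
      have h2 : (fun x => fderiv ℝ f (0, x) (1, 0)) =ᶠ[𝓝 x] fun _ => 0 :=
        Filter.eventuallyEq_of_mem (isOpen_ball.mem_nhds hx) h.2.zero_time
      exact h1.unique ((hasFDerivAt_const (0 : F) x).congr_of_eventuallyEq h2)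
    · have hd : HasFDerivAt (fderiv ℝ f) (fderiv ℝ (fderiv ℝ f) z) z :=
        (hf.fderiv z hz).differentiableAt.hasFDerivAt
      have hsymm : IsSymmSndFDerivAt ℝ f z :=
        ((hf z hz).contDiffAt (n := 2)).isSymmSndFDerivAt (by simp)
      ext v
      have h1 : HasFDerivAt (fun z => (fderiv ℝ f z).comp (ContinuousLinearMap.inr ℝ ℝ X))
          (((ContinuousLinearMap.compL ℝ X (ℝ × X) F).flip
            (ContinuousLinearMap.inr ℝ ℝ X)).comp (fderiv ℝ (fderiv ℝ f) z)) z :=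
        ((ContinuousLinearMap.compL ℝ X (ℝ × X) F).flip
          (ContinuousLinearMap.inr ℝ ℝ X)).hasFDerivAt.comp z hd
      have h2 : HasFDerivAt (fun z => fderiv ℝ f z (1, 0))
          ((ContinuousLinearMap.apply ℝ F ((1 : ℝ), (0 : X))).comp (fderiv ℝ (fderiv ℝ f) z)) z :=
        (ContinuousLinearMap.apply ℝ F ((1 : ℝ), (0 : X))).hasFDerivAt.comp z hd
      dsimp only
      rw [h1.fderiv, h2.fderiv]
      simpa using hsymm.eq (1, 0) (0, v)

theorem iteratedDeriv_eq_zero [CompleteSpace F] (h : TimeVanishing x₀ δ n f)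
    (hf : AnalyticOnNhd ℝ f (ball (0, x₀) δ)) {x : X} (hx : x ∈ ball x₀ δ) :
    iteratedDeriv n (fun s => f (s, x)) 0 = 0 := by
  induction n generalizing f with
  | zero => simpa using h x hx
  | succ n ih =>
    have hf' : AnalyticOnNhd ℝ (fun z => fderiv ℝ f z (1, 0)) (ball (0, x₀) δ) := fun z hz =>
      ((ContinuousLinearMap.apply ℝ F ((1 : ℝ), (0 : X))).analyticAt _).comp (hf.fderiv z hz)
    rw [iteratedDeriv_succ', Filter.EventuallyEq.iteratedDeriv_eq n
      (g := fun s => fderiv ℝ f (s, x) (1, 0)), ih h.2 hf']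
    have hδ := pos_of_mem_ball hx
    filter_upwards [ball_mem_nhds (0 : ℝ) hδ] with s hs
    have hz : (s, x) ∈ ball ((0 : ℝ), x₀) δ := by rw [← ball_prod_same]; exact ⟨hs, hx⟩
    have h1 : HasDerivAt (fun s : ℝ => (s, x)) ((1 : ℝ), (0 : X)) s :=
      (hasDerivAt_id s).prodMk (hasDerivAt_const s x)
    exact ((hf _ hz).differentiableAt.hasFDerivAt.comp_hasDerivAt s h1).deriv

end TimeVanishing

/-- Uniqueness for analytic solutions of a linear transport equation. -/
theorem eqOn_zero_of_transport [CompleteSpace X] [CompleteSpace F] {x₀ : X} {δ : ℝ}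
    {f : ℝ × X → F} {V : ℝ × X → X} {ν : ℝ × X → ℝ} (hf : AnalyticOnNhd ℝ f (ball (0, x₀) δ))
    (hV : AnalyticOnNhd ℝ V (ball (0, x₀) δ)) (hν : AnalyticOnNhd ℝ ν (ball (0, x₀) δ))
    (h0 : ∀ x ∈ ball x₀ δ, f (0, x) = 0)
    (h : ∀ z ∈ ball ((0 : ℝ), x₀) δ,
      fderiv ℝ f z (1, 0) = fderiv ℝ f z (0, V z) + ν z • f z) :
    Set.EqOn f 0 (ball (0, x₀) δ) := by
  -- The equation writes the time derivative through `f` and its space derivative, which vanish to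
  -- order `n`; hence `f` vanishes to order `n + 1`.
  have hall : ∀ n, TimeVanishing x₀ δ n f := by
    intro n
    induction n with
    | zero => exact h0
    | succ n ih =>
      have hsp : AnalyticOnNhd ℝ
          (fun z => (fderiv ℝ f z).comp (ContinuousLinearMap.inr ℝ ℝ X)) (ball (0, x₀) δ) :=
        fun z hz => (((ContinuousLinearMap.compL ℝ X (ℝ × X) F).flip
          (ContinuousLinearMap.inr ℝ ℝ X)).analyticAt _).comp (hf.fderiv z hz)
      have h1 := (ih.spatial hf).bilinear (ContinuousLinearMap.apply ℝ F) hsp hV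
      have h2 := ih.bilinear (ContinuousLinearMap.lsmul ℝ ℝ) hf hν
      refine ⟨h0, (h1.add h2 ?_ ?_).congr fun z hz => ?_⟩
      · exact fun z hz => ((ContinuousLinearMap.apply ℝ F).analyticAt_bilinear _).comp₂
          (hV z hz) (hsp z hz)
      · exact fun z hz => (hν z hz).smul (hf z hz)
      · simpa using h z hz
  rintro ⟨s, x⟩ hz
  have hz' := hz
  rw [← ball_prod_same] at hz'
  have hx : x ∈ ball x₀ δ := hz'.2
  have hδ := pos_of_mem_ball hx
  have hline : AnalyticOnNhd ℝ (fun s => f (s, x)) (ball 0 δ) := fun s hs =>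
    AnalyticAt.comp₂ (h := f) (f := fun s => s) (g := fun _ => x)
      (hf (s, x) (by rw [← ball_prod_same]; exact ⟨hs, hx⟩)) analyticAt_id analyticAt_const
  -- For fixed `x`, the analytic function of time has infinite order of vanishing at 0, so it is
  -- zero on the whole interval.
  have htop : analyticOrderAt (fun s => f (s, x)) 0 = ⊤ := by
    refine ENat.eq_top_iff_forall_ge.2 fun n => ?_
    exact (natCast_le_analyticOrderAt_iff_iteratedDeriv_eq_zero
      (hline 0 (mem_ball_self hδ))).2 fun i _ => (hall i).iteratedDeriv_eq_zero hf hx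
  exact hline.eqOn_zero_of_preconnected_of_eventuallyEq_zero (convex_ball 0 δ).isPreconnected
    (mem_ball_self hδ) (analyticOrderAt_eq_top.1 htop) hz'.1

end Transport

/-! ### Variable coefficients as additional unknowns. -/

section CauchyKovalevskayaCoeff

set_option maxSynthPendingDepth 3

variable {X E C : Type*} [NormedAddCommGroup X] [NormedSpace ℝ X] [CompleteSpace X]
  [NormedAddCommGroup E] [NormedSpace ℝ E] [CompleteSpace E] [NormedAddCommGroup C]
  [NormedSpace ℝ C] [CompleteSpace C]

open Metric

/-- **Cauchy–Kovalevskaya** for the equation `∂ₛ w = T ((c, w), (c, w), D w)`, with `T` trilinear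
and `c` a given analytic function. -/
theorem cauchy_kovalevskaya_coeff (T : (C × E) →L[ℝ] (C × E) →L[ℝ] (X →L[ℝ] E) →L[ℝ] E)
    {c : ℝ × X → C} {w₀ : X → E} {x₀ : X} (hc : AnalyticAt ℝ c (0, x₀))
    (hw₀ : AnalyticAt ℝ w₀ x₀) :
    ∃ δ > 0, ∃ w : ℝ × X → E, AnalyticOnNhd ℝ w (ball (0, x₀) δ) ∧
      (∀ x, w (0, x) = w₀ x) ∧ ∀ z ∈ ball ((0 : ℝ), x₀) δ, fderiv ℝ w z (1, 0) =
        T (c z, w z) (c z, w z) ((fderiv ℝ w z).comp (ContinuousLinearMap.inr ℝ ℝ X)) := by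
  -- A space variable `σ` is added and `(c, w)` becomes the unknown. `S` imposes `∂ₛ c = ∂_σ c` on
  -- the first component, with initial value `c (σ, x)`, so that it becomes `c (s + σ, x)`; `Φ`
  -- extracts the `X`-derivative of the second component, on which `T` acts. The system now has
  -- constant coefficients, and `σ = 0` recovers the original one.
  let Φ : ((ℝ × X) →L[ℝ] (C × E)) →L[ℝ] (X →L[ℝ] E) :=
    (ContinuousLinearMap.compL ℝ X (C × E) E (ContinuousLinearMap.snd ℝ C E)).comp
      ((ContinuousLinearMap.compL ℝ X (ℝ × X) (C × E)).flip (ContinuousLinearMap.inr ℝ ℝ X))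
  let Ψ : ((X →L[ℝ] E) →L[ℝ] E) →L[ℝ] (((ℝ × X) →L[ℝ] (C × E)) →L[ℝ] (C × E)) :=
    (ContinuousLinearMap.compL ℝ ((ℝ × X) →L[ℝ] (C × E)) E (C × E)
      (ContinuousLinearMap.inr ℝ C E)).comp
      ((ContinuousLinearMap.compL ℝ ((ℝ × X) →L[ℝ] (C × E)) (X →L[ℝ] E) E).flip Φ)
  let T' : (C × E) →L[ℝ] (C × E) →L[ℝ] ((ℝ × X) →L[ℝ] (C × E)) →L[ℝ] (C × E) :=
    (ContinuousLinearMap.compL ℝ (C × E) ((X →L[ℝ] E) →L[ℝ] E) _ Ψ).comp T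
  let S : ((ℝ × X) →L[ℝ] (C × E)) →L[ℝ] (C × E) :=
    ((ContinuousLinearMap.inl ℝ C E).comp (ContinuousLinearMap.fst ℝ C E)).comp
      (ContinuousLinearMap.apply ℝ (C × E) ((1 : ℝ), (0 : X)))
  have hw₀' : AnalyticAt ℝ (fun z : ℝ × X => (c z, w₀ z.2)) (0, x₀) :=
    hc.prod (hw₀.comp_of_eq analyticAt_snd rfl)
  obtain ⟨δ₁, hδ₁, W, hW, hW0, hWeq⟩ := cauchy_kovalevskaya T' S hw₀'
  have hT' : ∀ e e' D, T' e e' D = (0, T e e' ((ContinuousLinearMap.snd ℝ C E).comp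
      (D.comp (ContinuousLinearMap.inr ℝ ℝ X)))) := fun e e' D => rfl
  have hS : ∀ D, S D = ((D (1, 0)).1, 0) := fun D => rfl
  obtain ⟨δ₂, hδ₂, hcball⟩ := Metric.eventually_nhds_iff_ball.1 hc.eventually_analyticAt
  -- Half of `δ₂`, because `s + σ` has to stay where `c` is analytic.
  set δ := min δ₁ (δ₂ / 2) with hδ
  have hδ0 : 0 < δ := lt_min hδ₁ (by positivity)
  have hsub : ball ((0 : ℝ), ((0 : ℝ), x₀)) δ ⊆ ball ((0 : ℝ), ((0 : ℝ), x₀)) δ₁ :=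
    ball_subset_ball (min_le_left _ _)
  have hWδ := hW.mono hsub
  have hmem : ∀ z ∈ ball ((0 : ℝ), ((0 : ℝ), x₀)) δ,
      (z.1 + z.2.1, z.2.2) ∈ ball ((0 : ℝ), x₀) δ₂ := by
    rintro ⟨s, σ, x⟩ hz
    have hδ' : δ ≤ δ₂ / 2 := min_le_right _ _
    simp only [← ball_prod_same, Set.mem_prod, mem_ball_zero_iff, Real.norm_eq_abs] at hz ⊢
    refine ⟨(abs_add_le _ _).trans_lt (by linarith [hz.1, hz.2.1]), ?_⟩
    exact ball_subset_ball (by linarith) hz.2.2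
  let shift : ℝ × (ℝ × X) →L[ℝ] ℝ × X :=
    ((ContinuousLinearMap.fst ℝ ℝ (ℝ × X)) + (ContinuousLinearMap.fst ℝ ℝ X).comp
      (ContinuousLinearMap.snd ℝ ℝ (ℝ × X))).prod ((ContinuousLinearMap.snd ℝ ℝ X).comp
      (ContinuousLinearMap.snd ℝ ℝ (ℝ × X)))
  have hshift : ∀ z, shift z = (z.1 + z.2.1, z.2.2) := fun z => rfl
  have hcan : AnalyticOnNhd ℝ (fun z => c (shift z)) (ball ((0 : ℝ), ((0 : ℝ), x₀)) δ) :=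
    fun z hz => AnalyticAt.comp (f := shift) (hcball _ (hmem z hz)) (shift.analyticAt z)
  have hW1 : AnalyticOnNhd ℝ (fun z => (W z).1) (ball ((0 : ℝ), ((0 : ℝ), x₀)) δ) :=
    fun z hz => analyticAt_fst.comp (hWδ z hz)
  -- Both functions solve the same transport equation in `σ` with the same initial values.
  have hcoef : Set.EqOn (fun z => (W z).1 - c (shift z)) 0
      (ball ((0 : ℝ), ((0 : ℝ), x₀)) δ) := by
    refine eqOn_zero_of_transport (V := fun _ => (1, 0)) (ν := fun _ => 0)
      (hW1.sub hcan) (fun _ _ => analyticAt_const) (fun _ _ => analyticAt_const)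
      (fun x _ => by simp [hW0, hshift]) fun z hz => ?_
    have hd1 : HasFDerivAt (fun z => (W z).1)
        ((ContinuousLinearMap.fst ℝ C E).comp (fderiv ℝ W z)) z :=
      (ContinuousLinearMap.fst ℝ C E).hasFDerivAt.comp z (hWδ z hz).differentiableAt.hasFDerivAt
    have hd2 : HasFDerivAt (fun z => c (shift z)) ((fderiv ℝ c (shift z)).comp shift) z :=
      (hcball _ (hmem z hz)).differentiableAt.hasFDerivAt.comp z shift.hasFDerivAt
    rw [(hd1.fun_sub hd2).fderiv]
    have h1 : (fderiv ℝ W z (1, 0)).1 = (fderiv ℝ W z (0, (1, 0))).1 := by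
      rw [hWeq z (hsub hz), hT', hS]
      simp
    simp [hshift, h1]
  have hin : ∀ z ∈ ball ((0 : ℝ), x₀) δ, (z.1, ((0 : ℝ), z.2)) ∈
      ball ((0 : ℝ), ((0 : ℝ), x₀)) δ := by
    rintro ⟨s, x⟩ hz
    simp only [← ball_prod_same, Set.mem_prod, mem_ball_zero_iff, Real.norm_eq_abs] at hz ⊢
    exact ⟨hz.1, by simpa using hδ0, hz.2⟩
  let ι : ℝ × X →L[ℝ] ℝ × (ℝ × X) := (ContinuousLinearMap.fst ℝ ℝ X).prod
    ((ContinuousLinearMap.inr ℝ ℝ X).comp (ContinuousLinearMap.snd ℝ ℝ X))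
  have hι : ∀ z, ι z = (z.1, ((0 : ℝ), z.2)) := fun z => rfl
  refine ⟨δ, hδ0, fun z => (W (ι z)).2, fun z hz => analyticAt_snd.comp
    (AnalyticAt.comp (f := ι) (hWδ _ (hin z hz)) (ι.analyticAt z)), fun x => by simp [hι, hW0], fun z hz => ?_⟩
  have hd : HasFDerivAt (fun z => (W (ι z)).2)
      ((ContinuousLinearMap.snd ℝ C E).comp ((fderiv ℝ W (ι z)).comp ι)) z :=
    (ContinuousLinearMap.snd ℝ C E).hasFDerivAt.comp z
      (HasFDerivAt.comp (f := ι) z (hWδ _ (hin z hz)).differentiableAt.hasFDerivAt ι.hasFDerivAt)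
  have hcz : (W (ι z)).1 = c z := by
    have := hcoef (hin z hz)
    simp only [hshift, Pi.zero_apply, sub_eq_zero, add_zero] at this
    exact this
  rw [hd.fderiv]
  have h1 := congrArg Prod.snd (hWeq (ι z) (hsub (hin z hz)))
  rw [hT', hS] at h1
  have h2 : (c z, (W (ι z)).2) = W (ι z) := by rw [← hcz]
  rw [h2]
  rw [Prod.snd_add, add_zero] at h1
  exact h1

end CauchyKovalevskayaCoeff

/-! ### Trilinear maps on finite-dimensional spaces. -/

section Trilinear

set_option maxSynthPendingDepth 3

variable {E F G H : Type*} [NormedAddCommGroup E] [NormedSpace ℝ E] [FiniteDimensional ℝ E]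
  [NormedAddCommGroup F] [NormedSpace ℝ F] [FiniteDimensional ℝ F] [NormedAddCommGroup G]
  [NormedSpace ℝ G] [FiniteDimensional ℝ G] [NormedAddCommGroup H] [NormedSpace ℝ H]

/-- A map between finite-dimensional spaces that is linear in each of its three arguments, as a
continuous trilinear map. -/
noncomputable def mkTrilinear (f : E → F → G → H)
    (h₁ : ∀ y z, IsLinearMap ℝ fun x => f x y z) (h₂ : ∀ x z, IsLinearMap ℝ fun y => f x y z)
    (h₃ : ∀ x y, IsLinearMap ℝ fun z => f x y z) : E →L[ℝ] F →L[ℝ] G →L[ℝ] H :=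
  LinearMap.toContinuousLinearMap
    { toFun := fun x => (LinearMap.mk₂ ℝ (f x) (fun y y' z => (h₂ x z).map_add y y')
        (fun a y z => (h₂ x z).map_smul a y) (fun y z z' => (h₃ x y).map_add z z')
        (fun a y z => (h₃ x y).map_smul a z)).toContinuousBilinearMap
      map_add' := fun x x' => by ext y z; exact (h₁ y z).map_add x x'
      map_smul' := fun a x => by ext y z; exact (h₁ y z).map_smul a x }

@[simp]
theorem mkTrilinear_apply (f : E → F → G → H) (h₁ h₂ h₃) (x : E) (y : F) (z : G) :
    mkTrilinear f h₁ h₂ h₃ x y z = f x y z := rfl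

end Trilinear

/-! ### Solving the Euler equations. -/

section Euler

set_option maxSynthPendingDepth 3

open Metric

/-- The right-hand side of the compressible Euler equations for the unknowns
`(log ρ, u, v, ρ ^ (γ - 1))`, as a trilinear expression. -/
noncomputable def eulerRhs (γ : ℝ) (a b : ℝ × (Fin 4 → ℝ)) (D : Plane →L[ℝ] (Fin 4 → ℝ)) :
    Fin 4 → ℝ :=
  let D₀ := D (EuclideanSpace.single 0 1)
  let D₁ := D (EuclideanSpace.single 1 1)
  -- With `K = ρ ^ (γ - 1)` the force `∇p / ρ` is `K ∇ log ρ`, so the system is polynomial. The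
  -- components `a.1`, `b.1` will be the constant 1 and pad lower-order terms to degree three. The
  -- last row is `(γ - 1) K` times the equation for `log ρ`.
  ![-(a.2 1 * b.1 * D₀ 0 + a.2 2 * b.1 * D₁ 0 + a.1 * b.1 * (D₀ 1 + D₁ 2)),
    -(a.2 1 * b.1 * D₀ 1 + a.2 2 * b.1 * D₁ 1 + a.2 3 * b.1 * D₀ 0),
    -(a.2 1 * b.1 * D₀ 2 + a.2 2 * b.1 * D₁ 2 + a.2 3 * b.1 * D₁ 0),
    -(γ - 1) * (a.2 3 * b.2 1 * D₀ 0 + a.2 3 * b.2 2 * D₁ 0 + a.2 3 * b.1 * (D₀ 1 + D₁ 2))]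

/-- `eulerRhs` as a continuous trilinear map. -/
noncomputable def eulerTrilinear (γ : ℝ) : (ℝ × (Fin 4 → ℝ)) →L[ℝ] (ℝ × (Fin 4 → ℝ)) →L[ℝ]
    (Plane →L[ℝ] (Fin 4 → ℝ)) →L[ℝ] (Fin 4 → ℝ) :=
  mkTrilinear (eulerRhs γ)
    (fun y z => by
      constructor <;> intros <;> ext i <;> fin_cases i <;> simp [eulerRhs] <;> ring)
    (fun x z => by
      constructor <;> intros <;> ext i <;> fin_cases i <;> simp [eulerRhs] <;> ring)
    (fun x y => by
      constructor <;> intros <;> ext i <;> fin_cases i <;> simp [eulerRhs] <;> ring)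

/-- Analytic solutions of the compressible Euler equations with `ρ = exp ℓ`. -/
theorem exists_euler_solution (γ : ℝ) {x₀ : Plane} {ℓ₀ u₀ v₀ : Plane → ℝ}
    (hℓ₀ : AnalyticAt ℝ ℓ₀ x₀) (hu₀ : AnalyticAt ℝ u₀ x₀) (hv₀ : AnalyticAt ℝ v₀ x₀) :
    ∃ δ > 0, ∃ ℓ u v : ℝ × Plane → ℝ,
      AnalyticOnNhd ℝ ℓ (ball (0, x₀) δ) ∧ AnalyticOnNhd ℝ u (ball (0, x₀) δ) ∧
      AnalyticOnNhd ℝ v (ball (0, x₀) δ) ∧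
      (∀ x, ℓ (0, x) = ℓ₀ x ∧ u (0, x) = u₀ x ∧ v (0, x) = v₀ x) ∧
      ∀ z ∈ ball ((0 : ℝ), x₀) δ,
        fderiv ℝ ℓ z (1, 0) = -(u z * fderiv ℝ ℓ z (0, EuclideanSpace.single 0 1) +
          v z * fderiv ℝ ℓ z (0, EuclideanSpace.single 1 1) +
          (fderiv ℝ u z (0, EuclideanSpace.single 0 1) +
            fderiv ℝ v z (0, EuclideanSpace.single 1 1))) ∧
        fderiv ℝ u z (1, 0) = -(u z * fderiv ℝ u z (0, EuclideanSpace.single 0 1) +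
          v z * fderiv ℝ u z (0, EuclideanSpace.single 1 1) +
          Real.exp ((γ - 1) * ℓ z) * fderiv ℝ ℓ z (0, EuclideanSpace.single 0 1)) ∧
        fderiv ℝ v z (1, 0) = -(u z * fderiv ℝ v z (0, EuclideanSpace.single 0 1) +
          v z * fderiv ℝ v z (0, EuclideanSpace.single 1 1) +
          Real.exp ((γ - 1) * ℓ z) * fderiv ℝ ℓ z (0, EuclideanSpace.single 1 1)) := by
  have hexp : AnalyticAt ℝ (fun x => Real.exp ((γ - 1) * ℓ₀ x)) x₀ :=
    (analyticAt_const.mul hℓ₀).rexp'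
  have hw₀ : AnalyticAt ℝ (fun x => ![ℓ₀ x, u₀ x, v₀ x, Real.exp ((γ - 1) * ℓ₀ x)]) x₀ := by
    refine AnalyticAt.pi fun i => ?_
    fin_cases i
    exacts [hℓ₀, hu₀, hv₀, hexp]
  obtain ⟨δ, hδ, w, hw, hw0, heq⟩ := cauchy_kovalevskaya_coeff (eulerTrilinear γ)
    (c := fun _ => (1 : ℝ)) analyticAt_const hw₀
  have hcomp : ∀ i, AnalyticOnNhd ℝ (fun z => w z i) (ball (0, x₀) δ) := fun i z hz =>
    ((ContinuousLinearMap.proj (R := ℝ) (φ := fun _ : Fin 4 => ℝ) i).analyticAt _).comp (hw z hz)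
  have hder : ∀ i, ∀ z ∈ ball ((0 : ℝ), x₀) δ, ∀ v,
      fderiv ℝ (fun z => w z i) z v = fderiv ℝ w z v i := by
    intro i z hz v
    have := (ContinuousLinearMap.proj (R := ℝ) (φ := fun _ : Fin 4 => ℝ) i).hasFDerivAt.comp z
      (hw z hz).differentiableAt.hasFDerivAt
    exact congrArg (fun A => A v) this.fderiv
  have hi : ∀ i, ∀ z ∈ ball ((0 : ℝ), x₀) δ, fderiv ℝ w z (1, 0) i =
      eulerRhs γ (1, w z) (1, w z) ((fderiv ℝ w z).comp (ContinuousLinearMap.inr ℝ ℝ Plane)) i :=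
    fun i z hz => congrFun (heq z hz) i
  -- The fourth unknown was evolved independently. By the first and last rows, `K exp (-(γ - 1) log
  -- ρ)` has zero time derivative, so it keeps its initial value 1.
  have hK : ∀ z ∈ ball ((0 : ℝ), x₀) δ, w z 3 = Real.exp ((γ - 1) * w z 0) := by
    have hE : AnalyticOnNhd ℝ (fun z => w z 3 * Real.exp (-((γ - 1) * w z 0)) - 1)
        (ball (0, x₀) δ) := fun z hz =>
      ((hcomp 3 z hz).mul (analyticAt_const.mul (hcomp 0 z hz)).neg.rexp').sub analyticAt_const
    have := eqOn_zero_of_transport (V := fun _ => 0) (ν := fun _ => 0) hE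
      (fun _ _ => analyticAt_const) (fun _ _ => analyticAt_const)
      (fun x _ => by simp [hw0, ← Real.exp_add]) fun z hz => ?_
    · intro z hz
      have h1 := this hz
      simp only [Pi.zero_apply, sub_eq_zero, Real.exp_neg] at h1
      field_simp at h1
      exact h1
    · have h3 := (hcomp 3 z hz).differentiableAt.hasFDerivAt
      have h0 := (hcomp 0 z hz).differentiableAt.hasFDerivAt
      rw [((h3.fun_mul ((h0.const_mul (γ - 1)).fun_neg.exp)).sub_const 1).fderiv]
      simp only [add_apply, smul_apply, neg_apply, smul_eq_mul, hder _ z hz, hi _ z hz,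
        show ((0 : ℝ), (0 : Plane)) = 0 from rfl, map_zero]
      simp [eulerRhs]
      ring
  refine ⟨δ, hδ, fun z => w z 0, fun z => w z 1, fun z => w z 2, hcomp 0, hcomp 1, hcomp 2,
    fun x => by simp [hw0], fun z hz => ?_⟩
  simp only [hder _ z hz, ← hK z hz]
  refine ⟨(hi 0 z hz).trans ?_, (hi 1 z hz).trans ?_, (hi 2 z hz).trans ?_⟩ <;> simp [eulerRhs]

end Euler

/-! ### Vector product identities. -/

section CrossProduct

/-- The vector product of `Space`. -/
noncomputable def cross (a b : Space) : Space :=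
  WithLp.toLp 2 (crossProduct (WithLp.ofLp a) (WithLp.ofLp b))

theorem cross_add_left (a a' b : Space) : cross (a + a') b = cross a b + cross a' b := by
  simp [cross]

theorem cross_add_right (a b b' : Space) : cross a (b + b') = cross a b + cross a b' := by
  simp [cross]

theorem cross_smul_left (c : ℝ) (a b : Space) : cross (c • a) b = c • cross a b := by
  simp [cross]

theorem cross_smul_right (c : ℝ) (a b : Space) : cross a (c • b) = c • cross a b := by
  simp [cross]

theorem cross_sub_right (a b b' : Space) : cross a (b - b') = cross a b - cross a b' := by
  simp [cross]

@[simp]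
theorem spaceCross_self (a : Space) : cross a a = 0 := by
  simp [cross]

theorem spaceCross_anticomm (a b : Space) : cross a b = -cross b a := by
  rw [cross, ← _root_.cross_anticomm]; rfl

theorem inner_space (a b : Space) : inner ℝ a b = a 0 * b 0 + a 1 * b 1 + a 2 * b 2 := by
  simp [PiLp.inner_apply, Fin.sum_univ_three, mul_comm]

theorem spaceCross_apply (a b : Space) : cross a b =
    !₂[a 1 * b 2 - a 2 * b 1, a 2 * b 0 - a 0 * b 2, a 0 * b 1 - a 1 * b 0] := by
  rw [cross, _root_.cross_apply]

theorem inner_cross_cycle (a b c : Space) : inner ℝ a (cross b c) = inner ℝ b (cross c a) := by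
  simp only [inner_space, spaceCross_apply]
  simp
  ring

@[simp]
theorem inner_self_cross (a b : Space) : inner ℝ a (cross a b) = 0 := by
  rw [inner_cross_cycle, inner_cross_cycle, spaceCross_self, inner_zero_right]

@[simp]
theorem inner_self_cross_right (a b : Space) : inner ℝ b (cross a b) = 0 := by
  rw [inner_cross_cycle, spaceCross_self, inner_zero_right]

@[simp]
theorem inner_cross_self (a b : Space) : inner ℝ (cross a b) a = 0 := by
  rw [real_inner_comm, inner_self_cross]

@[simp]
theorem inner_cross_self_right (a b : Space) : inner ℝ (cross a b) b = 0 := by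
  rw [real_inner_comm, inner_self_cross_right]

theorem spaceCross_cross (a b c : Space) :
    cross (cross a b) c = inner ℝ a c • b - inner ℝ b c • a := by
  ext i
  simp only [inner_space, spaceCross_apply]
  fin_cases i <;> simp <;> ring

theorem inner_cross_cross (a b c d : Space) : inner ℝ (cross a b) (cross c d) =
    inner ℝ a c * inner ℝ b d - inner ℝ a d * inner ℝ b c := by
  simp only [inner_space, spaceCross_apply]
  simp
  ring

/-- The vector product as a continuous bilinear map. -/
noncomputable def crossL : Space →L[ℝ] Space →L[ℝ] Space :=
  (LinearMap.mk₂ ℝ cross cross_add_left cross_smul_left cross_add_right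
    cross_smul_right).toContinuousBilinearMap

end CrossProduct

/-! ### Product rules and mixed derivatives. -/

section Derivatives

variable {V F G H : Type*} [NormedAddCommGroup V] [NormedSpace ℝ V] [NormedAddCommGroup F]
  [NormedSpace ℝ F] [NormedAddCommGroup G] [NormedSpace ℝ G] [NormedAddCommGroup H]
  [NormedSpace ℝ H]

theorem ContinuousLinearMap.fderiv_bilinear_apply (B : F →L[ℝ] G →L[ℝ] H) {f : V → F} {g : V → G}
    {x : V} (hf : DifferentiableAt ℝ f x) (hg : DifferentiableAt ℝ g x) (v : V) :
    fderiv ℝ (fun y => B (f y) (g y)) x v =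
      B (f x) (fderiv ℝ g x v) + B (fderiv ℝ f x v) (g x) := by
  rw [B.fderiv_of_bilinear hf hg]; rfl

theorem fderiv_smul_apply {a : V → ℝ} {g : V → G} {x : V} (ha : DifferentiableAt ℝ a x)
    (hg : DifferentiableAt ℝ g x) (v : V) :
    fderiv ℝ (fun y => a y • g y) x v = a x • fderiv ℝ g x v + fderiv ℝ a x v • g x :=
  (ContinuousLinearMap.lsmul ℝ ℝ).fderiv_bilinear_apply ha hg v

theorem fderiv_inner_space_apply {f g : V → Space} {x : V} (hf : DifferentiableAt ℝ f x)
    (hg : DifferentiableAt ℝ g x) (v : V) : fderiv ℝ (fun y => inner ℝ (f y) (g y)) x v =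
      inner ℝ (f x) (fderiv ℝ g x v) + inner ℝ (fderiv ℝ f x v) (g x) :=
  (innerSL ℝ).fderiv_bilinear_apply hf hg v

theorem fderiv_cross_apply {f g : V → Space} {x : V} (hf : DifferentiableAt ℝ f x)
    (hg : DifferentiableAt ℝ g x) (v : V) : fderiv ℝ (fun y => cross (f y) (g y)) x v =
      cross (f x) (fderiv ℝ g x v) + cross (fderiv ℝ f x v) (g x) :=
  crossL.fderiv_bilinear_apply hf hg v

theorem AnalyticAt.cross {f g : V → Space} {x : V} (hf : AnalyticAt ℝ f x)
    (hg : AnalyticAt ℝ g x) : AnalyticAt ℝ (fun y => cross (f y) (g y)) x :=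
  (crossL.analyticAt_bilinear _).comp₂ hf hg

theorem AnalyticAt.inner_space {f g : V → Space} {x : V} (hf : AnalyticAt ℝ f x)
    (hg : AnalyticAt ℝ g x) : AnalyticAt ℝ (fun y => inner ℝ (f y) (g y)) x :=
  ((innerSL ℝ).analyticAt_bilinear _).comp₂ hf hg

theorem AnalyticAt.fderiv_apply [CompleteSpace F] {f : V → F} {x : V} (hf : AnalyticAt ℝ f x)
    (v : V) : AnalyticAt ℝ (fun y => fderiv ℝ f y v) x :=
  ((ContinuousLinearMap.apply ℝ F v).analyticAt _).comp hf.fderiv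

theorem AnalyticAt.fderiv_fderiv_comm [CompleteSpace F] {f : V → F} {x : V}
    (hf : AnalyticAt ℝ f x) (v w : V) :
    _root_.fderiv ℝ (fun y => _root_.fderiv ℝ f y v) x w =
      _root_.fderiv ℝ (fun y => _root_.fderiv ℝ f y w) x v := by
  have h : ∀ v, _root_.fderiv ℝ (fun y => _root_.fderiv ℝ f y v) x =
      (ContinuousLinearMap.apply ℝ F v).comp (_root_.fderiv ℝ (_root_.fderiv ℝ f) x) := fun v =>
    ((ContinuousLinearMap.apply ℝ F v).hasFDerivAt.comp x
      hf.fderiv.differentiableAt.hasFDerivAt).fderiv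
  rw [h, h]
  exact (hf.contDiffAt (n := 2)).isSymmSndFDerivAt (by simp) w v

end Derivatives

/-! ### The Cauchy problem for a surface and its normal. -/

section SurfaceSystem

set_option maxSynthPendingDepth 3

open Metric

/-- The right-hand side of the evolution of a surface and its normal, as a trilinear expression;
the coefficients are `(1, μ, η, λ)`. -/
noncomputable def surfaceRhs (a b : (Fin 4 → ℝ) × (Space × Space))
    (D : (ℝ × ℝ) →L[ℝ] (Space × Space)) : Space × Space :=
  -- The evolution variable is `x₁` and the space variables are `(x₂, t)`, so `D (1, 0)` is the
  -- `x₂`-derivative; `b.1 0` is the constant 1.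
  ((a.1 1 * b.1 0) • (D (1, 0)).1 + a.1 2 • cross b.2.2 (D (1, 0)).2,
    (a.1 1 * b.1 0) • (D (1, 0)).2 + a.1 3 • cross b.2.2 (D (1, 0)).1)

/-- `surfaceRhs` as a continuous trilinear map. -/
noncomputable def surfaceTrilinear : ((Fin 4 → ℝ) × (Space × Space)) →L[ℝ]
    ((Fin 4 → ℝ) × (Space × Space)) →L[ℝ] ((ℝ × ℝ) →L[ℝ] (Space × Space)) →L[ℝ]
      (Space × Space) :=
  mkTrilinear surfaceRhs
    (fun y z => by
      constructor <;> intros <;> ext1 <;> simp [surfaceRhs] <;> module)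
    (fun x z => by
      constructor <;> intros <;> ext1 <;>
        simp [surfaceRhs, cross_add_left, cross_smul_left] <;> module)
    (fun x y => by
      constructor <;> intros <;> ext1 <;>
        simp [surfaceRhs, cross_add_right, cross_smul_right] <;> module)

/-- The surface system `y₁ = μ y₂ + η n × n₂`, `n₁ = μ n₂ + λ n × y₂` has analytic solutions with
`|n| = 1` and `n ⊥ y₂`. -/
theorem exists_surface_system {μ η lam : ℝ × (ℝ × ℝ) → ℝ} {q : ℝ × ℝ}
    (hμ : AnalyticAt ℝ μ (0, q)) (hη : AnalyticAt ℝ η (0, q)) (hlam : AnalyticAt ℝ lam (0, q)) :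
    ∃ δ > 0, ∃ y n : ℝ × (ℝ × ℝ) → Space,
      AnalyticOnNhd ℝ y (ball (0, q) δ) ∧ AnalyticOnNhd ℝ n (ball (0, q) δ) ∧
      (∀ z ∈ ball ((0 : ℝ), q) δ,
        fderiv ℝ y z (1, 0) = μ z • fderiv ℝ y z (0, (1, 0)) +
          η z • cross (n z) (fderiv ℝ n z (0, (1, 0))) ∧
        fderiv ℝ n z (1, 0) = μ z • fderiv ℝ n z (0, (1, 0)) +
          lam z • cross (n z) (fderiv ℝ y z (0, (1, 0))) ∧
        inner ℝ (n z) (n z) = (1 : ℝ) ∧ inner ℝ (n z) (fderiv ℝ y z (0, (1, 0))) = (0 : ℝ)) ∧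
      inner ℝ (fderiv ℝ n (0, q) (0, (1, 0))) (fderiv ℝ y (0, q) (0, (1, 0))) = (-1 : ℝ) := by
  have hc : AnalyticAt ℝ (fun z => ![1, μ z, η z, lam z]) (0, q) := by
    refine AnalyticAt.pi fun i => ?_
    fin_cases i
    exacts [analyticAt_const, hμ, hη, hlam]
  set E₀ : Space := EuclideanSpace.single 0 1 with hE₀
  set E₁ : Space := EuclideanSpace.single 1 1 with hE₁
  -- The initial curve is an arc of the unit circle, the same for all `t`, with `y = -n`. Thus `n₂ ·
  -- y₂ = -1` on it, which later fixes the orientation and makes the surface immersed.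
  set n₀ : ℝ × ℝ → Space := fun p => Real.cos p.1 • E₀ + Real.sin p.1 • E₁ with hn₀
  have hn₀a : ∀ p, AnalyticAt ℝ n₀ p := fun p =>
    ((Real.analyticAt_cos.comp analyticAt_fst).smul analyticAt_const).add
      ((Real.analyticAt_sin.comp analyticAt_fst).smul analyticAt_const)
  have hw₀ : AnalyticAt ℝ (fun p => (-n₀ p, n₀ p)) q := (hn₀a q).neg.prod (hn₀a q)
  obtain ⟨δ₁, hδ₁, w, hw, hw0, heq⟩ := cauchy_kovalevskaya_coeff surfaceTrilinear hc hw₀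
  obtain ⟨δ₂, hδ₂, hμball⟩ := Metric.eventually_nhds_iff_ball.1
    (hμ.eventually_analyticAt.and (hη.eventually_analyticAt.and hlam.eventually_analyticAt))
  set δ := min δ₁ δ₂ with hδ
  have hδ0 : 0 < δ := lt_min hδ₁ hδ₂
  have hs1 : ball ((0 : ℝ), q) δ ⊆ ball (0, q) δ₁ := ball_subset_ball (min_le_left _ _)
  have hs2 : ball ((0 : ℝ), q) δ ⊆ ball (0, q) δ₂ := ball_subset_ball (min_le_right _ _)
  set y : ℝ × (ℝ × ℝ) → Space := fun z => (w z).1 with hy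
  set n : ℝ × (ℝ × ℝ) → Space := fun z => (w z).2 with hn
  have hya : AnalyticOnNhd ℝ y (ball (0, q) δ) := fun z hz => analyticAt_fst.comp (hw z (hs1 hz))
  have hna : AnalyticOnNhd ℝ n (ball (0, q) δ) := fun z hz => analyticAt_snd.comp (hw z (hs1 hz))
  have hdy : ∀ z ∈ ball ((0 : ℝ), q) δ, ∀ v, fderiv ℝ y z v = (fderiv ℝ w z v).1 := by
    intro z hz v
    have := (ContinuousLinearMap.fst ℝ Space Space).hasFDerivAt.comp z
      (hw z (hs1 hz)).differentiableAt.hasFDerivAt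
    exact congrArg (fun A => A v) this.fderiv
  have hdn : ∀ z ∈ ball ((0 : ℝ), q) δ, ∀ v, fderiv ℝ n z v = (fderiv ℝ w z v).2 := by
    intro z hz v
    have := (ContinuousLinearMap.snd ℝ Space Space).hasFDerivAt.comp z
      (hw z (hs1 hz)).differentiableAt.hasFDerivAt
    exact congrArg (fun A => A v) this.fderiv
  have e1 : ∀ z ∈ ball ((0 : ℝ), q) δ, fderiv ℝ y z (1, 0) = μ z • fderiv ℝ y z (0, (1, 0)) +
          η z • cross (n z) (fderiv ℝ n z (0, (1, 0))) := by
    intro z hz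
    rw [hdy z hz, hdy z hz, hdn z hz, heq z (hs1 hz)]
    simp [surfaceTrilinear, surfaceRhs, hn]
  have e2 : ∀ z ∈ ball ((0 : ℝ), q) δ, fderiv ℝ n z (1, 0) = μ z • fderiv ℝ n z (0, (1, 0)) +
          lam z • cross (n z) (fderiv ℝ y z (0, (1, 0))) := by
    intro z hz
    rw [hdn z hz, hdy z hz, hdn z hz, heq z (hs1 hz)]
    simp [surfaceTrilinear, surfaceRhs, hn]
  have hn0 : ∀ p, n (0, p) = n₀ p := fun p => by simp [hn, hw0]
  have hy0 : ∀ p, y (0, p) = -n₀ p := fun p => by simp [hy, hw0]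
  set n₀' : ℝ × ℝ → Space := fun p => (-Real.sin p.1) • E₀ + Real.cos p.1 • E₁ with hn₀'
  have hdn₀ : ∀ p, HasFDerivAt n₀
      ((ContinuousLinearMap.fst ℝ ℝ ℝ).smulRight (n₀' p)) p := by
    intro p
    have h1 : HasDerivAt (fun s : ℝ => Real.cos s • E₀ + Real.sin s • E₁) (n₀' p) p.1 :=
      ((Real.hasDerivAt_cos _).smul_const E₀).add ((Real.hasDerivAt_sin _).smul_const E₁)
    exact h1.hasFDerivAt.comp p (hasFDerivAt_fst (𝕜 := ℝ))
  have hsn : ∀ p ∈ ball q δ, fderiv ℝ n (0, p) (0, (1, 0)) = n₀' p := by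
    intro p hp
    have h1 := (hna _ (zero_prodMk_mem_ball hp)).differentiableAt.hasFDerivAt.comp p
      (hasFDerivAt_prodMk_right (𝕜 := ℝ) (0 : ℝ) p)
    have h2 := (h1.congr_of_eventuallyEq (f₁ := n₀)
      (Filter.Eventually.of_forall fun p => (hn0 p).symm)).unique (hdn₀ p)
    simpa using congrArg (fun A => A ((1 : ℝ), (0 : ℝ))) h2
  have hsy : ∀ p ∈ ball q δ, fderiv ℝ y (0, p) (0, (1, 0)) = -n₀' p := by
    intro p hp
    have h1 := (hya _ (zero_prodMk_mem_ball hp)).differentiableAt.hasFDerivAt.comp p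
      (hasFDerivAt_prodMk_right (𝕜 := ℝ) (0 : ℝ) p)
    have h2 := (h1.congr_of_eventuallyEq (f₁ := fun p => -n₀ p)
      (Filter.Eventually.of_forall fun p => (hy0 p).symm)).unique (hdn₀ p).fun_neg
    simpa using congrArg (fun A => A ((1 : ℝ), (0 : ℝ))) h2
  have hunit : ∀ p, inner ℝ (n₀ p) (n₀ p) = (1 : ℝ) := fun p => by
    rw [_root_.inner_space]
    simp [hn₀, hE₀, hE₁, ← sq]
  have hunit' : ∀ p, inner ℝ (n₀' p) (n₀' p) = (1 : ℝ) := fun p => by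
    rw [_root_.inner_space]
    simp [hn₀', hE₀, hE₁, ← sq]
  have horth : ∀ p, inner ℝ (n₀ p) (n₀' p) = (0 : ℝ) := fun p => by
    rw [_root_.inner_space]
    simp [hn₀, hn₀', hE₀, hE₁]
    ring
  have hμ' : AnalyticOnNhd ℝ μ (ball (0, q) δ) := fun z hz => (hμball z (hs2 hz)).1
  have hη' : AnalyticOnNhd ℝ η (ball (0, q) δ) := fun z hz => (hμball z (hs2 hz)).2.1
  have hVeq : ∀ z, ((0 : ℝ), (μ z, (0 : ℝ))) = μ z • ((0 : ℝ), ((1 : ℝ), (0 : ℝ))) := fun z => by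
    simp
  have hV : AnalyticOnNhd ℝ (fun z => (μ z, (0 : ℝ))) (ball (0, q) δ) := fun z hz =>
    (hμ' z hz).prod analyticAt_const
  -- The term `n × y₂` is orthogonal to `n`, so `|n|²` is merely transported by `μ`.
  have c1 : Set.EqOn (fun z => inner ℝ (n z) (n z) - (1 : ℝ)) 0 (ball (0, q) δ) := by
    refine eqOn_zero_of_transport (V := fun z => (μ z, 0)) (ν := fun _ => 0)
      (fun z hz => ((hna z hz).inner_space (hna z hz)).sub analyticAt_const) hV
      (fun _ _ => analyticAt_const) (fun p _ => by rw [hn0, hunit, sub_self]) fun z hz => ?_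
    have hd := (hna z hz).differentiableAt
    rw [fderiv_sub_const, hVeq, map_smul, zero_smul, add_zero,
      fderiv_inner_space_apply hd hd, fderiv_inner_space_apply hd hd, e2 z hz]
    simp only [inner_add_left, inner_add_right, real_inner_smul_left, real_inner_smul_right,
      inner_self_cross, inner_cross_self, smul_eq_mul]
    ring
  -- The equation for `y₁` is differentiated in `x₂`. This puts the derivative of `μ` in the
  -- zeroth-order term, and the terms with `η` are orthogonal to `n` or contain `n₂ × n₂`.
  have c2 : Set.EqOn (fun z => inner ℝ (n z) (fderiv ℝ y z (0, (1, 0)))) 0 (ball (0, q) δ) := by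
    refine eqOn_zero_of_transport (V := fun z => (μ z, 0))
      (ν := fun z => fderiv ℝ μ z (0, (1, 0)))
      (fun z hz => (hna z hz).inner_space ((hya z hz).fderiv_apply _)) hV
      (fun z hz => (hμ' z hz).fderiv_apply _)
      (fun p hp => by simp [hn0, hsy p hp, horth]) fun z hz => ?_
    have hdN := (hna z hz).differentiableAt
    have hdY := ((hya z hz).fderiv_apply (0, (1, 0))).differentiableAt
    have hdN2 := ((hna z hz).fderiv_apply (0, (1, 0))).differentiableAt
    have hsw : fderiv ℝ (fun z => fderiv ℝ y z (0, (1, 0))) z (1, 0) =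
        fderiv ℝ (fun z => μ z • fderiv ℝ y z (0, (1, 0)) +
          η z • cross (n z) (fderiv ℝ n z (0, (1, 0)))) z (0, (1, 0)) := by
      rw [(hya z hz).fderiv_fderiv_comm, Filter.EventuallyEq.fderiv_eq
        (Filter.eventuallyEq_of_mem (isOpen_ball.mem_nhds hz) e1)]
    have hcr : DifferentiableAt ℝ (fun z => cross (n z) (fderiv ℝ n z (0, (1, 0)))) z :=
      ((hna z hz).cross ((hna z hz).fderiv_apply _)).differentiableAt
    have hdμ := (hμ' z hz).differentiableAt
    have hdη := (hη' z hz).differentiableAt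
    rw [fderiv_fun_add (hdμ.fun_smul hdY) (hdη.fun_smul hcr), add_apply,
      fderiv_smul_apply hdμ hdY, fderiv_smul_apply hdη hcr, fderiv_cross_apply hdN hdN2] at hsw
    rw [hVeq, map_smul, fderiv_inner_space_apply hdN hdY, fderiv_inner_space_apply hdN hdY, hsw,
      e2 z hz]
    simp only [inner_add_left, inner_add_right, real_inner_smul_left, real_inner_smul_right,
      inner_self_cross, inner_cross_self_right, smul_eq_mul, spaceCross_self, inner_zero_right]
    ring
  refine ⟨δ, hδ0, y, n, hya, hna, fun z hz => ⟨e1 z hz, e2 z hz, ?_, c2 hz⟩, ?_⟩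
  · exact sub_eq_zero.1 (c1 hz)
  · rw [hsn q (mem_ball_self hδ0), hsy q (mem_ball_self hδ0), inner_neg_right, hunit']

end SurfaceSystem

/-! ### Surfaces with prescribed Weingarten equations. -/

section Surface

open Metric

/-- The Weingarten equation for `n₂`, solved from the equation `y₁ = μ y₂ + η n × n₂` of the
surface system with `μ = M / N` and `η = 1 / N`. -/
theorem normal_deriv_of_system {n y₁ y₂ n₂ : Space} {M N : ℝ} (hN : N ≠ 0)
    (hn : inner ℝ n n = (1 : ℝ)) (hn₂ : inner ℝ n n₂ = (0 : ℝ))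
    (hy : y₁ = (M / N) • y₂ + N⁻¹ • cross n n₂) : n₂ = cross n (M • y₂ - N • y₁) := by
  have h : cross n (cross n n₂) = -n₂ := by
    rw [spaceCross_anticomm, spaceCross_cross, hn, real_inner_comm, hn₂]
    simp
  have e : M • y₂ - N • y₁ = -cross n n₂ := by
    rw [hy, smul_add, smul_smul, smul_smul, mul_div_cancel₀ _ hN, mul_inv_cancel₀ hN]
    module
  rw [e, ← neg_one_smul ℝ, cross_smul_right, h]
  simp

/-- The change of variables exchanging the time variable with the first space variable. -/
noncomputable def swapTime (x₀ : Plane) (z : ℝ × Plane) : ℝ × (ℝ × ℝ) :=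
  (z.2 0 - x₀ 0, (z.2 1, z.1))

/-- The inverse of `swapTime`. -/
noncomputable def unswapTime (x₀ : Plane) (p : ℝ × (ℝ × ℝ)) : ℝ × Plane :=
  (p.2.2, p.1 • EuclideanSpace.single 0 1 + p.2.1 • EuclideanSpace.single 1 1 +
    EuclideanSpace.single 0 (x₀ 0))

theorem unswapTime_swapTime (x₀ : Plane) (z : ℝ × Plane) :
    unswapTime x₀ (swapTime x₀ z) = z := by
  refine Prod.ext rfl ?_
  ext i
  fin_cases i <;> simp [unswapTime, swapTime]

theorem swapTime_base (x₀ : Plane) : swapTime x₀ (0, x₀) = (0, (x₀ 1, 0)) := by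
  simp [swapTime]

theorem unswapTime_base (x₀ : Plane) : unswapTime x₀ (0, (x₀ 1, 0)) = (0, x₀) := by
  rw [← swapTime_base, unswapTime_swapTime]

theorem analyticAt_unswapTime (x₀ : Plane) (p : ℝ × (ℝ × ℝ)) :
    AnalyticAt ℝ (unswapTime x₀) p := by
  have h1 : AnalyticAt ℝ (fun p : ℝ × (ℝ × ℝ) => p.2.2) p :=
    ((ContinuousLinearMap.snd ℝ ℝ ℝ).comp (.snd ℝ ℝ (ℝ × ℝ))).analyticAt p
  have h2 : AnalyticAt ℝ (fun p : ℝ × (ℝ × ℝ) => p.2.1) p :=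
    ((ContinuousLinearMap.fst ℝ ℝ ℝ).comp (.snd ℝ ℝ (ℝ × ℝ))).analyticAt p
  exact h1.prod (((analyticAt_fst.smul analyticAt_const).add (h2.smul analyticAt_const)).add
    analyticAt_const)

theorem hasFDerivAt_swapTime (x₀ : Plane) (z : ℝ × Plane) :
    HasFDerivAt (swapTime x₀)
      ((((EuclideanSpace.proj 0 : Plane →L[ℝ] ℝ).comp (.snd ℝ ℝ Plane))).prod
        (((EuclideanSpace.proj 1 : Plane →L[ℝ] ℝ).comp (.snd ℝ ℝ Plane)).prod (.fst ℝ ℝ Plane)))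
      z :=
  (((EuclideanSpace.proj 0 : Plane →L[ℝ] ℝ).comp (.snd ℝ ℝ Plane)).hasFDerivAt.sub_const
      (x₀ 0)).prodMk
    (((EuclideanSpace.proj 1 : Plane →L[ℝ] ℝ).comp (.snd ℝ ℝ Plane)).prod
      (.fst ℝ ℝ Plane)).hasFDerivAt

theorem analyticAt_swapTime (x₀ : Plane) (z : ℝ × Plane) : AnalyticAt ℝ (swapTime x₀) z :=
  (((((EuclideanSpace.proj 0 : Plane →L[ℝ] ℝ).comp (.snd ℝ ℝ Plane))).analyticAt z).sub
    analyticAt_const).prod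
    ((((EuclideanSpace.proj 1 : Plane →L[ℝ] ℝ).comp (.snd ℝ ℝ Plane)).prod
      (.fst ℝ ℝ Plane)).analyticAt z)

theorem swapTime_mem_ball {x₀ : Plane} {δ : ℝ} {z : ℝ × Plane} (hz : z ∈ ball (0, x₀) δ) :
    swapTime x₀ z ∈ ball (0, (x₀ 1, (0 : ℝ))) δ := by
  rw [← ball_prod_same, Set.mem_prod, mem_ball, mem_ball] at hz
  have h : ∀ i, |z.2 i - x₀ i| < δ := fun i => by
    have := (PiLp.norm_apply_le (z.2 - x₀) i).trans_lt (dist_eq_norm z.2 x₀ ▸ hz.2)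
    simpa using this
  rw [← ball_prod_same, ← ball_prod_same]
  refine ⟨?_, ?_, hz.1⟩
  · simpa [Real.dist_eq, swapTime] using h 0
  · simpa [Real.dist_eq, swapTime] using h 1

theorem fderiv_comp_swapTime {F : Type*} [NormedAddCommGroup F] [NormedSpace ℝ F] {x₀ : Plane}
    {f : ℝ × (ℝ × ℝ) → F} {z : ℝ × Plane} (hf : DifferentiableAt ℝ f (swapTime x₀ z))
    (v : ℝ × Plane) :
    fderiv ℝ (fun z => f (swapTime x₀ z)) z v =
      fderiv ℝ f (swapTime x₀ z) (v.2 0, (v.2 1, v.1)) := by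
  have := (hf.hasFDerivAt.comp z (hasFDerivAt_swapTime x₀ z)).fderiv
  exact congrArg (fun A => A v) this

/-- Local analytic families of surfaces with unit normal `n` satisfying the Weingarten equations
`n₁ = n × (L y₂ - M y₁)` and `n₂ = n × (M y₂ - N y₁)`. -/
theorem exists_surface {L M N : ℝ × Plane → ℝ} {x₀ : Plane} (hL : AnalyticAt ℝ L (0, x₀))
    (hM : AnalyticAt ℝ M (0, x₀)) (hN : AnalyticAt ℝ N (0, x₀)) (hN0 : 0 < N (0, x₀)) :
    ∃ δ > 0, ∃ y n : ℝ × Plane → Space,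
      AnalyticOnNhd ℝ y (ball (0, x₀) δ) ∧ AnalyticOnNhd ℝ n (ball (0, x₀) δ) ∧
      ∀ z ∈ ball ((0 : ℝ), x₀) δ,
        inner ℝ (n z) (n z) = (1 : ℝ) ∧
        (∀ i, inner ℝ (n z) (fderiv ℝ y z (0, EuclideanSpace.single i 1)) = (0 : ℝ)) ∧
        fderiv ℝ n z (0, EuclideanSpace.single 0 1) =
          cross (n z) (L z • fderiv ℝ y z (0, EuclideanSpace.single 1 1) -
            M z • fderiv ℝ y z (0, EuclideanSpace.single 0 1)) ∧
        fderiv ℝ n z (0, EuclideanSpace.single 1 1) =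
          cross (n z) (M z • fderiv ℝ y z (0, EuclideanSpace.single 1 1) -
            N z • fderiv ℝ y z (0, EuclideanSpace.single 0 1)) ∧
        0 < inner ℝ (n z) (cross (fderiv ℝ y z (0, EuclideanSpace.single 0 1))
          (fderiv ℝ y z (0, EuclideanSpace.single 1 1))) := by
  set q : ℝ × ℝ := (x₀ 1, 0) with hq
  have hΛ := analyticAt_unswapTime x₀ (0, q)
  have hb : unswapTime x₀ (0, q) = (0, x₀) := unswapTime_base x₀
  have hμ : AnalyticAt ℝ (fun z => M z / N z) (0, x₀) := hM.fun_div hN hN0.ne'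
  have hη : AnalyticAt ℝ (fun z => (N z)⁻¹) (0, x₀) := hN.fun_inv hN0.ne'
  have hlam : AnalyticAt ℝ (fun z => L z - M z * (M z / N z)) (0, x₀) :=
    hL.fun_sub (hM.fun_mul hμ)
  obtain ⟨δ₁, hδ₁, Y, n, hY, hn, heq, hbase⟩ := exists_surface_system (q := q)
    (μ := fun p => M (unswapTime x₀ p) / N (unswapTime x₀ p))
    (η := fun p => (N (unswapTime x₀ p))⁻¹)
    (lam := fun p => L (unswapTime x₀ p) - M (unswapTime x₀ p) *
      (M (unswapTime x₀ p) / N (unswapTime x₀ p)))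
    (AnalyticAt.comp (g := fun z => M z / N z) (by rwa [hb]) hΛ)
    (AnalyticAt.comp (g := fun z => (N z)⁻¹) (by rwa [hb]) hΛ)
    (AnalyticAt.comp (g := fun z => L z - M z * (M z / N z)) (by rwa [hb]) hΛ)
  set y' : ℝ × Plane → Space := fun z => Y (swapTime x₀ z) with hy'
  set n' : ℝ × Plane → Space := fun z => n (swapTime x₀ z) with hn'
  have hya : AnalyticOnNhd ℝ y' (ball (0, x₀) δ₁) := fun z hz =>
    (hY _ (swapTime_mem_ball hz)).comp (analyticAt_swapTime x₀ z)
  have hna : AnalyticOnNhd ℝ n' (ball (0, x₀) δ₁) := fun z hz =>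
    (hn _ (swapTime_mem_ball hz)).comp (analyticAt_swapTime x₀ z)
  have hy0 : ∀ z ∈ ball ((0 : ℝ), x₀) δ₁, fderiv ℝ y' z (0, EuclideanSpace.single 0 1) =
      fderiv ℝ Y (swapTime x₀ z) (1, 0) := fun z hz => by
    rw [hy', fderiv_comp_swapTime (hY _ (swapTime_mem_ball hz)).differentiableAt]; simp; rfl
  have hy1 : ∀ z ∈ ball ((0 : ℝ), x₀) δ₁, fderiv ℝ y' z (0, EuclideanSpace.single 1 1) =
      fderiv ℝ Y (swapTime x₀ z) (0, (1, 0)) := fun z hz => by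
    rw [hy', fderiv_comp_swapTime (hY _ (swapTime_mem_ball hz)).differentiableAt]; simp
  have hn0 : ∀ z ∈ ball ((0 : ℝ), x₀) δ₁, fderiv ℝ n' z (0, EuclideanSpace.single 0 1) =
      fderiv ℝ n (swapTime x₀ z) (1, 0) := fun z hz => by
    rw [hn', fderiv_comp_swapTime (hn _ (swapTime_mem_ball hz)).differentiableAt]; simp; rfl
  have hn1 : ∀ z ∈ ball ((0 : ℝ), x₀) δ₁, fderiv ℝ n' z (0, EuclideanSpace.single 1 1) =
      fderiv ℝ n (swapTime x₀ z) (0, (1, 0)) := fun z hz => by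
    rw [hn', fderiv_comp_swapTime (hn _ (swapTime_mem_ball hz)).differentiableAt]; simp
  have hmem0 : ((0 : ℝ), x₀) ∈ ball ((0 : ℝ), x₀) δ₁ := mem_ball_self hδ₁
  -- derivatives of the unit normal are tangent
  have htan : ∀ z ∈ ball ((0 : ℝ), x₀) δ₁, ∀ v, inner ℝ (n' z) (fderiv ℝ n' z v) = (0 : ℝ) := by
    intro z hz v
    have hd := (hna z hz).differentiableAt
    have h1 : (fun z => inner ℝ (n' z) (n' z)) =ᶠ[𝓝 z] fun _ => (1 : ℝ) :=
      Filter.eventuallyEq_of_mem (isOpen_ball.mem_nhds hz)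
        fun z hz => (heq _ (swapTime_mem_ball hz)).2.2.1
    have h2 := fderiv_inner_space_apply hd hd v
    rw [h1.fderiv_eq, real_inner_comm (n' z)] at h2
    simp at h2
    linarith
  -- At the base point the triple product `n · (y₁ × y₂)` reduces to `-(1 / N) n₂ · y₂ = 1 / N`.
  -- Continuity keeps it positive nearby.
  have horient : 0 < inner ℝ (n' (0, x₀)) (cross
      (fderiv ℝ y' (0, x₀) (0, EuclideanSpace.single 0 1))
      (fderiv ℝ y' (0, x₀) (0, EuclideanSpace.single 1 1))) := by
    obtain ⟨h1, -, h3, h4⟩ := heq _ (swapTime_mem_ball hmem0)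
    have ht := htan _ hmem0 (0, EuclideanSpace.single 1 1)
    rw [hn1 _ hmem0] at ht
    rw [hy0 _ hmem0, hy1 _ hmem0, h1]
    simp only [hn', swapTime_base, ← hq] at ht h3 h4 ⊢
    rw [inner_cross_cycle, inner_add_left, real_inner_smul_left, real_inner_smul_left,
      inner_self_cross, inner_cross_cross, h3, h4, hbase]
    simpa [hb] using hN0
  have hcont : ContinuousAt (fun z => inner ℝ (n' z) (cross
      (fderiv ℝ y' z (0, EuclideanSpace.single 0 1))
      (fderiv ℝ y' z (0, EuclideanSpace.single 1 1)))) (0, x₀) :=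
    ((hna _ hmem0).inner_space (((hya _ hmem0).fderiv_apply _).cross
      ((hya _ hmem0).fderiv_apply _))).continuousAt
  obtain ⟨δ₂, hδ₂, hpos⟩ := Metric.eventually_nhds_iff_ball.1
    ((hcont.eventually (lt_mem_nhds horient)).and (hN.continuousAt.eventually (lt_mem_nhds hN0)))
  have hs1 : ball ((0 : ℝ), x₀) (min δ₁ δ₂) ⊆ ball (0, x₀) δ₁ := ball_subset_ball (min_le_left _ _)
  refine ⟨min δ₁ δ₂, lt_min hδ₁ hδ₂, y', n', hya.mono hs1, hna.mono hs1, fun z hz' => ?_⟩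
  have hz := hs1 hz'
  have hpz := hpos z (ball_subset_ball (min_le_right _ _) hz')
  have hNz := hpz.2.ne'
  obtain ⟨h1, h2, h3, h4⟩ := heq _ (swapTime_mem_ball hz)
  rw [← hy0 _ hz, ← hy1 _ hz, ← hn1 _ hz, unswapTime_swapTime] at h1
  rw [← hn0 _ hz, ← hy1 _ hz, ← hn1 _ hz, unswapTime_swapTime] at h2
  rw [← hy1 _ hz] at h4
  have h5 := normal_deriv_of_system hNz h3 (htan z hz _) h1
  refine ⟨h3, ?_, ?_, h5, hpz.1⟩
  · intro i
    fin_cases i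
    · change inner ℝ (n' z) (fderiv ℝ y' z (0, EuclideanSpace.single 0 1)) = (0 : ℝ)
      rw [h1, inner_add_right, real_inner_smul_right, real_inner_smul_right]
      change _ * inner ℝ (n (swapTime x₀ z)) _ + _ * inner ℝ (n' z) (cross (n' z) _) = _
      rw [h4, inner_self_cross]
      simp
    · exact h4
  -- The coefficient `L - M² / N` is exactly what turns `M / N` times the equation for `n₂` into the
  -- equation for `n₁`.
  · rw [h2, h5]
    change _ • cross (n' z) _ + _ • cross (n' z) _ = _
    rw [← cross_smul_right, ← cross_smul_right, ← cross_add_right]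
    congr 1
    rw [smul_sub, smul_smul, smul_smul, div_mul_cancel₀ _ hNz]
    module

end Surface

/-! ### Vectors relative to the frame of two tangents and the normal. -/

section LinearAlgebra

variable {n a b c : Space}

theorem eq_smul_of_cross_eq_zero (hn : inner ℝ n n = (1 : ℝ)) (h : cross n c = 0) :
    c = (inner ℝ n c : ℝ) • n := by
  have h1 : cross (cross n c) n = 0 := by
    rw [h, ← zero_smul ℝ (0 : Space), cross_smul_left, zero_smul, zero_smul]
  rw [spaceCross_cross, hn, one_smul, real_inner_comm] at h1
  exact sub_eq_zero.1 h1

theorem cross_eq_smul_normal (hn : inner ℝ n n = (1 : ℝ)) (ha : inner ℝ n a = (0 : ℝ))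
    (hb : inner ℝ n b = (0 : ℝ)) : cross a b = (inner ℝ n (cross a b) : ℝ) • n := by
  refine eq_smul_of_cross_eq_zero hn ?_
  rw [spaceCross_anticomm, spaceCross_cross, real_inner_comm, ha, real_inner_comm, hb]
  simp

/-- Pairing `n × (α a + β b)` with `b` and `a` isolates `α` and `β`, up to sign, times the triple
product. -/
theorem coeff_eq_zero_of_cross (hD : inner ℝ n (cross a b) ≠ (0 : ℝ)) {α β : ℝ}
    (h : cross n (α • a + β • b) = 0) : α = 0 ∧ β = 0 := by
  rw [cross_add_right, cross_smul_right, cross_smul_right] at h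
  have hb : inner ℝ b (cross n a) = (inner ℝ n (cross a b) : ℝ) := inner_cross_cycle _ _ _
  have ha : inner ℝ a (cross n b) = -(inner ℝ n (cross a b) : ℝ) := by
    rw [spaceCross_anticomm, inner_neg_right, inner_cross_cycle, inner_cross_cycle]
  have h1 := congrArg (fun v => (inner ℝ b v : ℝ)) h
  have h2 := congrArg (fun v => (inner ℝ a v : ℝ)) h
  simp only [inner_add_right, real_inner_smul_right, inner_self_cross_right, hb, ha,
    inner_zero_right, mul_zero, add_zero, zero_add, mul_eq_zero, hD, neg_eq_zero, or_false]
    at h1 h2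
  exact ⟨h1, h2⟩

/-- A vector orthogonal to a basis is zero. -/
theorem eq_zero_of_inner_frame (hn : inner ℝ n n = (1 : ℝ))
    (hD : inner ℝ n (cross a b) ≠ (0 : ℝ)) (ha : inner ℝ a c = (0 : ℝ))
    (hb : inner ℝ b c = (0 : ℝ)) (hc : inner ℝ n c = (0 : ℝ))
    (hna : inner ℝ n a = (0 : ℝ)) (hnb : inner ℝ n b = (0 : ℝ)) : c = 0 := by
  have h1 : cross (cross a b) c = 0 := by
    rw [spaceCross_cross, ha, hb]; simp
  rw [cross_eq_smul_normal hn hna hnb, cross_smul_left, smul_eq_zero_iff_right hD] at h1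
  rw [eq_smul_of_cross_eq_zero hn h1, hc, zero_smul]

end LinearAlgebra

/-! ### Rules for partial derivatives on the plane. -/

section PartialDerivatives

variable {F : Type*} [NormedAddCommGroup F] [NormedSpace ℝ F] {x : Plane} (i j : Fin 2)

theorem pd_inner {f g : Plane → Space} (hf : DifferentiableAt ℝ f x)
    (hg : DifferentiableAt ℝ g x) : pd i (fun y => inner ℝ (f y) (g y)) x =
      inner ℝ (f x) (pd i g x) + inner ℝ (pd i f x) (g x) :=
  fderiv_inner_space_apply hf hg _

theorem pd_cross {f g : Plane → Space} (hf : DifferentiableAt ℝ f x)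
    (hg : DifferentiableAt ℝ g x) : pd i (fun y => cross (f y) (g y)) x =
      cross (f x) (pd i g x) + cross (pd i f x) (g x) :=
  fderiv_cross_apply hf hg _

theorem pd_smul {a : Plane → ℝ} {g : Plane → F} (ha : DifferentiableAt ℝ a x)
    (hg : DifferentiableAt ℝ g x) :
    pd i (fun y => a y • g y) x = a x • pd i g x + pd i a x • g x :=
  fderiv_smul_apply ha hg _

theorem pd_mul {a b : Plane → ℝ} (ha : DifferentiableAt ℝ a x) (hb : DifferentiableAt ℝ b x) :
    pd i (fun y => a y * b y) x = a x * pd i b x + pd i a x * b x :=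
  fderiv_smul_apply ha hb _

theorem pd_add {f g : Plane → F} (hf : DifferentiableAt ℝ f x) (hg : DifferentiableAt ℝ g x) :
    pd i (fun y => f y + g y) x = pd i f x + pd i g x := by
  rw [pd, fderiv_fun_add hf hg]; rfl

theorem pd_sub {f g : Plane → F} (hf : DifferentiableAt ℝ f x) (hg : DifferentiableAt ℝ g x) :
    pd i (fun y => f y - g y) x = pd i f x - pd i g x := by
  rw [pd, fderiv_fun_sub hf hg]; rfl

theorem pd_congr {f g : Plane → F} {U : Set Plane} (hU : IsOpen U) (hx : x ∈ U)
    (h : Set.EqOn f g U) : pd i f x = pd i g x := by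
  rw [pd, (Filter.eventuallyEq_of_mem (hU.mem_nhds hx) h).fderiv_eq]; rfl

theorem AnalyticAt.pd [CompleteSpace F] {f : Plane → F} (hf : AnalyticAt ℝ f x) :
    AnalyticAt ℝ (FluidGeometry.pd i f) x :=
  hf.fderiv_apply _

theorem pd_comm [CompleteSpace F] {f : Plane → F} (hf : AnalyticAt ℝ f x) :
    pd i (pd j f) x = pd j (pd i f) x :=
  hf.fderiv_fderiv_comm _ _

end PartialDerivatives

/-! ### Gauss formula and Theorema Egregium. -/

section Immersion

/-- The first fundamental form. -/
noncomputable def firstForm (y : Plane → Space) (x : Plane) : Matrix (Fin 2) (Fin 2) ℝ :=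
  Matrix.of fun i j => inner ℝ (pd i y x) (pd j y x)

theorem firstForm_apply (y : Plane → Space) (x : Plane) (i j : Fin 2) :
    firstForm y x i j = inner ℝ (pd i y x) (pd j y x) := rfl

/-- An analytic surface with its positively oriented unit normal. -/
structure IsOrientedSurfaceOn (y n : Plane → Space) (U : Set Plane) : Prop where
  isOpen : IsOpen U
  surface : AnalyticOnNhd ℝ y U
  normal : AnalyticOnNhd ℝ n U
  unit : ∀ x ∈ U, inner ℝ (n x) (n x) = (1 : ℝ)
  orthogonal : ∀ x ∈ U, ∀ i, inner ℝ (n x) (pd i y x) = (0 : ℝ)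
  pos : ∀ x ∈ U, 0 < inner ℝ (n x) (cross (pd 0 y x) (pd 1 y x))

namespace IsOrientedSurfaceOn

variable {y n : Plane → Space} {U : Set Plane} {x : Plane}

/-- By Lagrange's identity the determinant is `|y₁ × y₂|²`, and `y₁ × y₂` is a multiple of the unit
normal. -/
theorem det_firstForm (hS : IsOrientedSurfaceOn y n U) (hx : x ∈ U) :
    (firstForm y x).det = (inner ℝ (n x) (cross (pd 0 y x) (pd 1 y x)) : ℝ) ^ 2 := by
  have h := cross_eq_smul_normal (hS.unit x hx) (hS.orthogonal x hx 0) (hS.orthogonal x hx 1)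
  have h2 := inner_cross_cross (pd 0 y x) (pd 1 y x) (pd 0 y x) (pd 1 y x)
  rw [Matrix.det_fin_two, firstForm_apply, firstForm_apply, firstForm_apply, firstForm_apply, ← h2]
  set D : ℝ := inner ℝ (n x) (cross (pd 0 y x) (pd 1 y x))
  rw [h, real_inner_smul_left, real_inner_smul_right, hS.unit x hx]
  ring

theorem sqrt_det_firstForm (hS : IsOrientedSurfaceOn y n U) (hx : x ∈ U) :
    √(firstForm y x).det = inner ℝ (n x) (cross (pd 0 y x) (pd 1 y x)) := by
  rw [hS.det_firstForm hx, Real.sqrt_sq (hS.pos x hx).le]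

theorem unitNormal_eq (hS : IsOrientedSurfaceOn y n U) (hx : x ∈ U) : unitNormal y x = n x := by
  have h := cross_eq_smul_normal (hS.unit x hx) (hS.orthogonal x hx 0) (hS.orthogonal x hx 1)
  have hn : ‖n x‖ = 1 := by
    have := hS.unit x hx
    rwa [real_inner_self_eq_norm_sq, pow_eq_one_iff_of_nonneg (norm_nonneg _) two_ne_zero] at this
  change ‖cross (pd 0 y x) (pd 1 y x)‖⁻¹ • cross (pd 0 y x) (pd 1 y x) = _
  have hp := hS.pos x hx
  set D : ℝ := inner ℝ (n x) (cross (pd 0 y x) (pd 1 y x))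
  rw [h, norm_smul, hn, mul_one, Real.norm_of_nonneg hp.le, smul_smul, inv_mul_cancel₀ hp.ne',
    one_smul]

theorem fderiv_injective (hS : IsOrientedSurfaceOn y n U) (hx : x ∈ U) : Function.Injective (fderiv ℝ y x) := by
  refine (injective_iff_map_eq_zero _).2 fun v hv => ?_
  have hv2 : v = v 0 • EuclideanSpace.single 0 1 + v 1 • EuclideanSpace.single 1 1 := by
    ext i; fin_cases i <;> simp
  rw [hv2, map_add, map_smul, map_smul] at hv
  have h0 : cross (n x) (v 0 • pd 0 y x + v 1 • pd 1 y x) = 0 := by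
    rw [pd, pd, hv, ← zero_smul ℝ (0 : Space), cross_smul_right, zero_smul, zero_smul]
  obtain ⟨h1, h2⟩ := coeff_eq_zero_of_cross (hS.pos x hx).ne' h0
  rw [hv2, h1, h2]; simp

theorem posDef_firstForm (hS : IsOrientedSurfaceOn y n U) (hx : x ∈ U) : (firstForm y x).PosDef := by
  refine Matrix.posDef_gram_of_linearIndependent (𝕜 := ℝ) (v := fun i => pd i y x) ?_
  refine Fintype.linearIndependent_iff.2 fun c hc => ?_
  rw [Fin.sum_univ_two] at hc
  have h0 : cross (n x) (c 0 • pd 0 y x + c 1 • pd 1 y x) = 0 := by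
    rw [hc, ← zero_smul ℝ (0 : Space), cross_smul_right, zero_smul, zero_smul]
  have := coeff_eq_zero_of_cross (hS.pos x hx).ne' h0
  exact Fin.forall_fin_two.2 this

theorem isIsometricImmersionOn (hS : IsOrientedSurfaceOn y n U) : IsIsometricImmersionOn (firstForm y) y U where
  smooth := fun _ hx => (hS.surface _ hx).contDiffAt.contDiffWithinAt
  posDef := fun _ hx => hS.posDef_firstForm hx
  immersion := fun _ hx => hS.fderiv_injective hx
  isometric := fun _ _ _ _ => rfl

theorem pd_firstForm (hS : IsOrientedSurfaceOn y n U) (hx : x ∈ U) (k i j : Fin 2) : pd k (fun z => firstForm y z i j) x =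
    inner ℝ (pd i y x) (pd k (pd j y) x) + inner ℝ (pd k (pd i y) x) (pd j y x) :=
  pd_inner k ((hS.surface x hx).pd i).differentiableAt ((hS.surface x hx).pd j).differentiableAt

/-- For an induced metric, symmetry of second derivatives collapses the three metric derivatives to
`2 y_l · y_ij`. -/
theorem christoffel_eq (hS : IsOrientedSurfaceOn y n U) (hx : x ∈ U) (k i j : Fin 2) : christoffel (firstForm y) k i j x =
    ∑ l, (firstForm y x)⁻¹ k l * inner ℝ (pd l y x) (pd i (pd j y) x) := by
  rw [christoffel, Finset.mul_sum]
  refine Finset.sum_congr rfl fun l _ => ?_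
  have hy := hS.surface x hx
  rw [hS.pd_firstForm hx, hS.pd_firstForm hx, hS.pd_firstForm hx, pd_comm j i hy, pd_comm l i hy,
    pd_comm l j hy, real_inner_comm (pd l y x) (pd i (pd j y) x),
    real_inner_comm (pd j y x) (pd i (pd l y) x)]
  ring

theorem sum_firstForm_mul_christoffel (hS : IsOrientedSurfaceOn y n U) (hx : x ∈ U) (l i j : Fin 2) :
    ∑ m, firstForm y x l m * christoffel (firstForm y) m i j x =
      inner ℝ (pd l y x) (pd i (pd j y) x) := by
  have hdet : IsUnit (firstForm y x).det := by
    rw [hS.det_firstForm hx]; exact (pow_pos (hS.pos x hx) 2).ne'.isUnit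
  have h := Matrix.mul_nonsing_inv _ hdet
  have : (firstForm y x).mulVec ((firstForm y x)⁻¹.mulVec
      fun l => inner ℝ (pd l y x) (pd i (pd j y) x)) l = inner ℝ (pd l y x) (pd i (pd j y) x) := by
    rw [Matrix.mulVec_mulVec, h, Matrix.one_mulVec]
  rw [← this]
  simp only [hS.christoffel_eq hx]
  rfl

/-- The difference of the two sides is orthogonal to `y₁`, `y₂` and `n`. -/
theorem gauss_formula (hS : IsOrientedSurfaceOn y n U) (hx : x ∈ U) (i j : Fin 2) : pd i (pd j y) x =
    christoffel (firstForm y) 0 i j x • pd 0 y x + christoffel (firstForm y) 1 i j x • pd 1 y x +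
      (inner ℝ (n x) (pd i (pd j y) x) : ℝ) • n x := by
  have h0 := hS.orthogonal x hx 0
  have h1 := hS.orthogonal x hx 1
  have ho : ∀ i, inner ℝ (pd i y x) (n x) = (0 : ℝ) := fun i => by
    rw [real_inner_comm, hS.orthogonal x hx]
  have hl : ∀ l, inner ℝ (pd l y x) (pd i (pd j y) x -
    (christoffel (firstForm y) 0 i j x • pd 0 y x + christoffel (firstForm y) 1 i j x • pd 1 y x +
      (inner ℝ (n x) (pd i (pd j y) x) : ℝ) • n x)) = (0 : ℝ) := fun l => by
    have := hS.sum_firstForm_mul_christoffel hx l i j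
    rw [Fin.sum_univ_two, firstForm_apply, firstForm_apply] at this
    simp only [inner_sub_right, inner_add_right, real_inner_smul_right, ho]
    linarith
  refine sub_eq_zero.1 (eq_zero_of_inner_frame (hS.unit x hx) (hS.pos x hx).ne' (hl 0) (hl 1) ?_
    h0 h1)
  simp only [inner_sub_right, inner_add_right, real_inner_smul_right, h0, h1, hS.unit x hx]
  ring

theorem analyticAt_firstForm (hS : IsOrientedSurfaceOn y n U) (hx : x ∈ U) (i j : Fin 2) : AnalyticAt ℝ (fun x => firstForm y x i j) x :=
  ((hS.surface x hx).pd i).inner_space ((hS.surface x hx).pd j)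

theorem analyticAt_inv_firstForm (hS : IsOrientedSurfaceOn y n U) (hx : x ∈ U) (i j : Fin 2) :
    AnalyticAt ℝ (fun x => (firstForm y x)⁻¹ i j) x := by
  have h : ∀ i j, AnalyticAt ℝ (fun x => (firstForm y x).adjugate i j) x := fun i j => by
    have ha := fun i j => hS.analyticAt_firstForm hx i j
    simp only [Matrix.adjugate_fin_two]
    fin_cases i <;> fin_cases j
    exacts [ha 1 1, (ha 0 1).fun_neg, (ha 1 0).fun_neg, ha 0 0]
  have hd : AnalyticAt ℝ (fun x => (firstForm y x).det) x := by
    have ha := fun i j => hS.analyticAt_firstForm hx i j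
    simp only [Matrix.det_fin_two]
    exact ((ha 0 0).fun_mul (ha 1 1)).fun_sub ((ha 0 1).fun_mul (ha 1 0))
  have hd0 : (firstForm y x).det ≠ 0 := by
    rw [hS.det_firstForm hx]; exact (pow_pos (hS.pos x hx) 2).ne'
  simp only [Matrix.inv_def, Ring.inverse_eq_inv', Matrix.smul_apply, smul_eq_mul]
  exact (hd.fun_inv hd0).fun_mul (h i j)

theorem differentiableAt_christoffel (hS : IsOrientedSurfaceOn y n U) (hx : x ∈ U) (k i j : Fin 2) :
    DifferentiableAt ℝ (christoffel (firstForm y) k i j) x := by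
  refine AnalyticAt.differentiableAt ?_
  have ha : ∀ i j m, AnalyticAt ℝ (pd m (fun z => firstForm y z i j)) x := fun i j m =>
    (hS.analyticAt_firstForm hx i j).pd m
  refine AnalyticAt.fun_mul analyticAt_const (Finset.analyticAt_fun_sum _ fun l _ => ?_)
  exact (hS.analyticAt_inv_firstForm hx k l).fun_mul
    (((ha i l j).fun_add (ha j l i)).fun_sub (ha i j l))

/-- Theorema Egregium. The relation `g_lm Γ^m_ij = y_l · y_ij` is differentiated in `k` and
antisymmetrized in `j, k`. The third derivatives cancel, and the Gauss formula separates the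
products of second derivatives into Christoffel terms and normal components. -/
theorem riemann_firstForm (hS : IsOrientedSurfaceOn y n U) (hx : x ∈ U) (i l j k : Fin 2) : riemann (firstForm y) i l j k x =
    inner ℝ (n x) (pd i (pd j y) x) * inner ℝ (n x) (pd l (pd k y) x) -
      inner ℝ (n x) (pd i (pd k y) x) * inner ℝ (n x) (pd l (pd j y) x) := by
  have hy := hS.surface x hx
  have key : ∀ i j k, ∑ m, (firstForm y x l m * pd k (christoffel (firstForm y) m i j) x +
      christoffel (firstForm y) m i j x * (inner ℝ (pd l y x) (pd k (pd m y) x) +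
        inner ℝ (pd k (pd l y) x) (pd m y x))) =
      inner ℝ (pd l y x) (pd k (pd i (pd j y)) x) +
        inner ℝ (pd k (pd l y) x) (pd i (pd j y) x) := by
    intro i j k
    have h1 := pd_congr k hS.isOpen hx
      (fun z hz => hS.sum_firstForm_mul_christoffel hz l i j)
    rw [pd_inner k (hy.pd l).differentiableAt ((hy.pd j).pd i).differentiableAt] at h1
    rw [← h1]
    simp only [Fin.sum_univ_two]
    rw [pd_add, pd_mul, pd_mul, hS.pd_firstForm hx, hS.pd_firstForm hx]
    · ring
    all_goals first
      | exact hS.differentiableAt_christoffel hx _ _ _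
      | exact (hS.analyticAt_firstForm hx _ _).differentiableAt
      | exact (hS.analyticAt_firstForm hx _ _).differentiableAt.fun_mul
          (hS.differentiableAt_christoffel hx _ _ _)
  have tang : ∀ a b i j, inner ℝ (pd a (pd b y) x) (pd i (pd j y) x) =
      christoffel (firstForm y) 0 i j x * inner ℝ (pd a (pd b y) x) (pd 0 y x) +
      christoffel (firstForm y) 1 i j x * inner ℝ (pd a (pd b y) x) (pd 1 y x) +
      inner ℝ (n x) (pd i (pd j y) x) * inner ℝ (n x) (pd a (pd b y) x) := by
    intro a b i j
    rw [hS.gauss_formula hx i j, inner_add_right, inner_add_right, real_inner_smul_right,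
      real_inner_smul_right, real_inner_smul_right, real_inner_comm (n x) (pd a (pd b y) x),
      ← hS.gauss_formula hx i j]
  have third : pd k (pd i (pd j y)) x = pd j (pd i (pd k y)) x := by
    rw [pd_congr k hS.isOpen hx (fun z hz => pd_comm i j (hS.surface z hz)),
      pd_comm k j (hy.pd i), pd_congr j hS.isOpen hx (fun z hz => pd_comm k i (hS.surface z hz))]
  have k1 := key i j k
  have k2 := key i k j
  rw [tang] at k1 k2
  rw [third] at k1
  have s : ∀ m, ∑ a, firstForm y x l a * christoffel (firstForm y) a m k x =
      inner ℝ (pd l y x) (pd k (pd m y) x) := fun m => by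
    rw [hS.sum_firstForm_mul_christoffel hx, pd_comm m k hy]
  have s' : ∀ m, ∑ a, firstForm y x l a * christoffel (firstForm y) a m j x =
      inner ℝ (pd l y x) (pd j (pd m y) x) := fun m => by
    rw [hS.sum_firstForm_mul_christoffel hx, pd_comm m j hy]
  rw [riemann]
  simp only [Fin.sum_univ_two] at k1 k2 s s' ⊢
  simp only [← s, ← s'] at k1 k2
  rw [pd_comm l k hy, pd_comm l j hy]
  linear_combination k1 - k2

/-- Differentiation of `n · y_j = 0`. -/
theorem inner_normal_second (hS : IsOrientedSurfaceOn y n U) (hx : x ∈ U) (i j : Fin 2) :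
    inner ℝ (n x) (pd i (pd j y) x) = -(inner ℝ (pd i n x) (pd j y x) : ℝ) := by
  have h := pd_congr i hS.isOpen hx (fun z hz => hS.orthogonal z hz j)
  rw [pd_inner i (hS.normal x hx).differentiableAt
    ((hS.surface x hx).pd j).differentiableAt] at h
  have h2 : pd i (fun _ : Plane => (0 : ℝ)) x = 0 := by simp [pd]
  linarith

end IsOrientedSurfaceOn

end Immersion

/-! ### Gauss and Codazzi equations from the Weingarten equations. -/

section Weingarten

/-- The Weingarten equations of a surface with second fundamental form `√(det g) (L, M, N)`. -/
structure IsWeingartenOn (y n : Plane → Space) (L M N : Plane → ℝ) (U : Set Plane) : Prop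
    extends IsOrientedSurfaceOn y n U where
  analytic_L : AnalyticOnNhd ℝ L U
  analytic_M : AnalyticOnNhd ℝ M U
  analytic_N : AnalyticOnNhd ℝ N U
  normal_zero : ∀ x ∈ U, pd 0 n x = cross (n x) (L x • pd 1 y x - M x • pd 0 y x)
  normal_one : ∀ x ∈ U, pd 1 n x = cross (n x) (M x • pd 1 y x - N x • pd 0 y x)

namespace IsWeingartenOn

variable {y n : Plane → Space} {L M N : Plane → ℝ} {U : Set Plane} {x : Plane}

/-- The coefficients are `-nᵢ · yⱼ`; in the Weingarten equations these become multiples of `n · (y₁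
× y₂) = √(det g)`, which explains the normalization of `L, M, N`. -/
theorem second_form (hS : IsWeingartenOn y n L M N U) (hx : x ∈ U) :
    inner ℝ (n x) (pd 0 (pd 0 y) x) = √(firstForm y x).det * L x ∧
    inner ℝ (n x) (pd 0 (pd 1 y) x) = √(firstForm y x).det * M x ∧
    inner ℝ (n x) (pd 1 (pd 1 y) x) = √(firstForm y x).det * N x := by
  have h1 : inner ℝ (cross (n x) (pd 0 y x)) (pd 1 y x) =
      (inner ℝ (n x) (cross (pd 0 y x) (pd 1 y x)) : ℝ) := by
    rw [real_inner_comm, inner_cross_cycle]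
  have h2 : inner ℝ (cross (n x) (pd 1 y x)) (pd 0 y x) =
      -(inner ℝ (n x) (cross (pd 0 y x) (pd 1 y x)) : ℝ) := by
    rw [real_inner_comm, spaceCross_anticomm, inner_neg_right, inner_cross_cycle,
      inner_cross_cycle]
  rw [hS.sqrt_det_firstForm hx, hS.inner_normal_second hx, hS.inner_normal_second hx,
    hS.inner_normal_second hx, hS.normal_zero x hx, hS.normal_one x hx]
  simp only [cross_sub_right, cross_smul_right, inner_sub_left, real_inner_smul_left, h1, h2,
    inner_cross_self_right]
  refine ⟨?_, ?_, ?_⟩ <;> ring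

theorem secondForm_eq (hS : IsWeingartenOn y n L M N U) (hx : x ∈ U) :
    secondForm y 0 0 x = √(firstForm y x).det * L x ∧
    secondForm y 0 1 x = √(firstForm y x).det * M x ∧
    secondForm y 1 1 x = √(firstForm y x).det * N x := by
  simp only [secondForm, hS.unitNormal_eq hx]
  exact hS.second_form hx

theorem gauss_equation (hS : IsWeingartenOn y n L M N U) (hx : x ∈ U) :
    L x * N x - M x ^ 2 = gaussCurvature (firstForm y) x := by
  obtain ⟨h0, h1, h2⟩ := hS.second_form hx
  have hp : 0 < (firstForm y x).det := by
    rw [hS.det_firstForm hx]; exact pow_pos (hS.pos x hx) 2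
  rw [gaussCurvature, hS.riemann_firstForm hx, pd_comm 1 0 (hS.surface x hx), h0, h1, h2,
    eq_div_iff hp.ne']
  linear_combination -(L x * N x - M x ^ 2) * Real.sq_sqrt hp.le

/-- This is `n₁₂ = n₂₁` with the Weingarten equations inserted. -/
theorem codazzi_vector (hS : IsWeingartenOn y n L M N U) (hx : x ∈ U) :
    cross (n x) ((L x • pd 1 (pd 1 y) x + pd 1 L x • pd 1 y x -
        (M x • pd 1 (pd 0 y) x + pd 1 M x • pd 0 y x)) -
      (M x • pd 0 (pd 1 y) x + pd 0 M x • pd 1 y x -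
        (N x • pd 0 (pd 0 y) x + pd 0 N x • pd 0 y x))) = 0 := by
  have hy := hS.surface x hx
  have hL := (hS.analytic_L x hx).differentiableAt
  have hM := (hS.analytic_M x hx).differentiableAt
  have hN := (hS.analytic_N x hx).differentiableAt
  have hn := (hS.normal x hx).differentiableAt
  have hd : ∀ i, DifferentiableAt ℝ (pd i y) x := fun i => (hy.pd i).differentiableAt
  have hc := pd_comm 1 0 (hS.normal x hx)
  rw [pd_congr 1 hS.isOpen hx hS.normal_zero, pd_congr 0 hS.isOpen hx hS.normal_one,
    pd_cross 1 hn ((hL.fun_smul (hd 1)).fun_sub (hM.fun_smul (hd 0))),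
    pd_cross 0 hn ((hM.fun_smul (hd 1)).fun_sub (hN.fun_smul (hd 0))),
    pd_sub 1 (hL.fun_smul (hd 1)) (hM.fun_smul (hd 0)),
    pd_sub 0 (hM.fun_smul (hd 1)) (hN.fun_smul (hd 0)), pd_smul 1 hL (hd 1), pd_smul 1 hM (hd 0),
    pd_smul 0 hM (hd 1), pd_smul 0 hN (hd 0), hS.normal_zero x hx, hS.normal_one x hx,
    spaceCross_cross, spaceCross_cross] at hc
  have ho : ∀ a b : ℝ, inner ℝ (n x) (a • pd 1 y x - b • pd 0 y x) = (0 : ℝ) := fun a b => by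
    rw [inner_sub_right, real_inner_smul_right, real_inner_smul_right, hS.orthogonal x hx,
      hS.orthogonal x hx]
    simp
  -- With `a`, `b` tangent, `(n × a) × b = -(a · b) n` is symmetric in `a` and `b`, so these terms
  -- cancel.
  rw [ho, ho, real_inner_comm (M x • pd 1 y x - N x • pd 0 y x), zero_smul, zero_smul, add_left_inj,
    ← sub_eq_zero,
    ← cross_sub_right] at hc
  exact hc

/-- After the second derivatives are expanded by the Gauss formula, `n ×` removes the normal parts,
and the coefficients of `y₁` and `y₂` are the two Codazzi equations. -/
theorem gaussCodazziAt (hS : IsWeingartenOn y n L M N U) (hx : x ∈ U) :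
    GaussCodazziAt (firstForm y) L M N x := by
  have hy := hS.surface x hx
  have h : cross (n x)
      ((pd 0 N x - pd 1 M x + christoffel (firstForm y) 0 1 1 x * L x -
          2 * christoffel (firstForm y) 0 0 1 x * M x + christoffel (firstForm y) 0 0 0 x * N x) •
          pd 0 y x +
        (pd 1 L x - pd 0 M x + christoffel (firstForm y) 1 1 1 x * L x -
          2 * christoffel (firstForm y) 1 0 1 x * M x + christoffel (firstForm y) 1 0 0 x * N x) •
          pd 1 y x) = 0 := by
    rw [← hS.codazzi_vector hx, pd_comm 1 0 hy, hS.gauss_formula hx 1 1, hS.gauss_formula hx 0 1,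
      hS.gauss_formula hx 0 0]
    simp only [cross_add_right, cross_sub_right, cross_smul_right, spaceCross_self, smul_zero,
      add_zero]
    module
  obtain ⟨h0, h1⟩ := coeff_eq_zero_of_cross (hS.pos x hx).ne' h
  exact ⟨by linarith, by linarith, hS.gauss_equation hx⟩

end IsWeingartenOn

end Weingarten

/-! ### Partial derivatives on slices of space-time. -/

section Slices

variable {F : Type*} [NormedAddCommGroup F] [NormedSpace ℝ F] {f : ℝ × Plane → F} {t : ℝ}
  {x : Plane}

theorem pd_slice (i : Fin 2) (hf : DifferentiableAt ℝ f (t, x)) :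
    pd i (fun x => f (t, x)) x = fderiv ℝ f (t, x) (0, EuclideanSpace.single i 1) :=
  congrArg (fun A => A (EuclideanSpace.single i 1))
    (hf.hasFDerivAt.comp x (hasFDerivAt_prodMk_right (𝕜 := ℝ) t x)).fderiv

theorem deriv_slice (hf : DifferentiableAt ℝ f (t, x)) :
    deriv (fun s => f (s, x)) t = fderiv ℝ f (t, x) (1, 0) :=
  (hf.hasFDerivAt.comp_hasDerivAt t ((hasDerivAt_id t).prodMk (hasDerivAt_const t x))).deriv

theorem pd_pd_slice [CompleteSpace F] (i j : Fin 2) (hf : AnalyticAt ℝ f (t, x)) :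
    pd i (pd j fun x => f (t, x)) x = fderiv ℝ
      (fun z => fderiv ℝ f z (0, EuclideanSpace.single j 1)) (t, x)
        (0, EuclideanSpace.single i 1) := by
  rw [← pd_slice i (hf.fderiv_apply _).differentiableAt]
  have hc : ContinuousAt (fun x : Plane => (t, x)) x := by fun_prop
  have h : pd j (fun x => f (t, x)) =ᶠ[𝓝 x]
      fun x => fderiv ℝ f (t, x) (0, EuclideanSpace.single j 1) :=
    (hc.eventually hf.eventually_analyticAt).mono fun x hx => pd_slice j hx.differentiableAt
  rw [pd, h.fderiv_eq]
  rfl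

theorem deriv_deriv_slice [CompleteSpace F] (hf : AnalyticAt ℝ f (t, x)) :
    deriv (deriv fun s => f (s, x)) t =
      fderiv ℝ (fun z => fderiv ℝ f z (1, 0)) (t, x) (1, 0) := by
  rw [← deriv_slice (hf.fderiv_apply _).differentiableAt]
  have hc : ContinuousAt (fun s : ℝ => (s, x)) t := by fun_prop
  have h : deriv (fun s => f (s, x)) =ᶠ[𝓝 t] fun s => fderiv ℝ f (s, x) (1, 0) :=
    (hc.eventually hf.eventually_analyticAt).mono fun x hx => deriv_slice hx.differentiableAt
  exact h.deriv_eq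

end Slices

/-! ### From the primitive to the conservative Euler equations. -/

section Euler

variable {V : Type*} [NormedAddCommGroup V] [NormedSpace ℝ V]

/-- The momentum flux `ρ a² + p` as a function of `log ρ` and `a`. -/
noncomputable def normalFlux (γ : ℝ) (l a : V → ℝ) (z : V) : ℝ :=
  Real.exp (l z) * a z ^ 2 + pressure γ (Real.exp (l z))

/-- The momentum flux `ρ a b` as a function of `log ρ`, `a` and `b`. -/
noncomputable def shearFlux (l a b : V → ℝ) (z : V) : ℝ :=
  Real.exp (l z) * a z * b z

/-- The momentum density `ρ a` as a function of `log ρ` and `a`. -/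
noncomputable def momentum (l a : V → ℝ) (z : V) : ℝ :=
  Real.exp (l z) * a z

variable {γ : ℝ} {l a b : V → ℝ} {z : V}

theorem pressure_exp (γ r : ℝ) : pressure γ (Real.exp r) = Real.exp (r * γ) / γ := by
  rw [pressure, Real.exp_mul]

theorem AnalyticAt.normalFlux (hl : AnalyticAt ℝ l z) (ha : AnalyticAt ℝ a z) :
    AnalyticAt ℝ (normalFlux γ l a) z := by
  have h : _root_.normalFlux γ l a =
      fun z => Real.exp (l z) * a z ^ 2 + Real.exp (l z * γ) / γ := by
    ext z; rw [_root_.normalFlux, pressure_exp]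
  rw [h]
  exact (hl.rexp'.fun_mul (ha.fun_pow 2)).fun_add
    ((hl.fun_mul analyticAt_const).rexp'.fun_mul (analyticAt_const (v := γ⁻¹)))

theorem AnalyticAt.momentum (hl : AnalyticAt ℝ l z) (ha : AnalyticAt ℝ a z) :
    AnalyticAt ℝ (momentum l a) z :=
  hl.rexp'.fun_mul ha

theorem AnalyticAt.shearFlux (hl : AnalyticAt ℝ l z) (ha : AnalyticAt ℝ a z)
    (hb : AnalyticAt ℝ b z) : AnalyticAt ℝ (shearFlux l a b) z :=
  (hl.rexp'.fun_mul ha).fun_mul hb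

theorem fderiv_exp_comp_apply (hl : DifferentiableAt ℝ l z) (v : V) :
    fderiv ℝ (fun z => Real.exp (l z)) z v = Real.exp (l z) * fderiv ℝ l z v := by
  rw [fderiv_exp hl]; rfl

theorem fderiv_momentum_apply (hl : DifferentiableAt ℝ l z) (ha : DifferentiableAt ℝ a z) (v : V) :
    fderiv ℝ (momentum l a) z v =
      Real.exp (l z) * (fderiv ℝ a z v + a z * fderiv ℝ l z v) := by
  refine (fderiv_smul_apply (a := fun z => Real.exp (l z)) hl.exp ha v).trans ?_
  rw [fderiv_exp_comp_apply hl, smul_eq_mul, smul_eq_mul]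
  ring

theorem fderiv_shearFlux_apply (hl : DifferentiableAt ℝ l z) (ha : DifferentiableAt ℝ a z)
    (hb : DifferentiableAt ℝ b z) (v : V) : fderiv ℝ (shearFlux l a b) z v = Real.exp (l z) *
      (fderiv ℝ a z v * b z + a z * fderiv ℝ b z v + a z * b z * fderiv ℝ l z v) := by
  refine (fderiv_smul_apply (a := momentum l a) (hl.exp.fun_mul ha) hb v).trans ?_
  rw [fderiv_momentum_apply hl ha, smul_eq_mul, smul_eq_mul, momentum]
  ring

/-- The last term is the pressure gradient: `dp = ρ ^ (γ - 1) dρ`, with `dρ = ρ d log ρ`. -/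
theorem fderiv_normalFlux_apply (hγ : γ ≠ 0) (hl : DifferentiableAt ℝ l z)
    (ha : DifferentiableAt ℝ a z) (v : V) : fderiv ℝ (normalFlux γ l a) z v =
      Real.exp (l z) * (2 * a z * fderiv ℝ a z v + a z ^ 2 * fderiv ℝ l z v +
        Real.exp ((γ - 1) * l z) * fderiv ℝ l z v) := by
  have h : normalFlux γ l a = fun z => shearFlux l a a z + γ⁻¹ * Real.exp (γ * l z) := by
    ext z; rw [normalFlux, pressure_exp, shearFlux, mul_comm γ]; ring
  have hs : DifferentiableAt ℝ (shearFlux l a a) z := (hl.exp.fun_mul ha).fun_mul ha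
  have he : Real.exp (γ * l z) = Real.exp (l z) * Real.exp ((γ - 1) * l z) := by
    rw [← Real.exp_add]; ring_nf
  rw [h, fderiv_fun_add hs ((hl.const_mul γ).exp.const_mul _), add_apply,
    fderiv_shearFlux_apply hl ha ha, fderiv_const_mul (hl.const_mul γ).exp,
    fderiv_exp (hl.const_mul γ), fderiv_const_mul hl, he]
  simp only [smul_apply, smul_eq_mul]
  field_simp
  ring

/-- The Euler equations in terms of `log ρ` and the velocity. -/
def PrimitiveEulerAt (γ : ℝ) (l u v : ℝ × Plane → ℝ) (z : ℝ × Plane) : Prop :=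
  fderiv ℝ l z (1, 0) = -(u z * fderiv ℝ l z (0, EuclideanSpace.single 0 1) +
    v z * fderiv ℝ l z (0, EuclideanSpace.single 1 1) +
    (fderiv ℝ u z (0, EuclideanSpace.single 0 1) +
      fderiv ℝ v z (0, EuclideanSpace.single 1 1))) ∧
  fderiv ℝ u z (1, 0) = -(u z * fderiv ℝ u z (0, EuclideanSpace.single 0 1) +
    v z * fderiv ℝ u z (0, EuclideanSpace.single 1 1) +
    Real.exp ((γ - 1) * l z) * fderiv ℝ l z (0, EuclideanSpace.single 0 1)) ∧
  fderiv ℝ v z (1, 0) = -(u z * fderiv ℝ v z (0, EuclideanSpace.single 0 1) +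
    v z * fderiv ℝ v z (0, EuclideanSpace.single 1 1) +
    Real.exp ((γ - 1) * l z) * fderiv ℝ l z (0, EuclideanSpace.single 1 1))

variable {l u v : ℝ × Plane → ℝ} {z : ℝ × Plane}

theorem PrimitiveEulerAt.conservative (h : PrimitiveEulerAt γ l u v z) (hγ : γ ≠ 0)
    (hl : DifferentiableAt ℝ l z) (hu : DifferentiableAt ℝ u z) (hv : DifferentiableAt ℝ v z) :
    fderiv ℝ (normalFlux γ l u) z (0, EuclideanSpace.single 0 1) +
      fderiv ℝ (shearFlux l u v) z (0, EuclideanSpace.single 1 1) =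
        -fderiv ℝ (momentum l u) z (1, 0) ∧
    fderiv ℝ (shearFlux l u v) z (0, EuclideanSpace.single 0 1) +
      fderiv ℝ (normalFlux γ l v) z (0, EuclideanSpace.single 1 1) =
        -fderiv ℝ (momentum l v) z (1, 0) ∧
    fderiv ℝ (momentum l u) z (0, EuclideanSpace.single 0 1) +
      fderiv ℝ (momentum l v) z (0, EuclideanSpace.single 1 1) =
        -fderiv ℝ (fun z => Real.exp (l z)) z (1, 0) := by
  obtain ⟨h1, h2, h3⟩ := h
  simp only [fderiv_normalFlux_apply hγ hl hu, fderiv_normalFlux_apply hγ hl hv,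
    fderiv_shearFlux_apply hl hu hv, fderiv_momentum_apply hl hu, fderiv_momentum_apply hl hv,
    fderiv_exp_comp_apply hl, h1, h2, h3]
  refine ⟨?_, ?_, ?_⟩ <;> ring

/-- The divergence of the momentum equations. -/
theorem divergence_of_conservative {U : Set (ℝ × Plane)} (hU : IsOpen U) (hz : z ∈ U)
    {P Q R m₀ m₁ ρ : ℝ × Plane → ℝ}
    (hP : AnalyticAt ℝ P z) (hQ : AnalyticAt ℝ Q z) (hR : AnalyticAt ℝ R z)
    (hm₀ : AnalyticAt ℝ m₀ z) (hm₁ : AnalyticAt ℝ m₁ z) (hρ : AnalyticAt ℝ ρ z)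
    (h₀ : ∀ z ∈ U, fderiv ℝ P z (0, EuclideanSpace.single 0 1) +
      fderiv ℝ Q z (0, EuclideanSpace.single 1 1) = -fderiv ℝ m₀ z (1, 0))
    (h₁ : ∀ z ∈ U, fderiv ℝ Q z (0, EuclideanSpace.single 0 1) +
      fderiv ℝ R z (0, EuclideanSpace.single 1 1) = -fderiv ℝ m₁ z (1, 0))
    (h₂ : ∀ z ∈ U, fderiv ℝ m₀ z (0, EuclideanSpace.single 0 1) +
      fderiv ℝ m₁ z (0, EuclideanSpace.single 1 1) = -fderiv ℝ ρ z (1, 0)) :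
    fderiv ℝ (fun z => fderiv ℝ P z (0, EuclideanSpace.single 0 1)) z
        (0, EuclideanSpace.single 0 1) +
      2 * fderiv ℝ (fun z => fderiv ℝ Q z (0, EuclideanSpace.single 1 1)) z
        (0, EuclideanSpace.single 0 1) +
      fderiv ℝ (fun z => fderiv ℝ R z (0, EuclideanSpace.single 1 1)) z
        (0, EuclideanSpace.single 1 1) =
      fderiv ℝ (fun z => fderiv ℝ ρ z (1, 0)) z (1, 0) := by
  have key : ∀ {A B C : ℝ × Plane → ℝ} (a b c w : ℝ × Plane), AnalyticAt ℝ A z →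
      AnalyticAt ℝ B z → AnalyticAt ℝ C z →
      (∀ z ∈ U, fderiv ℝ A z a + fderiv ℝ B z b = -fderiv ℝ C z c) →
      fderiv ℝ (fun z => fderiv ℝ A z a) z w + fderiv ℝ (fun z => fderiv ℝ B z b) z w =
        -fderiv ℝ (fun z => fderiv ℝ C z c) z w := by
    intro A B C a b c w hA hB hC h
    have h1 := (Filter.eventuallyEq_of_mem (hU.mem_nhds hz) h).fderiv_eq (𝕜 := ℝ)
    rw [fderiv_fun_add (hA.fderiv_apply _).differentiableAt
      (hB.fderiv_apply _).differentiableAt, fderiv_fun_neg] at h1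
    exact congrArg (fun A => A w) h1
  -- The `x₁`-derivative of the first momentum equation and the `x₂`-derivative of the second are
  -- added; the time derivative of the mass equation removes the momenta.
  have k0 := key _ _ _ (0, EuclideanSpace.single 0 1) hP hQ hm₀ h₀
  have k1 := key _ _ _ (0, EuclideanSpace.single 1 1) hQ hR hm₁ h₁
  have k2 := key _ _ _ (1, 0) hm₀ hm₁ hρ h₂
  rw [hQ.fderiv_fderiv_comm] at k1
  rw [hm₀.fderiv_fderiv_comm, hm₁.fderiv_fderiv_comm] at k2
  linarith

end Euler

/-! ### The fluid equations on time slices. -/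

section FlowSlices

open Metric

variable {γ : ℝ} {l u v : ℝ × Plane → ℝ} {y n : ℝ × Plane → Space} {U : Set (ℝ × Plane)} {t : ℝ}
  {x : Plane}

theorem compressibleEulerAt_of_primitive (hγ : γ ≠ 0) (hl : AnalyticAt ℝ l (t, x))
    (hu : AnalyticAt ℝ u (t, x)) (hv : AnalyticAt ℝ v (t, x))
    (h : PrimitiveEulerAt γ l u v (t, x)) :
    CompressibleEulerAt γ (fun t x => Real.exp (l (t, x))) (fun t x => u (t, x))
      (fun t x => v (t, x)) t x := by
  obtain ⟨h0, h1, h2⟩ := h.conservative hγ hl.differentiableAt hu.differentiableAt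
    hv.differentiableAt
  rw [← pd_slice 0 (hl.normalFlux hu).differentiableAt,
    ← pd_slice 1 (hl.shearFlux hu hv).differentiableAt,
    ← deriv_slice (hl.momentum hu).differentiableAt] at h0
  rw [← pd_slice 0 (hl.shearFlux hu hv).differentiableAt,
    ← pd_slice 1 (hl.normalFlux hv).differentiableAt,
    ← deriv_slice (hl.momentum hv).differentiableAt] at h1
  rw [← pd_slice 0 (hl.momentum hu).differentiableAt,
    ← pd_slice 1 (hl.momentum hv).differentiableAt,
    ← deriv_slice hl.rexp'.differentiableAt] at h2
  exact ⟨h0, h1, h2⟩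

/-- Since `N₁ - M₂` is the flux `∂₁(ρu² + p) + ∂₂(ρuv)`, Euler identifies it with `-∂ₜ(ρu)`, while
Codazzi expresses it by Christoffel symbols; likewise `M₁ - L₂ = ∂ₜ(ρv)`. -/
theorem geometricFlowAt_of_primitive (hγ : γ ≠ 0) (hU : IsOpen U) (hx : (t, x) ∈ U)
    (hl : AnalyticOnNhd ℝ l U) (hu : AnalyticOnNhd ℝ u U) (hv : AnalyticOnNhd ℝ v U)
    (h : ∀ z ∈ U, PrimitiveEulerAt γ l u v z) {g : ℝ → Plane → Matrix (Fin 2) (Fin 2) ℝ}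
    (hg : GaussCodazziAt (g t) (fun x => normalFlux γ l v (t, x))
      (fun x => -shearFlux l u v (t, x)) (fun x => normalFlux γ l u (t, x)) x) :
    GeometricFlowAt γ (fun t x => Real.exp (l (t, x))) (fun t x => u (t, x))
      (fun t x => v (t, x)) g t x := by
  have hlx := hl _ hx
  have hux := hu _ hx
  have hvx := hv _ hx
  have hE := compressibleEulerAt_of_primitive hγ hlx hux hvx (h _ hx)
  have hneg : ∀ i, pd i (fun x => -shearFlux l u v (t, x)) x =
      -pd i (fun x => shearFlux l u v (t, x)) x := fun i => by
    rw [pd, fderiv_fun_neg]; rfl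
  have hc := fun z hz => (h z hz).conservative hγ (hl z hz).differentiableAt
    (hu z hz).differentiableAt (hv z hz).differentiableAt
  refine ⟨Fin.forall_fin_two.2 ⟨?_, ?_⟩, ?_⟩
  · have h1 := hg.codazzi_one
    have h2 := hE.momentum_one
    rw [hneg] at h1
    change pd 0 (fun x => normalFlux γ l u (t, x)) x + pd 1 (fun x => shearFlux l u v (t, x)) x =
      -deriv (fun s => Real.exp (l (s, x)) * u (s, x)) t at h2
    change deriv (fun s => Real.exp (l (s, x)) * u (s, x)) t =
      christoffel (g t) 0 1 1 x * normalFlux γ l v (t, x) -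
        2 * christoffel (g t) 0 0 1 x * -shearFlux l u v (t, x) +
        christoffel (g t) 0 0 0 x * normalFlux γ l u (t, x)
    linarith
  · have h1 := hg.codazzi_two
    have h2 := hE.momentum_two
    rw [hneg] at h1
    change pd 0 (fun x => shearFlux l u v (t, x)) x + pd 1 (fun x => normalFlux γ l v (t, x)) x =
      -deriv (fun s => Real.exp (l (s, x)) * v (s, x)) t at h2
    change deriv (fun s => Real.exp (l (s, x)) * v (s, x)) t =
      christoffel (g t) 1 1 1 x * normalFlux γ l v (t, x) -
        2 * christoffel (g t) 1 0 1 x * -shearFlux l u v (t, x) +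
        christoffel (g t) 1 0 0 x * normalFlux γ l u (t, x)
    linarith
  · have hd := divergence_of_conservative hU hx (hlx.normalFlux hux) (hlx.shearFlux hux hvx)
      (hlx.normalFlux hvx) (hlx.momentum hux) (hlx.momentum hvx) hlx.rexp'
      (fun z hz => (hc z hz).1) (fun z hz => (hc z hz).2.1) (fun z hz => (hc z hz).2.2)
    rw [← pd_pd_slice 0 0 (hlx.normalFlux hux), ← pd_pd_slice 0 1 (hlx.shearFlux hux hvx),
      ← pd_pd_slice 1 1 (hlx.normalFlux hvx), ← deriv_deriv_slice hlx.rexp'] at hd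
    have hM : pd 0 (pd 1 fun x => -shearFlux l u v (t, x)) x =
        -pd 0 (pd 1 fun x => shearFlux l u v (t, x)) x := by
      have : (pd 1 fun x => -shearFlux l u v (t, x)) =
          fun x => -pd 1 (fun x => shearFlux l u v (t, x)) x := by
        ext x; rw [pd, fderiv_fun_neg]; rfl
      rw [this, pd, fderiv_fun_neg]; rfl
    change pd 0 (pd 0 fun x => normalFlux γ l u (t, x)) x -
      2 * pd 0 (pd 1 fun x => -shearFlux l u v (t, x)) x +
      pd 1 (pd 1 fun x => normalFlux γ l v (t, x)) x = _
    rw [hM, ← hd]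
    ring

/-- In `LN - M²` the terms `ρ²u²v²` cancel, leaving `p² + pρ(u² + v²)`. -/
theorem curvatureDensity_of_det {V : Type*} {l u v : V → ℝ} {κ : ℝ} {z : V}
    (h : normalFlux γ l v z * normalFlux γ l u z - (-shearFlux l u v z) ^ 2 = κ) :
    CurvatureDensity γ (Real.exp (l z)) (u z) (v z) κ := by
  rw [CurvatureDensity, ← h, normalFlux, normalFlux, shearFlux, pressure,
    Real.rpow_add_one (Real.exp_ne_zero _)]
  ring

theorem mk_mem_ball_iff {x₀ : Plane} {δ : ℝ} :
    (t, x) ∈ ball ((0 : ℝ), x₀) δ ↔ t ∈ Set.Ioo (-δ) δ ∧ x ∈ ball x₀ δ := by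
  rw [← ball_prod_same, Set.mem_prod, Real.ball_eq_Ioo, zero_sub, zero_add]

theorem isWeingartenOn_slice {L M N : ℝ × Plane → ℝ} {x₀ : Plane} {δ : ℝ}
    (ht : t ∈ Set.Ioo (-δ) δ) (hy : AnalyticOnNhd ℝ y (ball (0, x₀) δ))
    (hn : AnalyticOnNhd ℝ n (ball (0, x₀) δ)) (hL : AnalyticOnNhd ℝ L (ball (0, x₀) δ))
    (hM : AnalyticOnNhd ℝ M (ball (0, x₀) δ)) (hN : AnalyticOnNhd ℝ N (ball (0, x₀) δ))
    (h : ∀ z ∈ ball ((0 : ℝ), x₀) δ,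
        inner ℝ (n z) (n z) = (1 : ℝ) ∧
        (∀ i, inner ℝ (n z) (fderiv ℝ y z (0, EuclideanSpace.single i 1)) = (0 : ℝ)) ∧
        fderiv ℝ n z (0, EuclideanSpace.single 0 1) =
          cross (n z) (L z • fderiv ℝ y z (0, EuclideanSpace.single 1 1) -
            M z • fderiv ℝ y z (0, EuclideanSpace.single 0 1)) ∧
        fderiv ℝ n z (0, EuclideanSpace.single 1 1) =
          cross (n z) (M z • fderiv ℝ y z (0, EuclideanSpace.single 1 1) -
            N z • fderiv ℝ y z (0, EuclideanSpace.single 0 1)) ∧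
        0 < inner ℝ (n z) (cross (fderiv ℝ y z (0, EuclideanSpace.single 0 1))
          (fderiv ℝ y z (0, EuclideanSpace.single 1 1)))) :
    IsWeingartenOn (fun x => y (t, x)) (fun x => n (t, x)) (fun x => L (t, x))
      (fun x => M (t, x)) (fun x => N (t, x)) (ball x₀ δ) := by
  have hm : ∀ x ∈ ball x₀ δ, (t, x) ∈ ball ((0 : ℝ), x₀) δ := fun x hx => mk_mem_ball_iff.2 ⟨ht, hx⟩
  have ha : ∀ {F : Type} [NormedAddCommGroup F] [NormedSpace ℝ F] {f : ℝ × Plane → F},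
      AnalyticOnNhd ℝ f (ball (0, x₀) δ) → AnalyticOnNhd ℝ (fun x => f (t, x)) (ball x₀ δ) :=
    fun hf x hx => AnalyticAt.fun_comp (hf _ (hm x hx)) (analyticAt_const.prod analyticAt_id)
  have hyd : ∀ x ∈ ball x₀ δ, ∀ i, pd i (fun x => y (t, x)) x =
      fderiv ℝ y (t, x) (0, EuclideanSpace.single i 1) := fun x hx i =>
    pd_slice i (hy _ (hm x hx)).differentiableAt
  have hnd : ∀ x ∈ ball x₀ δ, ∀ i, pd i (fun x => n (t, x)) x =
      fderiv ℝ n (t, x) (0, EuclideanSpace.single i 1) := fun x hx i =>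
    pd_slice i (hn _ (hm x hx)).differentiableAt
  refine { isOpen := isOpen_ball, surface := ha hy, normal := ha hn, analytic_L := ha hL,
           analytic_M := ha hM, analytic_N := ha hN, unit := ?_, orthogonal := ?_, pos := ?_,
           normal_zero := ?_, normal_one := ?_ } <;> intro x hx <;>
    obtain ⟨h1, h2, h3, h4, h5⟩ := h _ (hm x hx) <;> try simp only [hyd x hx, hnd x hx]
  exacts [h1, h2, h5, h3, h4]

end FlowSlices

/-! ### Assembly of the flow and the surfaces. -/

theorem theorem8p1 (γ : ℝ) (hγ : 1 ≤ γ) (x₀ : Plane) (ρ₀ u₀ v₀ κ₀ : Plane → ℝ)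
    (hρ₀ : AnalyticAt ℝ ρ₀ x₀) (hu₀ : AnalyticAt ℝ u₀ x₀) (hv₀ : AnalyticAt ℝ v₀ x₀)
    (hdensity : 0 ≤ ρ₀ x₀) (hne : ρ₀ x₀ * u₀ x₀ * v₀ x₀ ≠ 0)
    (hκ₀ : ∀ᶠ x in 𝓝 x₀, CurvatureDensity γ (ρ₀ x) (u₀ x) (v₀ x) (κ₀ x)) :
    ∃ T > 0, ∃ r > 0, ∃ (ρ u v : ℝ → Plane → ℝ) (g : ℝ → Plane → Matrix (Fin 2) (Fin 2) ℝ)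
      (y : ℝ → Plane → Space),
      -- everything is analytic in space-time
      AnalyticOnNhd ℝ (fun z : ℝ × Plane => ρ z.1 z.2) (Set.Ioo (-T) T ×ˢ Metric.ball x₀ r) ∧
      AnalyticOnNhd ℝ (fun z : ℝ × Plane => u z.1 z.2) (Set.Ioo (-T) T ×ˢ Metric.ball x₀ r) ∧
      AnalyticOnNhd ℝ (fun z : ℝ × Plane => v z.1 z.2) (Set.Ioo (-T) T ×ˢ Metric.ball x₀ r) ∧
      (∀ i j, AnalyticOnNhd ℝ (fun z : ℝ × Plane => g z.1 z.2 i j)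
        (Set.Ioo (-T) T ×ˢ Metric.ball x₀ r)) ∧
      AnalyticOnNhd ℝ (fun z : ℝ × Plane => y z.1 z.2) (Set.Ioo (-T) T ×ˢ Metric.ball x₀ r) ∧
      -- the initial data are attained
      (∀ x ∈ Metric.ball x₀ r, ρ 0 x = ρ₀ x ∧ u 0 x = u₀ x ∧ v 0 x = v₀ x ∧
        gaussCurvature (g 0) x = κ₀ x) ∧
      ∀ t ∈ Set.Ioo (-T) T,
        -- the surface at time `t`
        IsIsometricImmersionOn (g t) (y t) (Metric.ball x₀ r) ∧
        ∀ x ∈ Metric.ball x₀ r,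
          0 < ρ t x ∧
          CompressibleEulerAt γ ρ u v t x ∧
          GaussCodazziAt (g t) (formL γ (ρ t) (u t) (v t)) (formM (ρ t) (u t) (v t))
            (formN γ (ρ t) (u t) (v t)) x ∧
          GeometricFlowAt γ ρ u v g t x ∧
          CurvatureDensity γ (ρ t x) (u t x) (v t x) (gaussCurvature (g t) x) ∧
          -- the second fundamental form of the surface is the one given by the fluid
          secondForm (y t) 0 0 x = √(g t x).det * formL γ (ρ t) (u t) (v t) x ∧
          secondForm (y t) 0 1 x = √(g t x).det * formM (ρ t) (u t) (v t) x ∧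
          secondForm (y t) 1 1 x = √(g t x).det * formN γ (ρ t) (u t) (v t) x := by
  have hγ0 : γ ≠ 0 := (zero_lt_one.trans_le hγ).ne'
  have hρpos : 0 < ρ₀ x₀ := lt_of_le_of_ne hdensity fun h => hne (by simp [← h])
  obtain ⟨δ₁, hδ₁, l, u, v, hl, hu, hv, h0, hE⟩ :=
    exists_euler_solution γ (ℓ₀ := fun x => Real.log (ρ₀ x))
      ((analyticAt_id.log hρpos).comp hρ₀) hu₀ hv₀
  have hmem : ((0 : ℝ), x₀) ∈ Metric.ball ((0 : ℝ), x₀) δ₁ := Metric.mem_ball_self hδ₁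
  have hN0 : 0 < normalFlux γ l u (0, x₀) := by
    unfold normalFlux pressure
    have : 0 < γ := zero_lt_one.trans_le hγ
    positivity
  obtain ⟨δ₂, hδ₂, y, n, hy, hn, hS⟩ := exists_surface
    ((hl _ hmem).normalFlux (γ := γ) (hv _ hmem))
    ((hl _ hmem).shearFlux (hu _ hmem) (hv _ hmem)).fun_neg
    ((hl _ hmem).normalFlux (γ := γ) (hu _ hmem)) hN0
  -- The solution starts from `Real.log (ρ₀ x)`, which returns `ρ₀` only where `ρ₀` is positive; the
  -- disc is shrunk accordingly.
  obtain ⟨δ₃, hδ₃, hinit⟩ := Metric.eventually_nhds_iff_ball.1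
    (hκ₀.and (hρ₀.continuousAt.eventually (lt_mem_nhds hρpos)))
  set δ := min δ₁ (min δ₂ δ₃) with hδ
  have hδ0 : 0 < δ := lt_min hδ₁ (lt_min hδ₂ hδ₃)
  have hs₁ : Metric.ball ((0 : ℝ), x₀) δ ⊆ Metric.ball (0, x₀) δ₁ :=
    Metric.ball_subset_ball (min_le_left _ _)
  have hs₂ : Metric.ball ((0 : ℝ), x₀) δ ⊆ Metric.ball (0, x₀) δ₂ :=
    Metric.ball_subset_ball ((min_le_right _ _).trans (min_le_left _ _))
  have hs₃ : Metric.ball x₀ δ ⊆ Metric.ball x₀ δ₃ :=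
    Metric.ball_subset_ball ((min_le_right _ _).trans (min_le_right _ _))
  have hdom : Set.Ioo (-δ) δ ×ˢ Metric.ball x₀ δ = Metric.ball ((0 : ℝ), x₀) δ := by
    ext ⟨t, x⟩; exact mk_mem_ball_iff.symm
  replace hl := hl.mono hs₁
  replace hu := hu.mono hs₁
  replace hv := hv.mono hs₁
  replace hy := hy.mono hs₂
  replace hn := hn.mono hs₂
  have hW : ∀ t ∈ Set.Ioo (-δ) δ, IsWeingartenOn (fun x => y (t, x)) (fun x => n (t, x))
      (fun x => normalFlux γ l v (t, x)) (fun x => -shearFlux l u v (t, x))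
      (fun x => normalFlux γ l u (t, x)) (Metric.ball x₀ δ) := fun t ht =>
    isWeingartenOn_slice ht hy hn (fun z hz => (hl z hz).normalFlux (hv z hz))
      (fun z hz => ((hl z hz).shearFlux (hu z hz) (hv z hz)).fun_neg)
      (fun z hz => (hl z hz).normalFlux (hu z hz)) fun z hz => hS z (hs₂ hz)
  have hCD : ∀ t ∈ Set.Ioo (-δ) δ, ∀ x ∈ Metric.ball x₀ δ,
      CurvatureDensity γ (Real.exp (l (t, x))) (u (t, x)) (v (t, x))
        (gaussCurvature (firstForm fun x => y (t, x)) x) := fun t ht x hx =>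
    curvatureDensity_of_det ((hW t ht).gauss_equation hx)
  refine ⟨δ, hδ0, δ, hδ0, fun t x => Real.exp (l (t, x)), fun t x => u (t, x),
    fun t x => v (t, x), fun t => firstForm fun x => y (t, x), fun t x => y (t, x), ?_⟩
  rw [hdom]
  refine ⟨fun z hz => (hl z hz).rexp', hu, hv, fun i j => ?_, hy, fun x hx => ?_, fun t ht =>
    ⟨(hW t ht).isIsometricImmersionOn, fun x hx => ?_⟩⟩
  · refine AnalyticOnNhd.congr (f := fun z => inner ℝ
      (fderiv ℝ y z (0, EuclideanSpace.single i 1)) (fderiv ℝ y z (0, EuclideanSpace.single j 1)))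
      Metric.isOpen_ball (fun z hz => ((hy z hz).fderiv_apply _).inner_space
        ((hy z hz).fderiv_apply _)) fun z hz => ?_
    dsimp only
    rw [firstForm_apply, pd_slice i (hy z hz).differentiableAt,
      pd_slice j (hy z hz).differentiableAt]
  · obtain ⟨hκ, hpos⟩ := hinit x (hs₃ hx)
    have hr : Real.exp (l (0, x)) = ρ₀ x := by rw [(h0 x).1, Real.exp_log hpos]
    -- At `t = 0` the relation expresses both the Gauss curvature and `κ₀` by the same initial data,
    -- so they coincide.
    have hc := hCD 0 ⟨neg_lt_zero.2 hδ0, hδ0⟩ x hx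
    rw [hr, (h0 x).2.1, (h0 x).2.2] at hc
    exact ⟨hr, (h0 x).2.1, (h0 x).2.2, hc.symm.trans hκ⟩
  · have hz : (t, x) ∈ Metric.ball ((0 : ℝ), x₀) δ := mk_mem_ball_iff.2 ⟨ht, hx⟩
    have hG := (hW t ht).gaussCodazziAt hx
    have hP : ∀ z ∈ Metric.ball ((0 : ℝ), x₀) δ, PrimitiveEulerAt γ l u v z :=
      fun z hz => hE z (hs₁ hz)
    exact ⟨Real.exp_pos _, compressibleEulerAt_of_primitive hγ0 (hl _ hz) (hu _ hz) (hv _ hz)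
      (hP _ hz), hG, geometricFlowAt_of_primitive hγ0 Metric.isOpen_ball hz hl hu hv hP
        (g := fun t => firstForm fun x => y (t, x)) hG, hCD t ht x hx, (hW t ht).secondForm_eq hx⟩
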